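/- Conventions. The asynchronous, choice-free $\pi$-calculus has processes $P ::= 0 \mid P_1|P_2 \mid x(y).P \mid \bar x z \mid \nu x\,P \mid {!P}$ over a countably infinite set of atomic names, with the usual structural congruence $\equiv$ (including $\nu x\,0\equiv 0$, $\nu x\,\nu y\,P\equiv\nu y\,\nu x\,P$, $!P\equiv P|{!P}$, and scope extrusion) and reduction $x(y).P\mid\bar x z\to P\{z/y\}$, closed under parallel composition, restriction and $\equiv$. The $\rho$-calculus has processes $P ::= 0 \mid P_1|P_2 \mid x\langle\!|P|\!\rangle \mid x(y).P \mid {*x}$ whose names are quoted processes $\ulcorner P\urcorner$. Structural congruence (the least congruence with the abelian monoid laws of $|$ and $0$, $\alpha$-conversion, and name equivalence in name positions) and name equivalence $\equiv_{\mathcal N}$ (the least equivalence with $\ulcorner P_1\urcorner\equiv_{\mathcal N}\ulcorner P_2\urcorner$ if $P_1\equiv P_2$, and $\ulcorner {*x_1}\urcorner\equiv_{\mathcal N}x_2$ if $x_1\equiv_{\mathcal N}x_2$) are defined together. Reduction is $x_1(y).P_1\mid x_2\langle\!|P_2|\!\rangle\to P_1\{\ulcorner P_2\urcorner/y\}$ for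 $x_1\equiv_{\mathcal N}x_2$, closed under parallel composition and $\equiv$, where the substitution turns $*y$ into $P_2$ and does not enter quotes. In both calculi $P\Downarrow\bar x$ means that some reduct of $P$ (in zero or more steps) has an unguarded output on $x$; $\approx$ is weak barbed bisimilarity (input and output barbs) in $\pi$, and $\approx^{N}$ is weak barbed bisimilarity in $\rho$ with barbs restricted to the names (up to $\equiv_{\mathcal N}$) in $N$. Let $\varphi$ map $\pi$-names to $\rho$-names so that $\varphi(a)\equiv_{\mathcal N}\varphi(b)$ implies $a=b$; free $\pi$-names are identified with their images. Put ${}^+x=\ulcorner x\langle\!|0|\!\rangle\urcorner$, $x^+=\ulcorner x(\ulcorner0\urcorner).0\urcorner$, $x\circ y=\ulcorner x\langle\!|0|\!\rangle\mid y(\ulcorner0\urcorner).0\urcorner$, $\bar x y=x\langle\!|{*y}|\!\rangle$ and $D_x=x(y).({*y}\mid x\langle\!|{*y}|\!\rangle)$ in $\rho$. The Meredith--Radestock encoding is $[\![P]\!]=[\![P]\!](n_0,p_0)$ with $n_0=\ulcorner\prod_{x\in fn(P)}x\langle\!|0|\!\rangle\urcorner$, $p_0=\ulcorner\prod_{x\in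 fn(P)}x(\ulcorner0\urcorner).0\urcorner$, where (bound names being chosen to avoid clashes) $$[\![0]\!](n,p)=0,\quad [\![\bar x y]\!](n,p)=\bar x y,\quad [\![x(y).P]\!](n,p)=x(y).[\![P]\!](n,p),$$ $$[\![P_1|P_2]\!](n,p)=[\![P_1]\!]({}^+n,{}^+p)\mid[\![P_2]\!](n^+,p^+),\quad [\![\nu x\,P]\!](n,p)=p(x).[\![P]\!]({}^+n,{}^+p)\mid\bar p n,$$ $$[\![!P]\!](n,p)=(n\circ p)\langle\!|\,n^+(n).p^+(p).([\![P]\!](n,p)\mid D_{n\circ p}\mid n^+\langle\!|\bar n n|\!\rangle\mid p^+\langle\!|\bar p p|\!\rangle)\,|\!\rangle\mid D_{n\circ p}\mid\overline{n^+}\,{}^+n\mid\overline{p^+}\,{}^+p.$$ For distinct names $u,x$ and any name $o$ let $C[P]=P\mid u(n_1).u(n_2).(\bar n_1 o\mid n_2(y).\bar x o)$ (the object $o$ and the bound name $y$ play no role). Theorem. For every such $\varphi$: (1) Let $Q$ be any $\pi$-process without restriction operators such that $u,x\notin fn(Q)$, and let $z\notin fn(Q)\cup\{u\}$. Put $P_1'={!((\nu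 z\,\bar u z)\mid Q)}$ and $P_2'=\nu z\,{!(\bar u z\mid Q)}$. Then $C[P_1']\not\Downarrow\bar x$ and $C[P_2']\Downarrow\bar x$, so $C[P_1']\not\approx C[P_2']$; but $[\![C[P_1']]\!]\approx^{fn(C[P_1'])\cup fn(C[P_2'])}[\![C[P_2']]\!]$. (2) Let $P_1={!\nu z\,\bar u z}$ and $P_2={!\nu q\,\nu z\,\bar u z}$, with $u,z,q$ distinct. Then $P_1\equiv P_2$, $P_1\approx P_2$ and $C[P_1]\approx C[P_2]$; but $[\![C[P_1]]\!]\not\approx^{fn(C[P_1])\cup fn(C[P_2])}[\![C[P_2]]\!]$. Consequently both implications of the claimed full abstraction, $P_1\approx P_2\iff[\![P_1]\!]\approx^{fn(P_1)\cup fn(P_2)}[\![P_2]\!]$ for all $\pi$-processes $P_1,P_2$, fail. -/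

import Mathlib

/-! ## Behavioural equivalence, for any reduction relation and observation predicate -/

/-- Observable actions: input on `x` (written `x`), output on `x` (written `x̄`). -/
inductive Obs (α : Type) : Type
  | inp (x : α) : Obs α
  | out (x : α) : Obs α

/-- The weak observation predicate `P ⇓ o`. -/
def WeakBarb {Proc α : Type} (step : Proc → Proc → Prop) (barb : Proc → Obs α → Prop)
    (P : Proc) (o : Obs α) : Prop :=
  ∃ P', Relation.ReflTransGen step P P' ∧ barb P' o

/-- Weak barbed bisimulations. -/
structure IsWeakBarbedBisimulation {Proc α : Type} (step : Proc → Proc → Prop)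
    (barb : Proc → Obs α → Prop) (R : Proc → Proc → Prop) : Prop where
  symm : ∀ P₁ P₂, R P₁ P₂ → R P₂ P₁
  red : ∀ P₁ P₂, R P₁ P₂ → ∀ P₁', step P₁ P₁' →
    ∃ P₂', Relation.ReflTransGen step P₂ P₂' ∧ R P₁' P₂'
  obs : ∀ P₁ P₂, R P₁ P₂ → ∀ o, barb P₁ o → WeakBarb step barb P₂ o

/-- Weak barbed bisimilarity. -/
def WeakBarbedBisimilar {Proc α : Type} (step : Proc → Proc → Prop)
    (barb : Proc → Obs α → Prop) (P₁ P₂ : Proc) : Prop :=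
  ∃ R, IsWeakBarbedBisimulation step barb R ∧ R P₁ P₂

/-! ## The asynchronous, choice-free pi-calculus

Processes are represented up to change of bound names: a bound name is a de Bruijn index
(`0` is the innermost binder), a free name is one of the countably many atomic names `a : ℕ`.
`PiProc k` is the type of processes with `k` bound names in scope; the processes proper are
the elements of `PiProc 0`. -/

inductive PiName (k : ℕ) : Type
  | free (a : ℕ) : PiName k
  | bound (i : Fin k) : PiName k

/-- `inp x P` is `x(y).P` and `res P` is `νy P`, where `y` is the index `0` of `P`. -/
inductive PiProc : ℕ → Type
  | nil {k : ℕ} : PiProc k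
  | par {k : ℕ} (P Q : PiProc k) : PiProc k
  | inp {k : ℕ} (x : PiName k) (P : PiProc (k + 1)) : PiProc k
  | out {k : ℕ} (x z : PiName k) : PiProc k
  | res {k : ℕ} (P : PiProc (k + 1)) : PiProc k
  | repl {k : ℕ} (P : PiProc k) : PiProc k

/-- Put a name under one more binder. -/
def PiName.shift {k : ℕ} : PiName k → PiName (k + 1)
  | .free a => .free a
  | .bound i => .bound i.succ

/-- Extend a map of names under a binder, fixing the new bound name. -/
def PiName.under {k m : ℕ} (f : PiName k → PiName m) : PiName (k + 1) → PiName (m + 1)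
  | .free a => (f (.free a)).shift
  | .bound i => Fin.cases (.bound 0) (fun j => (f (.bound j)).shift) i

/-- Simultaneous capture-avoiding substitution of names for names. -/
def PiProc.map : {k m : ℕ} → (PiName k → PiName m) → PiProc k → PiProc m
  | _, _, _, .nil => .nil
  | _, _, f, .par P Q => .par (P.map f) (Q.map f)
  | _, _, f, .inp x P => .inp (f x) (P.map (PiName.under f))
  | _, _, f, .out x z => .out (f x) (f z)
  | _, _, f, .res P => .res (P.map (PiName.under f))
  | _, _, f, .repl P => .repl (P.map f)

/-- `P` seen under one more binder, whose name does not occur in `P`. -/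
def PiProc.weaken {k : ℕ} (P : PiProc k) : PiProc (k + 1) := P.map PiName.shift

/-- Replace the innermost bound name by `z`, on names. -/
def PiName.inst {k : ℕ} (z : PiName k) : PiName (k + 1) → PiName k
  | .free a => .free a
  | .bound i => Fin.cases z (fun j => .bound j) i

/-- `P{z/y}`, where `y` is the innermost bound name. -/
def PiProc.subst {k : ℕ} (P : PiProc (k + 1)) (z : PiName k) : PiProc k := P.map (PiName.inst z)

/-- Exchange the two innermost bound names. -/
def PiName.swap {k : ℕ} : PiName (k + 2) → PiName (k + 2)
  | .free a => .free a
  | .bound i => .bound (Equiv.swap 0 1 i)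

/-- Free names. -/
def PiName.fn {k : ℕ} : PiName k → Finset ℕ
  | .free a => {a}
  | .bound _ => ∅

def PiProc.fn : {k : ℕ} → PiProc k → Finset ℕ
  | _, .nil => ∅
  | _, .par P Q => P.fn ∪ Q.fn
  | _, .inp x P => x.fn ∪ P.fn
  | _, .out x z => x.fn ∪ z.fn
  | _, .res P => P.fn
  | _, .repl P => P.fn

/-- `P` does not contain the restriction operator. -/
def PiProc.NuFree : {k : ℕ} → PiProc k → Prop
  | _, .nil => True
  | _, .par P Q => P.NuFree ∧ Q.NuFree
  | _, .inp _ P => P.NuFree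
  | _, .out _ _ => True
  | _, .res _ => False
  | _, .repl P => P.NuFree

/-- Structural congruence (change of bound names is built into the representation). -/
inductive PiStruct : {k : ℕ} → PiProc k → PiProc k → Prop
  | refl {k : ℕ} (P : PiProc k) : PiStruct P P
  | symm {k : ℕ} {P Q : PiProc k} : PiStruct P Q → PiStruct Q P
  | trans {k : ℕ} {P Q R : PiProc k} : PiStruct P Q → PiStruct Q R → PiStruct P R
  | par {k : ℕ} {P P' Q Q' : PiProc k} :
      PiStruct P P' → PiStruct Q Q' → PiStruct (.par P Q) (.par P' Q')
  | inp {k : ℕ} (x : PiName k) {P P' : PiProc (k + 1)} :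
      PiStruct P P' → PiStruct (.inp x P) (.inp x P')
  | res {k : ℕ} {P P' : PiProc (k + 1)} : PiStruct P P' → PiStruct (.res P) (.res P')
  | repl {k : ℕ} {P P' : PiProc k} : PiStruct P P' → PiStruct (.repl P) (.repl P')
  | par_nil {k : ℕ} (P : PiProc k) : PiStruct (.par P .nil) P
  | par_comm {k : ℕ} (P Q : PiProc k) : PiStruct (.par P Q) (.par Q P)
  | par_assoc {k : ℕ} (P Q R : PiProc k) :
      PiStruct (.par (.par P Q) R) (.par P (.par Q R))
  | res_nil {k : ℕ} : PiStruct (.res (.nil : PiProc (k + 1))) .nil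
  | res_swap {k : ℕ} (P : PiProc (k + 2)) :
      PiStruct (.res (.res P)) (.res (.res (P.map PiName.swap)))
  | repl_unfold {k : ℕ} (P : PiProc k) : PiStruct (.repl P) (.par P (.repl P))
  | res_par {k : ℕ} (P : PiProc (k + 1)) (Q : PiProc k) :
      PiStruct (.par (.res P) Q) (.res (.par P Q.weaken))

/-- Reduction. -/
inductive PiRed : {k : ℕ} → PiProc k → PiProc k → Prop
  | com {k : ℕ} (x z : PiName k) (P : PiProc (k + 1)) :
      PiRed (.par (.inp x P) (.out x z)) (P.subst z)
  | par {k : ℕ} {P P' : PiProc k} (Q : PiProc k) : PiRed P P' → PiRed (.par P Q) (.par P' Q)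
  | res {k : ℕ} {P P' : PiProc (k + 1)} : PiRed P P' → PiRed (.res P) (.res P')
  | struct {k : ℕ} {P₁ P₁' P₂' P₂ : PiProc k} :
      PiStruct P₁ P₁' → PiRed P₁' P₂' → PiStruct P₂' P₂ → PiRed P₁ P₂

/-- The `N`-restricted observation predicate. Only free names are ever observed, so under a
restriction the observed name differs from the restricted one. -/
inductive PiBarb (N : Set ℕ) : {k : ℕ} → PiProc k → Obs ℕ → Prop
  | out {k : ℕ} {x : ℕ} (z : PiName k) : x ∈ N → PiBarb N (.out (.free x) z) (.out x)
  | inp {k : ℕ} {x : ℕ} (P : PiProc (k + 1)) : x ∈ N → PiBarb N (.inp (.free x) P) (.inp x)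
  | par_left {k : ℕ} {P : PiProc k} (Q : PiProc k) {o : Obs ℕ} :
      PiBarb N P o → PiBarb N (.par P Q) o
  | par_right {k : ℕ} (P : PiProc k) {Q : PiProc k} {o : Obs ℕ} :
      PiBarb N Q o → PiBarb N (.par P Q) o
  | res {k : ℕ} {P : PiProc (k + 1)} {o : Obs ℕ} : PiBarb N P o → PiBarb N (.res P) o
  | repl {k : ℕ} {P : PiProc k} {o : Obs ℕ} : PiBarb N P o → PiBarb N (.repl P) o

/-- `P ⇓ o` in the pi-calculus, all names being observable. -/
def PiWeakBarb (P : PiProc 0) (o : Obs ℕ) : Prop :=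
  WeakBarb (PiRed (k := 0)) (PiBarb Set.univ (k := 0)) P o

/-- Weak barbed bisimilarity in the pi-calculus, all names being observable. -/
def PiWeakBisim (P₁ P₂ : PiProc 0) : Prop :=
  WeakBarbedBisimilar (PiRed (k := 0)) (PiBarb Set.univ (k := 0)) P₁ P₂

/-! ## The reflective higher-order calculus

A name is a quoted process. Again processes are represented up to change of bound names:
`RhoProc k` has `k` bound names in scope, and a name position holds either a de Bruijn index
or a name `⌜P⌝`. A quoted process is always closed (`P : RhoProc 0`), because neither binding
nor substitution reaches under quotes. The input `x(y).P` with a given name `y` as binder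
is `RhoProc.inputBinding` below. -/

mutual
/-- `lift x P` is the lift of `P` on `x`, `inp x P` is the input `x(y).P` (`y` is the
index `0` of `P`), and `drop x` is the drop of `x`. -/
inductive RhoProc : ℕ → Type
  | nil {k : ℕ} : RhoProc k
  | par {k : ℕ} (P Q : RhoProc k) : RhoProc k
  | lift {k : ℕ} (x : RhoRef k) (P : RhoProc k) : RhoProc k
  | inp {k : ℕ} (x : RhoRef k) (P : RhoProc (k + 1)) : RhoProc k
  | drop {k : ℕ} (x : RhoRef k) : RhoProc k
/-- What may stand in a name position: a bound name or a (free) name. -/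
inductive RhoRef : ℕ → Type
  | bound {k : ℕ} (i : Fin k) : RhoRef k
  | name {k : ℕ} (x : RhoName) : RhoRef k
/-- Names: quoted processes. -/
inductive RhoName : Type
  | quote (P : RhoProc 0) : RhoName
end

mutual
/-- Structural congruence. The rule for input compares the bodies with the same (fresh) name,
the index `0`, in place of the two bound names. -/
inductive RhoStruct : {k : ℕ} → RhoProc k → RhoProc k → Prop
  | refl {k : ℕ} (P : RhoProc k) : RhoStruct P P
  | symm {k : ℕ} {P Q : RhoProc k} : RhoStruct P Q → RhoStruct Q P
  | trans {k : ℕ} {P Q R : RhoProc k} : RhoStruct P Q → RhoStruct Q R → RhoStruct P R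
  | par {k : ℕ} {P P' Q Q' : RhoProc k} :
      RhoStruct P P' → RhoStruct Q Q' → RhoStruct (.par P Q) (.par P' Q')
  | lift {k : ℕ} {x x' : RhoRef k} {P P' : RhoProc k} :
      RhoRefEq x x' → RhoStruct P P' → RhoStruct (.lift x P) (.lift x' P')
  | inp {k : ℕ} {x x' : RhoRef k} {P P' : RhoProc (k + 1)} :
      RhoRefEq x x' → RhoStruct P P' → RhoStruct (.inp x P) (.inp x' P')
  | drop {k : ℕ} {x x' : RhoRef k} : RhoRefEq x x' → RhoStruct (.drop x) (.drop x')
  | par_nil {k : ℕ} (P : RhoProc k) : RhoStruct (.par P .nil) P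
  | par_comm {k : ℕ} (P Q : RhoProc k) : RhoStruct (.par P Q) (.par Q P)
  | par_assoc {k : ℕ} (P Q R : RhoProc k) :
      RhoStruct (.par (.par P Q) R) (.par P (.par Q R))
/-- Name equivalence on name positions. -/
inductive RhoRefEq : {k : ℕ} → RhoRef k → RhoRef k → Prop
  | bound {k : ℕ} (i : Fin k) : RhoRefEq (.bound i) (.bound i)
  | name {k : ℕ} {x y : RhoName} : RhoNameEq x y → RhoRefEq (k := k) (.name x) (.name y)
/-- Name equivalence: the least equivalence closed under the rules `struct` and `drop`. -/
inductive RhoNameEq : RhoName → RhoName → Prop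
  | refl (x : RhoName) : RhoNameEq x x
  | symm {x y : RhoName} : RhoNameEq x y → RhoNameEq y x
  | trans {x y z : RhoName} : RhoNameEq x y → RhoNameEq y z → RhoNameEq x z
  | struct {P Q : RhoProc 0} : RhoStruct P Q → RhoNameEq (.quote P) (.quote Q)
  | drop {x y : RhoName} : RhoNameEq x y → RhoNameEq (.quote (.drop (.name x))) y
end

/-- Put a name position under one more binder. -/
def RhoRef.shift {k : ℕ} : RhoRef k → RhoRef (k + 1)
  | .bound i => .bound i.succ
  | .name x => .name x

/-- Extend a map of name positions under a binder, fixing the new bound name. -/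
def RhoRef.under {k m : ℕ} (f : RhoRef k → RhoRef m) : RhoRef (k + 1) → RhoRef (m + 1)
  | .bound i => Fin.cases (.bound 0) (fun j => (f (.bound j)).shift) i
  | .name x => (f (.name x)).shift

/-- Simultaneous syntactic capture-avoiding substitution; it does not enter quotes. -/
def RhoProc.map : {k m : ℕ} → (RhoRef k → RhoRef m) → RhoProc k → RhoProc m
  | _, _, _, .nil => .nil
  | _, _, f, .par P Q => .par (P.map f) (Q.map f)
  | _, _, f, .lift x P => .lift (f x) (P.map f)
  | _, _, f, .inp x P => .inp (f x) (P.map (RhoRef.under f))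
  | _, _, f, .drop x => .drop (f x)

/-- A closed name position seen under `k` binders. -/
def RhoRef.weaken (k : ℕ) : RhoRef 0 → RhoRef k
  | .bound i => i.elim0
  | .name x => .name x

/-- A closed process seen under `k` binders. -/
def RhoProc.weaken (k : ℕ) (P : RhoProc 0) : RhoProc k := P.map (RhoRef.weaken k)

/-- The process run by a drop whose argument is bound and has been replaced by the given
name position: the drop of a name that has just been received runs the quoted process. -/
def RhoRef.run {k : ℕ} : RhoRef k → RhoProc k
  | .bound i => .drop (.bound i)
  | .name (.quote P) => P.weaken k

/-- The semantic substitution: as `RhoProc.map` for a substitution of the bound names, but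
dropping a bound name that is replaced by `⌜P⌝` yields `P`. -/
def RhoProc.semSubst : {k m : ℕ} → (Fin k → RhoRef m) → RhoProc k → RhoProc m
  | _, _, _, .nil => .nil
  | _, _, s, .par P Q => .par (P.semSubst s) (Q.semSubst s)
  | _, _, s, .lift (.bound i) P => .lift (s i) (P.semSubst s)
  | _, _, s, .lift (.name x) P => .lift (.name x) (P.semSubst s)
  | _, _, s, .inp (.bound i) P =>
      .inp (s i) (P.semSubst (Fin.cases (.bound 0) fun j => (s j).shift))
  | _, _, s, .inp (.name x) P =>
      .inp (.name x) (P.semSubst (Fin.cases (.bound 0) fun j => (s j).shift))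
  | _, _, s, .drop (.bound i) => (s i).run
  | _, _, _, .drop (.name x) => .drop (.name x)

/-- Reduction. -/
inductive RhoRed : RhoProc 0 → RhoProc 0 → Prop
  | com {x₁ x₂ : RhoName} (P₁ : RhoProc 1) (P₂ : RhoProc 0) : RhoNameEq x₁ x₂ →
      RhoRed (.par (.inp (.name x₁) P₁) (.lift (.name x₂) P₂))
        (P₁.semSubst fun _ => .name (.quote P₂))
  | par {P P' : RhoProc 0} (Q : RhoProc 0) : RhoRed P P' → RhoRed (.par P Q) (.par P' Q)
  | struct {P₁ P₁' P₂' P₂ : RhoProc 0} :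
      RhoStruct P₁ P₁' → RhoRed P₁' P₂' → RhoStruct P₂' P₂ → RhoRed P₁ P₂

/-- The `N`-restricted observation predicate. -/
inductive RhoBarb (N : Set RhoName) : RhoProc 0 → Obs RhoName → Prop
  | out {x₁ x₂ : RhoName} (P : RhoProc 0) : RhoNameEq x₁ x₂ → x₁ ∈ N →
      RhoBarb N (.lift (.name x₁) P) (.out x₂)
  | inp {x₁ x₂ : RhoName} (P : RhoProc 1) : RhoNameEq x₁ x₂ → x₁ ∈ N →
      RhoBarb N (.inp (.name x₁) P) (.inp x₂)
  | par_left {P : RhoProc 0} (Q : RhoProc 0) {o : Obs RhoName} :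
      RhoBarb N P o → RhoBarb N (.par P Q) o
  | par_right (P : RhoProc 0) {Q : RhoProc 0} {o : Obs RhoName} :
      RhoBarb N Q o → RhoBarb N (.par P Q) o

/-- The weak `N`-restricted observation predicate. -/
def RhoWeakBarb (N : Set RhoName) (P : RhoProc 0) (o : Obs RhoName) : Prop :=
  WeakBarb RhoRed (RhoBarb N) P o

/-- Weak `N`-restricted barbed bisimilarity. -/
def RhoWeakBisim (N : Set RhoName) (P₁ P₂ : RhoProc 0) : Prop :=
  WeakBarbedBisimilar RhoRed (RhoBarb N) P₁ P₂

/-! ## The encoding of Meredith and Radestock -/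

open Classical in
/-- Bind the name `y`: every free occurrence of a name equivalent to `y` becomes the new
bound name `0`. -/
noncomputable def RhoRef.bindName {k : ℕ} (y : RhoName) : RhoRef k → RhoRef (k + 1)
  | .bound i => .bound i.succ
  | .name x => if RhoNameEq x y then .bound 0 else .name x

/-- Bind the name `y` in a process. -/
noncomputable def RhoProc.bindName {k : ℕ} (y : RhoName) (P : RhoProc k) : RhoProc (k + 1) :=
  P.map (RhoRef.bindName y)

/-- The input `x(y).P`, binding the name `y`. -/
noncomputable def RhoProc.inputBinding {k : ℕ} (x y : RhoName) (P : RhoProc k) : RhoProc k :=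
  .inp (.name x) (P.bindName y)

/-- Left increment of a name: the quote of the lift of `0` on `x`. -/
def RhoName.linc (x : RhoName) : RhoName := .quote (.lift (.name x) .nil)

/-- Right increment of a name: the quote of `x(⌜0⌝).0`. -/
def RhoName.rinc (x : RhoName) : RhoName := .quote (.inp (.name x) .nil)

/-- Composition of two names: the quote of the lift of `0` on `x` in parallel with
`y(⌜0⌝).0`. -/
def RhoName.comp (x y : RhoName) : RhoName :=
  .quote (.par (.lift (.name x) .nil) (.inp (.name y) .nil))

/-- The simulated output of `y` on `x`: the lift of the drop of `y`. -/
def RhoProc.output {k : ℕ} (x y : RhoRef k) : RhoProc k := .lift x (.drop y)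

/-- The copying process `x(y).(*y | x⟨|*y|⟩)`. -/
def RhoProc.copier {k : ℕ} (x : RhoName) : RhoProc k :=
  .inp (.name x) (.par (.drop (.bound 0)) (.lift (.name x) (.drop (.bound 0))))

/-- Names of the pi-calculus as name positions, the free ones through `φ`. -/
def PiName.toRef (φ : ℕ → RhoName) {k : ℕ} : PiName k → RhoRef k
  | .free a => .name (φ a)
  | .bound i => .bound i

/-- The translation with parameters `(n, p)`. -/
noncomputable def PiProc.trans (φ : ℕ → RhoName) :
    {k : ℕ} → PiProc k → RhoName → RhoName → RhoProc k
  | _, .nil, _, _ => .nil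
  | _, .out x y, _, _ => .output (x.toRef φ) (y.toRef φ)
  | _, .inp x P, n, p => .inp (x.toRef φ) (P.trans φ n p)
  | _, .par P₁ P₂, n, p => .par (P₁.trans φ n.linc p.linc) (P₂.trans φ n.rinc p.rinc)
  | _, .res P, n, p =>
      .par (.inp (.name p) (P.trans φ n.linc p.linc)) (.output (.name p) (.name n))
  | _, .repl P, n, p =>
      .par
        (.lift (.name (n.comp p))
          (.inputBinding n.rinc n (.inputBinding p.rinc p
            (.par (P.trans φ n p)
              (.par (.copier (n.comp p))
                (.par (.lift (.name n.rinc) (.output (.name n) (.name n)))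
                  (.lift (.name p.rinc) (.output (.name p) (.name p)))))))))
        (.par (.copier (n.comp p))
          (.par (.output (.name n.rinc) (.name n.linc))
            (.output (.name p.rinc) (.name p.linc))))

/-- Generalised parallel composition. -/
def RhoProc.parList {k : ℕ} : List (RhoProc k) → RhoProc k
  | [] => .nil
  | P :: Ps => .par P (RhoProc.parList Ps)

/-- The initial parameter `n₀`: the quote of the product of the lifts of `0` on `x`, for the
free names `x` of the process. -/
noncomputable def initN (φ : ℕ → RhoName) (S : Finset ℕ) : RhoName :=
  .quote (.parList (S.toList.map fun a => .lift (.name (φ a)) .nil))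

/-- The initial parameter `p₀`: the quote of the product of the inputs `x(⌜0⌝).0`, for the
free names `x` of the process. -/
noncomputable def initP (φ : ℕ → RhoName) (S : Finset ℕ) : RhoName :=
  .quote (.parList (S.toList.map fun a => .inp (.name (φ a)) .nil))

/-- The translation of a process, with the initial parameters. -/
noncomputable def PiProc.encode (φ : ℕ → RhoName) (P : PiProc 0) : RhoProc 0 :=
  P.trans φ (initN φ P.fn) (initP φ P.fn)

/-- The free names of `P₁` and `P₂`, implemented as names of the reflective calculus (up to
name equivalence). -/
def observableNames (φ : ℕ → RhoName) (P₁ P₂ : PiProc 0) : Set RhoName :=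
  {x | ∃ a ∈ P₁.fn ∪ P₂.fn, RhoNameEq x (φ a)}

/-- The translations of `P₁` and `P₂` are weakly barbed bisimilar, with the observations
restricted to the free names of `P₁` and `P₂`. -/
def EncodeBisim (φ : ℕ → RhoName) (P₁ P₂ : PiProc 0) : Prop :=
  RhoWeakBisim (observableNames φ P₁ P₂) (P₁.encode φ) (P₂.encode φ)

/-! ## The processes of the counterexamples -/

/-- The context `[ ] | u(n₁).u(n₂).(n̄₁⟨o⟩ | n₂(y).x̄⟨o⟩)`; the object `o` and the bound
name `y` play no role. -/
def testContext (u x o : ℕ) (P : PiProc 0) : PiProc 0 :=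
  .par P (.inp (.free u) (.inp (.free u)
    (.par (.out (.bound 1) (.free o)) (.inp (.bound 0) (.out (.free x) (.free o))))))

/-- `!((νz ū⟨z⟩) | Q)` -/
def replNewPar (u : ℕ) (Q : PiProc 0) : PiProc 0 :=
  .repl (.par (.res (.out (.free u) (.bound 0))) Q)

/-- `νz !(ū⟨z⟩ | Q)`, where `z` is not free in `Q` -/
def newReplPar (u : ℕ) (Q : PiProc 0) : PiProc 0 :=
  .res (.repl (.par (.out (.free u) (.bound 0)) Q.weaken))

/-- `!νz ū⟨z⟩` -/
def replNew (u : ℕ) : PiProc 0 := .repl (.res (.out (.free u) (.bound 0)))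

/-- `!νq νz ū⟨z⟩` -/
def replNewNew (u : ℕ) : PiProc 0 := .repl (.res (.res (.out (.free u) (.bound 0))))

/-! ## An invariant of structural congruence and name equivalence -/

-- Binding and substitution do not enter quotes, and this defeats the encoding. A translated
-- replication receives its parameters `n`, `p` anew in each round, but only literal occurrences of
-- `n` and `p` in its body are bound; increments such as `n.linc` are quoted constants. A
-- restriction directly under a replication is translated with `n` and `p` themselves and yields a
-- new name in each round. Below a parallel composition or another restriction it is translated with
-- increments, and all rounds yield the same name. The test context receives two names on `u` and
-- can output on `x` only if they agree.
--
-- First pair. In the pi-calculus every copy of `νz ū⟨z⟩` creates its own name, so the test fails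
-- for a replicated restriction and succeeds for a restricted replication. Failure is a matter of
-- linearity: the names sent on `u` are used at most once, so an input on such a name never fires
-- (`PiRed.typed`). After encoding, both processes send one constant name on `u` forever, and `Q` is
-- served in the same way on both sides. Bisimilarity then needs no step-by-step matching. From
-- every reachable state every observation that could ever be made can still be made, except for the
-- input on `u`, which disappears for good once the context has received two names. Two systems with
-- this behaviour are bisimilar as soon as they agree on whether that has happened
-- (`IsTwoPhase.bisim`).
--
-- Second pair. `νq` is vacuous, so the two processes are structurally congruent and
-- `PiStruct.bisim` settles the pi-calculus side. In the encoding of `!νz ū⟨z⟩` the names of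
-- different rounds are inequivalent, and the test never succeeds (`Safe.react`,
-- `newMachine_not_weakBarb`). The extra restriction moves the inner one to increments, and the test
-- succeeds after two rounds (`replNewNew_round`).
--
-- To control all reductions of the encodings, a process is viewed as a multiset of prefixes, each
-- carrying a label (`Machine.HasLabels`). Names are told apart by an invariant of name equivalence
-- (`RhoNameEq.code_eq`): a multiset of codes of the top-level prefixes, and a size counting all
-- prefixes. Size makes the parameters larger than every free name, and the outermost shape
-- separates parameters, copying channels and data channels. Hence only intended communications
-- occur (`Machine.Chan.unique`, `Machine.IsLab.react`). The residues of `Q` are not tracked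
-- individually: all are components of translations of threads in `Avail Q`, and every such thread
-- can be produced from any state (`Machine.exists_reds_of_avail`).

/-- A multiset code together with a size. -/
abbrev Code : Type := Multiset ℕ × ℕ

/-- The code of a prefix. -/
def Code.node (b : Bool) (x y : Code) : Code := ({Encodable.encode (b, x.1, y.1)}, 1 + x.2 + y.2)

mutual
/-- The code of a process, invariant under structural congruence. -/
def RhoProc.code : {k : ℕ} → RhoProc k → Code
  | _, .nil => 0
  | _, .par P Q => P.code + Q.code
  | _, .lift x P => Code.node false x.code P.code
  | _, .inp x P => Code.node true x.code P.code
  -- A drop contributes nothing of its own, because the quote of a drop of `x` is equivalent to `x`.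
  | _, .drop x => x.code
/-- The code of a name position. -/
def RhoRef.code : {k : ℕ} → RhoRef k → Code
  | _, .bound _ => 0
  | _, .name x => x.code
/-- The code of a name, invariant under name equivalence. -/
def RhoName.code : RhoName → Code
  | .quote P => P.code
end

mutual
-- The code forgets which bound name is meant, so the converse is not to be expected. Only
-- invariance is needed: names with different codes are inequivalent.
theorem RhoStruct.code_eq : ∀ {k : ℕ} {P Q : RhoProc k}, RhoStruct P Q → P.code = Q.code
  | _, _, _, .refl _ => rfl
  | _, _, _, .symm h => h.code_eq.symm
  | _, _, _, .trans h h' => h.code_eq.trans h'.code_eq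
  | _, _, _, .par h h' => by simp only [RhoProc.code, h.code_eq, h'.code_eq]
  | _, _, _, .lift h h' => by simp only [RhoProc.code, h.code_eq, h'.code_eq]
  | _, _, _, .inp h h' => by simp only [RhoProc.code, h.code_eq, h'.code_eq]
  | _, _, _, .drop h => by simp only [RhoProc.code, h.code_eq]
  | _, _, _, .par_nil _ => by simp only [RhoProc.code, add_zero]
  | _, _, _, .par_comm _ _ => by simp only [RhoProc.code, add_comm]
  | _, _, _, .par_assoc _ _ _ => by simp only [RhoProc.code, add_assoc]
theorem RhoRefEq.code_eq : ∀ {k : ℕ} {x y : RhoRef k}, RhoRefEq x y → x.code = y.code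
  | _, _, _, .bound _ => rfl
  | _, _, _, .name h => by simp only [RhoRef.code, h.code_eq]
theorem RhoNameEq.code_eq : ∀ {x y : RhoName}, RhoNameEq x y → x.code = y.code
  | _, _, .refl _ => rfl
  | _, _, .symm h => h.code_eq.symm
  | _, _, .trans h h' => h.code_eq.trans h'.code_eq
  | _, _, .struct h => by simp only [RhoName.code, h.code_eq]
  | _, _, .drop h => by simp only [RhoName.code, RhoProc.code, RhoRef.code, h.code_eq]
end

theorem Code.node_injective {b b' : Bool} {x x' y y' : Code}
    (h : (Code.node b x y).1 = (Code.node b' x' y').1) : b = b' ∧ x.1 = x'.1 ∧ y.1 = y'.1 := by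
  simpa [Code.node] using h

theorem RhoName.code_comp (x y : RhoName) :
    (x.comp y).code = Code.node false x.code 0 + Code.node true y.code 0 := rfl

/-! ## Processes up to structural congruence -/

instance RhoProc.structSetoid (k : ℕ) : Setoid (RhoProc k) :=
  ⟨RhoStruct, .refl, .symm, .trans⟩

/-- Processes up to structural congruence. -/
def RhoCls (k : ℕ) : Type := Quotient (RhoProc.structSetoid k)

/-- The structural congruence class of a process. -/
def RhoProc.cls {k : ℕ} (P : RhoProc k) : RhoCls k := Quotient.mk _ P

theorem RhoProc.cls_eq {k : ℕ} {P Q : RhoProc k} : P.cls = Q.cls ↔ RhoStruct P Q :=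
  Quotient.eq (r := RhoProc.structSetoid k)

theorem RhoCls.exists_rep {k : ℕ} (q : RhoCls k) : ∃ P : RhoProc k, P.cls = q :=
  Quotient.exists_rep q

instance (k : ℕ) : Add (RhoCls k) :=
  ⟨Quotient.map₂ RhoProc.par fun _ _ h _ _ h' => RhoStruct.par h h'⟩

instance (k : ℕ) : Zero (RhoCls k) := ⟨RhoProc.cls .nil⟩

theorem RhoProc.cls_par {k : ℕ} (P Q : RhoProc k) : (RhoProc.par P Q).cls = P.cls + Q.cls := rfl

instance (k : ℕ) : AddCommMonoid (RhoCls k) where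
  add_assoc := by
    rintro ⟨P⟩ ⟨Q⟩ ⟨R⟩; exact RhoProc.cls_eq.2 (.par_assoc P Q R)
  zero_add := by
    rintro ⟨P⟩; exact RhoProc.cls_eq.2 (.trans (.par_comm _ _) (.par_nil P))
  add_zero := by
    rintro ⟨P⟩; exact RhoProc.cls_eq.2 (.par_nil P)
  add_comm := by
    rintro ⟨P⟩ ⟨Q⟩; exact RhoProc.cls_eq.2 (.par_comm P Q)
  nsmul := nsmulRec

/-- The sum of the classes of a multiset of processes. -/
def clsSum {k : ℕ} (L : Multiset (RhoProc k)) : RhoCls k := (L.map RhoProc.cls).sum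

@[simp] theorem clsSum_zero {k : ℕ} : clsSum (0 : Multiset (RhoProc k)) = 0 := rfl

@[simp] theorem clsSum_cons {k : ℕ} (P : RhoProc k) (L : Multiset (RhoProc k)) :
    clsSum (P ::ₘ L) = P.cls + clsSum L := by simp [clsSum]

@[simp] theorem clsSum_add {k : ℕ} (L L' : Multiset (RhoProc k)) :
    clsSum (L + L') = clsSum L + clsSum L' := by simp [clsSum]

@[simp] theorem clsSum_singleton {k : ℕ} (P : RhoProc k) : clsSum {P} = P.cls := by simp [clsSum]

-- Parallel components and inversion of structural congruence

/-- The parallel components of a process. -/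
def RhoProc.comps : {k : ℕ} → RhoProc k → Multiset (RhoProc k)
  | _, .nil => 0
  | _, .par P Q => P.comps + Q.comps
  | _, .lift x P => {.lift x P}
  | _, .inp x P => {.inp x P}
  | _, .drop x => {.drop x}

theorem RhoProc.clsSum_comps : ∀ {k : ℕ} (P : RhoProc k), clsSum P.comps = P.cls
  | _, .nil => rfl
  | _, .par P Q => by rw [comps, clsSum_add, P.clsSum_comps, Q.clsSum_comps, cls_par]
  | _, .lift x P => by simp [comps]
  | _, .inp x P => by simp [comps]
  | _, .drop x => by simp [comps]

/-- Congruence of components. -/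
inductive CompEq {k : ℕ} : RhoProc k → RhoProc k → Prop
  | lift {x x' : RhoRef k} {P P' : RhoProc k} :
      RhoRefEq x x' → RhoStruct P P' → CompEq (.lift x P) (.lift x' P')
  | inp {x x' : RhoRef k} {P P' : RhoProc (k + 1)} :
      RhoRefEq x x' → RhoStruct P P' → CompEq (.inp x P) (.inp x' P')
  | drop {x x' : RhoRef k} : RhoRefEq x x' → CompEq (.drop x) (.drop x')

theorem RhoRefEq.refl {k : ℕ} : (x : RhoRef k) → RhoRefEq x x
  | .bound i => .bound i
  | .name x => .name (.refl x)

theorem RhoRefEq.symm {k : ℕ} {x y : RhoRef k} : RhoRefEq x y → RhoRefEq y x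
  | .bound i => .bound i
  | .name h => .name h.symm

theorem RhoRefEq.trans {k : ℕ} {x y z : RhoRef k} : RhoRefEq x y → RhoRefEq y z → RhoRefEq x z
  | .bound i, .bound _ => .bound i
  | .name h, .name h' => .name (h.trans h')

theorem CompEq.symm {k : ℕ} {P Q : RhoProc k} : CompEq P Q → CompEq Q P
  | .lift h h' => .lift h.symm h'.symm
  | .inp h h' => .inp h.symm h'.symm
  | .drop h => .drop h.symm

theorem CompEq.trans {k : ℕ} {P Q R : RhoProc k} : CompEq P Q → CompEq Q R → CompEq P R
  | .lift h h', .lift g g' => .lift (h.trans g) (h'.trans g')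
  | .inp h h', .inp g g' => .inp (h.trans g) (h'.trans g')
  | .drop h, .drop g => .drop (h.trans g)

theorem rel_singleton {k : ℕ} {P Q : RhoProc k} (h : CompEq P Q) :
    Multiset.Rel CompEq ({P} : Multiset (RhoProc k)) {Q} :=
  Multiset.Rel.cons h .zero

theorem RhoProc.comps_rel_refl : ∀ {k : ℕ} (P : RhoProc k), Multiset.Rel CompEq P.comps P.comps
  | _, .nil => .zero
  | _, .par P Q => by
      simpa only [comps] using Multiset.Rel.add P.comps_rel_refl Q.comps_rel_refl
  | _, .lift x P => by
      exact rel_singleton (.lift (.refl x) (.refl P))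
  | _, .inp x P => by
      exact rel_singleton (.inp (.refl x) (.refl P))
  | _, .drop x => by
      exact rel_singleton (.drop (.refl x))

theorem compEq_flip {k : ℕ} : flip (CompEq (k := k)) = CompEq := by
  funext a b; exact propext ⟨CompEq.symm, CompEq.symm⟩

theorem rel_compEq_trans {k : ℕ} {s t u : Multiset (RhoProc k)} (h : Multiset.Rel CompEq s t)
    (h' : Multiset.Rel CompEq t u) : Multiset.Rel CompEq s u := by
  have : IsTrans (RhoProc k) CompEq := ⟨fun _ _ _ => CompEq.trans⟩
  exact Multiset.Rel.trans CompEq h h'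

/-- Inversion of structural congruence: parallel laws only reshuffle components, and the congruence
rules act inside a single one. Symmetry and transitivity are absorbed since `CompEq` is symmetric
and transitive. -/
theorem RhoStruct.comps_rel : ∀ {k : ℕ} {P Q : RhoProc k}, RhoStruct P Q →
    Multiset.Rel CompEq P.comps Q.comps
  | _, _, _, .refl P => P.comps_rel_refl
  | _, _, _, .symm h => by
      have := Multiset.rel_flip.2 h.comps_rel
      rwa [compEq_flip] at this
  | _, _, _, .trans h h' => rel_compEq_trans h.comps_rel h'.comps_rel
  | _, _, _, .par h h' => by
      simpa only [RhoProc.comps] using Multiset.Rel.add h.comps_rel h'.comps_rel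
  | _, _, _, .lift h h' => by
      exact rel_singleton (.lift h h')
  | _, _, _, .inp h h' => by
      exact rel_singleton (.inp h h')
  | _, _, _, .drop h => by
      exact rel_singleton (.drop h)
  | _, _, _, .par_nil P => by
      simpa only [RhoProc.comps, add_zero] using P.comps_rel_refl
  | _, _, _, .par_comm P Q => by
      simpa only [RhoProc.comps, add_comm] using (RhoProc.par P Q).comps_rel_refl
  | _, _, _, .par_assoc P Q R => by
      simpa only [RhoProc.comps, add_assoc] using
        (RhoProc.par P (RhoProc.par Q R)).comps_rel_refl

/-! ## Substitution -/

theorem RhoRef.under_comp {k l m : ℕ} (f : RhoRef k → RhoRef l) (g : RhoRef l → RhoRef m) :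
    RhoRef.under (g ∘ f) = RhoRef.under g ∘ RhoRef.under f := by
  have aux : ∀ r : RhoRef l, (g r).shift = RhoRef.under g r.shift := by
    rintro (i | x) <;> rfl
  funext r
  rcases r with i | x
  · refine Fin.cases ?_ (fun j => ?_) i
    · rfl
    · exact aux _
  · exact aux _

theorem RhoRef.under_id {k : ℕ} : RhoRef.under (id : RhoRef k → RhoRef k) = id := by
  funext r
  rcases r with i | x
  · refine Fin.cases rfl (fun j => rfl) i
  · rfl

theorem RhoProc.map_map : ∀ {k l m : ℕ} (f : RhoRef k → RhoRef l) (g : RhoRef l → RhoRef m)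
    (P : RhoProc k), (P.map f).map g = P.map (g ∘ f)
  | _, _, _, _, _, .nil => rfl
  | _, _, _, f, g, .par P Q => by simp only [map, P.map_map, Q.map_map]
  | _, _, _, f, g, .lift x P => by simp only [map, P.map_map, Function.comp]
  | _, _, _, f, g, .inp x P => by
      simp only [map, map_map, RhoRef.under_comp, Function.comp_apply]
  | _, _, _, f, g, .drop x => rfl

theorem RhoProc.map_id : ∀ {k : ℕ} (P : RhoProc k), P.map id = P
  | _, .nil => rfl
  | _, .par P Q => by simp only [map, P.map_id, Q.map_id]
  | _, .lift x P => by simp only [map, P.map_id, id]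
  | _, .inp x P => by simp only [map, RhoRef.under_id, P.map_id, id]
  | _, .drop x => rfl

@[simp] theorem RhoProc.weaken_zero (P : RhoProc 0) : P.weaken 0 = P := by
  have : RhoRef.weaken 0 = id := by
    funext r
    rcases r with i | x
    · exact i.elim0
    · rfl
  rw [weaken, this, map_id]

/-- The action of a substitution on name positions. -/
def RhoRef.sub {k m : ℕ} (s : Fin k → RhoRef m) : RhoRef k → RhoRef m
  | .bound i => s i
  | .name x => .name x

/-- A substitution under a binder. -/
def subUnder {k m : ℕ} (s : Fin k → RhoRef m) : Fin (k + 1) → RhoRef (m + 1) :=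
  Fin.cases (.bound 0) fun j => (s j).shift

@[simp] theorem subUnder_zero {k m : ℕ} (s : Fin k → RhoRef m) : subUnder s 0 = .bound 0 := rfl

@[simp] theorem subUnder_succ {k m : ℕ} (s : Fin k → RhoRef m) (j : Fin k) :
    subUnder s j.succ = (s j).shift := rfl

@[simp] theorem RhoProc.semSubst_nil {k m : ℕ} (s : Fin k → RhoRef m) :
    (RhoProc.nil : RhoProc k).semSubst s = .nil := by simp [semSubst]

@[simp] theorem RhoProc.semSubst_par {k m : ℕ} (s : Fin k → RhoRef m) (P Q : RhoProc k) :
    (RhoProc.par P Q).semSubst s = .par (P.semSubst s) (Q.semSubst s) := by simp [semSubst]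

@[simp] theorem RhoProc.semSubst_lift {k m : ℕ} (s : Fin k → RhoRef m) (x : RhoRef k)
    (P : RhoProc k) : (RhoProc.lift x P).semSubst s = .lift (x.sub s) (P.semSubst s) := by
  cases x <;> simp [semSubst, RhoRef.sub]

@[simp] theorem RhoProc.semSubst_inp {k m : ℕ} (s : Fin k → RhoRef m) (x : RhoRef k)
    (P : RhoProc (k + 1)) :
    (RhoProc.inp x P).semSubst s = .inp (x.sub s) (P.semSubst (subUnder s)) := by
  cases x <;> simp only [semSubst, RhoRef.sub] <;> rfl

@[simp] theorem RhoProc.semSubst_drop_bound {k m : ℕ} (s : Fin k → RhoRef m) (i : Fin k) :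
    (RhoProc.drop (.bound i)).semSubst s = (s i).run := by simp [semSubst]

@[simp] theorem RhoProc.semSubst_drop_name {k m : ℕ} (s : Fin k → RhoRef m) (x : RhoName) :
    (RhoProc.drop (.name x)).semSubst s = .drop (.name x) := by simp [semSubst]

@[simp] theorem RhoRef.sub_bound {k m : ℕ} (s : Fin k → RhoRef m) (i : Fin k) :
    RhoRef.sub s (.bound i) = s i := rfl

@[simp] theorem RhoRef.sub_name {k m : ℕ} (s : Fin k → RhoRef m) (x : RhoName) :
    RhoRef.sub s (.name x) = .name x := rfl

@[simp] theorem RhoRef.run_bound {k : ℕ} (i : Fin k) : (RhoRef.bound i).run = .drop (.bound i) :=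
  rfl

@[simp] theorem RhoRef.run_quote {k : ℕ} (P : RhoProc 0) :
    (RhoRef.name (k := k) (.quote P)).run = P.weaken k := rfl

@[simp] theorem RhoRef.shift_bound {k : ℕ} (i : Fin k) :
    (RhoRef.bound i).shift = .bound i.succ := rfl

@[simp] theorem RhoRef.shift_name {k : ℕ} (x : RhoName) :
    (RhoRef.name (k := k) x).shift = .name x := rfl

theorem RhoRef.sub_shift {k m : ℕ} (s : Fin k → RhoRef m) (r : RhoRef k) :
    r.shift.sub (subUnder s) = (r.sub s).shift := by
  cases r <;> rfl

/-- The two alternatives exclude that a bound name is replaced by a quoted process, which is the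
only case where the semantic substitution differs from a renaming by running a drop. -/
theorem RhoProc.semSubst_map : ∀ {j k m : ℕ} (P : RhoProc j) (f : RhoRef j → RhoRef k)
    (t : Fin k → RhoRef m) (g : RhoRef j → RhoRef m),
    (∀ r, (∃ i i', f r = .bound i ∧ t i = .bound i' ∧ g r = .bound i') ∨
      ∃ x, f r = .name x ∧ g r = .name x) → (P.map f).semSubst t = P.map g
  | _, _, _, .nil, _, _, _, _ => by simp [map]
  | _, _, _, .par P Q, f, t, g, h => by
      simp [map, P.semSubst_map f t g h, Q.semSubst_map f t g h]
  | _, _, _, .lift x P, f, t, g, h => by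
      simp only [map, semSubst_lift, P.semSubst_map f t g h]
      rcases h x with ⟨i, i', h₁, h₂, h₃⟩ | ⟨y, h₁, h₂⟩ <;> simp [*]
  | _, _, _, .inp x P, f, t, g, h => by
      simp only [map, semSubst_inp]
      rw [P.semSubst_map (RhoRef.under f) (subUnder t) (RhoRef.under g)]
      · rcases h x with ⟨i, i', h₁, h₂, h₃⟩ | ⟨y, h₁, h₂⟩ <;> simp [*]
      · rintro (i | y)
        · refine Fin.cases ?_ (fun j => ?_) i
          · exact .inl ⟨0, 0, rfl, rfl, rfl⟩
          · rcases h (.bound j) with ⟨i, i', h₁, h₂, h₃⟩ | ⟨y, h₁, h₂⟩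
            · exact .inl ⟨i.succ, i'.succ, by simp [RhoRef.under, h₁], by simp [h₂],
                by simp [RhoRef.under, h₃]⟩
            · exact .inr ⟨y, by simp [RhoRef.under, h₁], by simp [RhoRef.under, h₂]⟩
        · rcases h (.name y) with ⟨i, i', h₁, h₂, h₃⟩ | ⟨y, h₁, h₂⟩
          · exact .inl ⟨i.succ, i'.succ, by simp [RhoRef.under, h₁], by simp [h₂],
              by simp [RhoRef.under, h₃]⟩
          · exact .inr ⟨y, by simp [RhoRef.under, h₁], by simp [RhoRef.under, h₂]⟩
  | _, _, _, .drop x, f, t, g, h => by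
      simp only [map]
      rcases h x with ⟨i, i', h₁, h₂, h₃⟩ | ⟨y, h₁, h₂⟩ <;> simp [*]

@[simp] theorem RhoProc.semSubst_weaken {k m : ℕ} (P : RhoProc 0) (t : Fin k → RhoRef m) :
    (P.weaken k).semSubst t = P.weaken m := by
  refine P.semSubst_map _ _ _ ?_
  rintro (i | x)
  · exact i.elim0
  · exact .inr ⟨x, rfl, rfl⟩

theorem subUnder_sub {k l m : ℕ} (s : Fin k → RhoRef l) (t : Fin l → RhoRef m) :
    (RhoRef.sub (subUnder t) ∘ subUnder s) = subUnder (RhoRef.sub t ∘ s) := by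
  funext i
  refine Fin.cases rfl (fun j => ?_) i
  simp [RhoRef.sub_shift]

theorem RhoRef.sub_sub {k l m : ℕ} (s : Fin k → RhoRef l) (t : Fin l → RhoRef m)
    (r : RhoRef k) : (r.sub s).sub t = r.sub (RhoRef.sub t ∘ s) := by
  cases r <;> rfl

theorem RhoRef.run_semSubst {l m : ℕ} (t : Fin l → RhoRef m) (r : RhoRef l) :
    r.run.semSubst t = (r.sub t).run := by
  cases r with
  | bound i => simp
  | name x => cases x with | quote P => simp

/-- At a drop, the first substitution may insert a quoted process and run it; that process is
closed, so the second substitution does not touch it. -/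
theorem RhoProc.semSubst_semSubst : ∀ {k l m : ℕ} (P : RhoProc k) (s : Fin k → RhoRef l)
    (t : Fin l → RhoRef m), (P.semSubst s).semSubst t = P.semSubst (RhoRef.sub t ∘ s)
  | _, _, _, .nil, _, _ => by simp
  | _, _, _, .par P Q, s, t => by simp [P.semSubst_semSubst, Q.semSubst_semSubst]
  | _, _, _, .lift x P, s, t => by simp [P.semSubst_semSubst, RhoRef.sub_sub]
  | _, _, _, .inp x P, s, t => by
      simp [P.semSubst_semSubst, RhoRef.sub_sub, subUnder_sub]
  | _, _, _, .drop (.bound i), s, t => by simp [RhoRef.run_semSubst]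
  | _, _, _, .drop (.name x), s, t => by simp

/-! ## Substitution and structural congruence -/

theorem RhoRefEq.shift {k : ℕ} {x y : RhoRef k} : RhoRefEq x y → RhoRefEq x.shift y.shift
  | .bound i => .bound i.succ
  | .name h => .name h

theorem RhoRefEq.under {k m : ℕ} {f : RhoRef k → RhoRef m}
    (hf : ∀ x y, RhoRefEq x y → RhoRefEq (f x) (f y)) :
    ∀ x y, RhoRefEq x y → RhoRefEq (RhoRef.under f x) (RhoRef.under f y)
  | _, _, .bound i => .refl _
  | _, _, .name h => (hf _ _ (.name h)).shift

theorem RhoStruct.map : ∀ {k m : ℕ} {P Q : RhoProc k} {f : RhoRef k → RhoRef m},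
    RhoStruct P Q → (∀ x y, RhoRefEq x y → RhoRefEq (f x) (f y)) →
    RhoStruct (P.map f) (Q.map f)
  | _, _, _, _, _, .refl _, _ => .refl _
  | _, _, _, _, _, .symm h, hf => (h.map hf).symm
  | _, _, _, _, _, .trans h h', hf => (h.map hf).trans (h'.map hf)
  | _, _, _, _, _, .par h h', hf => .par (h.map hf) (h'.map hf)
  | _, _, _, _, _, .lift h h', hf => .lift (hf _ _ h) (h'.map hf)
  | _, _, _, _, _, .inp h h', hf => .inp (hf _ _ h) (h'.map (RhoRefEq.under hf))
  | _, _, _, _, _, .drop h, hf => .drop (hf _ _ h)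
  | _, _, _, _, _, .par_nil _, _ => .par_nil _
  | _, _, _, _, _, .par_comm _ _, _ => .par_comm _ _
  | _, _, _, _, _, .par_assoc _ _ _, _ => .par_assoc _ _ _

theorem RhoStruct.weaken {P Q : RhoProc 0} (k : ℕ) (h : RhoStruct P Q) :
    RhoStruct (P.weaken k) (Q.weaken k) := by
  refine h.map ?_
  rintro _ _ (i | h)
  · exact i.elim0
  · exact .name h

theorem RhoRefEq.sub {k m : ℕ} (s : Fin k → RhoRef m) {x y : RhoRef k} :
    RhoRefEq x y → RhoRefEq (x.sub s) (y.sub s)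
  | .bound _ => .refl _
  | .name h => .name h

theorem RhoStruct.semSubst : ∀ {k m : ℕ} {P Q : RhoProc k},
    RhoStruct P Q → ∀ s : Fin k → RhoRef m, RhoStruct (P.semSubst s) (Q.semSubst s)
  | _, _, _, _, .refl _, _ => .refl _
  | _, _, _, _, .symm h, s => (h.semSubst s).symm
  | _, _, _, _, .trans h h', s => (h.semSubst s).trans (h'.semSubst s)
  | _, _, _, _, .par h h', s => by
      simpa only [RhoProc.semSubst_par] using .par (h.semSubst s) (h'.semSubst s)
  | _, _, _, _, .lift h h', s => by
      simpa only [RhoProc.semSubst_lift] using .lift (h.sub s) (h'.semSubst s)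
  | _, _, _, _, .inp h h', s => by
      simpa only [RhoProc.semSubst_inp] using .inp (h.sub s) (h'.semSubst (subUnder s))
  | _, _, _, _, .drop (.bound i), s => .refl _
  | _, _, _, _, .drop (.name h), s => by
      simpa only [RhoProc.semSubst_drop_name] using .drop (.name h)
  | _, _, _, _, .par_nil _, s => by
      simpa only [RhoProc.semSubst_par, RhoProc.semSubst_nil] using .par_nil _
  | _, _, _, _, .par_comm _ _, s => by
      simpa only [RhoProc.semSubst_par] using .par_comm _ _
  | _, _, _, _, .par_assoc _ _ _, s => by
      simpa only [RhoProc.semSubst_par] using .par_assoc _ _ _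

/-- Name positions that are equal up to structural congruence of the quoted process. -/
inductive RunEq {m : ℕ} : RhoRef m → RhoRef m → Prop
  | bound (i : Fin m) : RunEq (.bound i) (.bound i)
  | quote {P Q : RhoProc 0} : RhoStruct P Q → RunEq (.name (.quote P)) (.name (.quote Q))

theorem RunEq.shift {m : ℕ} {x y : RhoRef m} : RunEq x y → RunEq x.shift y.shift
  | .bound i => .bound i.succ
  | .quote h => .quote h

theorem RunEq.run {m : ℕ} {x y : RhoRef m} : RunEq x y → RhoStruct x.run y.run
  | .bound i => .refl _
  | .quote h => h.weaken m

theorem RunEq.refEq {m : ℕ} {x y : RhoRef m} : RunEq x y → RhoRefEq x y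
  | .bound i => .refl _
  | .quote h => .name (.struct h)

theorem RunEq.sub {k m : ℕ} {s t : Fin k → RhoRef m} (h : ∀ i, RunEq (s i) (t i)) :
    (r : RhoRef k) → RhoRefEq (r.sub s) (r.sub t)
  | .bound i => (h i).refEq
  | .name _ => .refl _

/-- Equivalence of the substituted names would not suffice: `⌜*⌜P⌝⌝` and `⌜P⌝` are equivalent names,
but running them gives `*⌜P⌝` and `P`. Hence the quoted processes themselves must be congruent. -/
theorem RhoProc.semSubst_congr : ∀ {k m : ℕ} (P : RhoProc k) {s t : Fin k → RhoRef m},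
    (∀ i, RunEq (s i) (t i)) → RhoStruct (P.semSubst s) (P.semSubst t)
  | _, _, .nil, s, t, h => by simpa using .refl _
  | _, _, .par P Q, s, t, h => by
      simpa using .par (P.semSubst_congr h) (Q.semSubst_congr h)
  | _, _, .lift x P, s, t, h => by
      simpa using .lift (RunEq.sub h x) (P.semSubst_congr h)
  | _, _, .inp x P, s, t, h => by
      simpa using .inp (RunEq.sub h x) (P.semSubst_congr (s := subUnder s) (t := subUnder t)
        (Fin.cases (.bound 0) fun j => (h j).shift))
  | _, _, .drop (.bound i), s, t, h => by simpa using (h i).run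
  | _, _, .drop (.name x), s, t, h => by simpa using .refl _

/-- The result of a communication. -/
def RhoProc.recv (P : RhoProc 1) (R : RhoProc 0) : RhoProc 0 :=
  P.semSubst fun _ => .name (.quote R)

theorem RhoStruct.recv {P P' : RhoProc 1} {R R' : RhoProc 0} (h : RhoStruct P P')
    (h' : RhoStruct R R') : RhoStruct (P.recv R) (P'.recv R') :=
  (h.semSubst _).trans (P'.semSubst_congr fun _ => .quote h')

/-! ## Reductions and barbs of a sum of components -/

theorem clsSum_rel {k : ℕ} {L M : Multiset (RhoProc k)} (h : Multiset.Rel CompEq L M) :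
    clsSum L = clsSum M := by
  induction h with
  | zero => rfl
  | cons h _ ih =>
    rw [clsSum_cons, clsSum_cons, ih]
    congr 1
    refine RhoProc.cls_eq.2 ?_
    cases h with
    | lift a b => exact .lift a b
    | inp a b => exact .inp a b
    | drop a => exact .drop a

/-- Every reduction is a single communication between two components. Closure under congruence is
removed by carrying the two participants back along the matching of components. -/
theorem RhoRed.comps {A A' : RhoProc 0} (h : RhoRed A A') :
    ∃ x y P R L, A.comps = .inp (.name x) P ::ₘ .lift (.name y) R ::ₘ L ∧ RhoNameEq x y ∧
      A'.cls = (P.recv R).cls + clsSum L := by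
  induction h with
  | com P₁ P₂ hx => exact ⟨_, _, P₁, P₂, 0, rfl, hx, by simp [RhoProc.recv]⟩
  | par Q _ ih =>
    obtain ⟨x, y, P, R, L, h₁, h₂, h₃⟩ := ih
    refine ⟨x, y, P, R, L + Q.comps, ?_, h₂, ?_⟩
    · simp [RhoProc.comps, h₁]
    · rw [RhoProc.cls_par, h₃, clsSum_add, Q.clsSum_comps, add_assoc]
  | struct h _ h' ih =>
    obtain ⟨x, y, P, R, L, h₁, h₂, h₃⟩ := ih
    have hr := h.comps_rel
    rw [h₁] at hr
    obtain ⟨X, L₁, hX, hr, e₁⟩ := Multiset.rel_cons_right.1 hr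
    obtain ⟨Y, L₂, hY, hr', e₂⟩ := Multiset.rel_cons_right.1 hr
    subst e₂
    rcases hX with _ | @⟨_, _, P', _, hx, hP⟩ | _
    rcases hY with @⟨_, _, R', _, hy, hR⟩ | _ | _
    cases hx with | name hx =>
    cases hy with | name hy =>
    refine ⟨_, _, P', R', L₂, e₁, hx.trans (h₂.trans hy.symm), ?_⟩
    rw [← RhoProc.cls_eq.2 h', h₃, RhoProc.cls_eq.2 (hP.recv hR)]
    exact congrArg _ (clsSum_rel hr').symm

/-- All components of the multiset are prefixes. -/
def AllPrefix (L : Multiset (RhoProc 0)) : Prop := ∀ P ∈ L, P.comps = {P}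

theorem AllPrefix.exists_rep {L : Multiset (RhoProc 0)} (h : AllPrefix L) :
    ∃ P : RhoProc 0, P.comps = L := by
  induction L using Multiset.induction_on with
  | empty => exact ⟨.nil, rfl⟩
  | cons Q L ih =>
    obtain ⟨P, hP⟩ := ih fun R hR => h R (Multiset.mem_cons_of_mem hR)
    exact ⟨.par Q P, by rw [RhoProc.comps, h Q (Multiset.mem_cons_self Q L), hP]; rfl⟩

theorem RhoRed.of_cls {A A' B B' : RhoProc 0} (h : RhoRed A A') (hA : A.cls = B.cls)
    (hA' : A'.cls = B'.cls) : RhoRed B B' :=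
  .struct (RhoProc.cls_eq.1 hA.symm) h (RhoProc.cls_eq.1 hA')

/-- The form in which reductions are analysed below: the state is known only up to congruence, as a
sum of prefixes, yet the participants are literal members of the given multiset. -/
theorem RhoRed.of_sum {A A' : RhoProc 0} {L : Multiset (RhoProc 0)} (h : RhoRed A A')
    (hL : AllPrefix L) (hA : A.cls = clsSum L) :
    ∃ x y P R M, L = .inp (.name x) P ::ₘ .lift (.name y) R ::ₘ M ∧ RhoNameEq x y ∧
      A'.cls = (P.recv R).cls + clsSum M := by
  obtain ⟨B, rfl⟩ := hL.exists_rep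
  exact (h.of_cls (B := B) (by rw [hA, B.clsSum_comps]) rfl).comps

/-- Reduction of classes. -/
def ClsRed (q q' : RhoCls 0) : Prop := ∃ A A', A.cls = q ∧ A'.cls = q' ∧ RhoRed A A'

/-- Many-step reduction of classes. -/
def ClsReds : RhoCls 0 → RhoCls 0 → Prop := Relation.ReflTransGen ClsRed

theorem ClsRed.add_right {q q' : RhoCls 0} (h : ClsRed q q') (r : RhoCls 0) :
    ClsRed (q + r) (q' + r) := by
  obtain ⟨A, A', rfl, rfl, h⟩ := h
  obtain ⟨R, rfl⟩ := r.exists_rep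
  exact ⟨.par A R, .par A' R, rfl, rfl, .par R h⟩

theorem ClsReds.add_right {q q' : RhoCls 0} (h : ClsReds q q') (r : RhoCls 0) :
    ClsReds (q + r) (q' + r) :=
  Relation.ReflTransGen.lift (· + r) (fun _ _ h => ClsRed.add_right h r) _ _ h

theorem ClsReds.add_left {q q' : RhoCls 0} (h : ClsReds q q') (r : RhoCls 0) :
    ClsReds (r + q) (r + q') := by
  rw [add_comm r, add_comm r]; exact h.add_right r

theorem ClsReds.trans {q q' q'' : RhoCls 0} (h : ClsReds q q') (h' : ClsReds q' q'') :
    ClsReds q q'' := Relation.ReflTransGen.trans h h'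

theorem ClsReds.congr {q q' r r' : RhoCls 0} (h : ClsReds q r) (hq : q' = q) (hr : r' = r) :
    ClsReds q' r' := by
  rwa [hq, hr]

theorem ClsReds.com {x y : RhoName} (h : RhoNameEq x y) (P : RhoProc 1) (R : RhoProc 0) :
    ClsReds ((RhoProc.inp (.name x) P).cls + (RhoProc.lift (.name y) R).cls) (P.recv R).cls :=
  .single ⟨_, _, rfl, rfl, .com P R h⟩

/-- Reductions may be computed in the commutative monoid of classes and are then realised by actual
processes. -/
theorem ClsReds.exists_reds {q : RhoCls 0} {A : RhoProc 0} (h : ClsReds A.cls q) :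
    ∃ A' : RhoProc 0, A'.cls = q ∧ Relation.ReflTransGen RhoRed A A' := by
  induction h with
  | refl => exact ⟨A, rfl, .refl⟩
  | tail _ h ih =>
    obtain ⟨A₁, rfl, h₁⟩ := ih
    obtain ⟨B, B', hB, hB', h⟩ := h
    exact ⟨B', hB', h₁.tail (h.of_cls hB rfl)⟩

/-- `P` is a prefix with the observation `o`. -/
inductive PrefixBarb : RhoProc 0 → Obs RhoName → Prop
  | out {x y : RhoName} (P : RhoProc 0) : RhoNameEq x y → PrefixBarb (.lift (.name x) P) (.out y)
  | inp {x y : RhoName} (P : RhoProc 1) : RhoNameEq x y → PrefixBarb (.inp (.name x) P) (.inp y)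

/-- The observed name. -/
def Obs.name {α : Type} : Obs α → α
  | .out x => x
  | .inp x => x

theorem PrefixBarb.of_compEq {P Q : RhoProc 0} {o : Obs RhoName} (h : CompEq P Q)
    (hQ : PrefixBarb Q o) : PrefixBarb P o := by
  cases hQ with
  | out R hx =>
    cases h with
    | lift h _ => cases h with | name h => exact .out _ (h.trans hx)
  | inp R hx =>
    cases h with
    | inp h _ => cases h with | name h => exact .inp _ (h.trans hx)

theorem RhoBarb.comps {N : Set RhoName} (hN : ∀ x y, RhoNameEq x y → x ∈ N → y ∈ N)
    {A : RhoProc 0} {o : Obs RhoName} (h : RhoBarb N A o) :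
    o.name ∈ N ∧ ∃ P ∈ A.comps, PrefixBarb P o := by
  induction h with
  | out P h h' => exact ⟨hN _ _ h h', _, Multiset.mem_singleton_self _, .out P h⟩
  | inp P h h' => exact ⟨hN _ _ h h', _, Multiset.mem_singleton_self _, .inp P h⟩
  | par_left Q _ ih =>
    obtain ⟨h₁, P, h₂, h₃⟩ := ih
    exact ⟨h₁, P, Multiset.mem_add.2 (.inl h₂), h₃⟩
  | par_right Q _ ih =>
    obtain ⟨h₁, P, h₂, h₃⟩ := ih
    exact ⟨h₁, P, Multiset.mem_add.2 (.inr h₂), h₃⟩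

theorem RhoBarb.of_comps {N : Set RhoName} (hN : ∀ x y, RhoNameEq x y → x ∈ N → y ∈ N)
    {o : Obs RhoName} (ho : o.name ∈ N) {P : RhoProc 0} (hP : PrefixBarb P o) :
    ∀ A : RhoProc 0, P ∈ A.comps → RhoBarb N A o
  | .nil, h => by simp [RhoProc.comps] at h
  | .par A B, h => by
      rcases Multiset.mem_add.1 h with h | h
      · exact .par_left _ (RhoBarb.of_comps hN ho hP A h)
      · exact .par_right _ (RhoBarb.of_comps hN ho hP B h)
  | .lift x A, h => by
      obtain rfl := Multiset.mem_singleton.1 h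
      cases hP with
      | out _ hx => exact .out _ hx (hN _ _ hx.symm ho)
  | .inp x A, h => by
      obtain rfl := Multiset.mem_singleton.1 h
      cases hP with
      | inp _ hx => exact .inp _ hx (hN _ _ hx.symm ho)
  | .drop x, h => by
      obtain rfl := Multiset.mem_singleton.1 h
      cases hP

theorem RhoBarb.of_sum {N : Set RhoName} (hN : ∀ x y, RhoNameEq x y → x ∈ N → y ∈ N)
    {A : RhoProc 0} {o : Obs RhoName} {L : Multiset (RhoProc 0)} (h : RhoBarb N A o)
    (hL : AllPrefix L) (hA : A.cls = clsSum L) : o.name ∈ N ∧ ∃ P ∈ L, PrefixBarb P o := by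
  obtain ⟨B, rfl⟩ := hL.exists_rep
  obtain ⟨h₁, P, h₂, h₃⟩ := h.comps hN
  rw [B.clsSum_comps] at hA
  obtain ⟨Q, hQ, hPQ⟩ := Multiset.exists_mem_of_rel_of_mem (RhoProc.cls_eq.1 hA).comps_rel h₂
  exact ⟨h₁, Q, hQ, h₃.of_compEq hPQ.symm⟩

theorem RhoBarb.of_cls {N : Set RhoName} (hN : ∀ x y, RhoNameEq x y → x ∈ N → y ∈ N)
    {A P : RhoProc 0} {o : Obs RhoName} {r : RhoCls 0} (ho : o.name ∈ N) (hP : PrefixBarb P o)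
    (hA : A.cls = P.cls + r) : RhoBarb N A o := by
  obtain ⟨R, rfl⟩ := r.exists_rep
  have hPm : P ∈ P.comps := by cases hP <;> exact Multiset.mem_singleton_self _
  have hr := (RhoProc.cls_eq.1 (hA.trans (RhoProc.cls_par P R).symm)).symm.comps_rel
  obtain ⟨Q, hQ, hPQ⟩ := Multiset.exists_mem_of_rel_of_mem hr
    (Multiset.mem_add.2 (.inl hPm) : P ∈ (RhoProc.par P R).comps)
  exact .of_comps hN ho (hP.of_compEq hPQ.symm) A hQ

/-! ## Threads of a restriction-free process and their translations -/

/-- The threads that can be made available by sufficiently many copies of `Q`. -/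
inductive Avail (Q : PiProc 0) : PiProc 0 → Prop
  | self : Avail Q Q
  | left {P R : PiProc 0} : Avail Q (.par P R) → Avail Q P
  | right {P R : PiProc 0} : Avail Q (.par P R) → Avail Q R
  | repl {P : PiProc 0} : Avail Q (.repl P) → Avail Q P
  | com {x z : PiName 0} {P : PiProc 1} : Avail Q (.inp x P) → Avail Q (.out x z) →
      Avail Q (P.subst z)

/-- The code of a channel that serves copies, at parameters of size greater than `b`. -/
def IsCopy (b : ℕ) (c : RhoName) : Prop := c.code.1.card = 2 ∧ 2 + 2 * b < c.code.2

/-- The code of a channel that carries parameters, at parameters of size greater than `b`. -/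
def IsData (b : ℕ) (c : RhoName) : Prop :=
  (∃ x y, c.code.1 = (Code.node true x y).1) ∧ 1 + b < c.code.2

/-- The process `Y` sent on a channel stands for the name `z`. -/
inductive Denotes {k m : ℕ} (ρ : PiName k → RhoRef m → Prop) (z : PiName k) : RhoProc m → Prop
  | drop {r : RhoRef m} : ρ z r → Denotes ρ z (.drop r)
  | run {R : RhoProc 0} : ρ z (.name (.quote R)) → Denotes ρ z (R.weaken m)

/-- A relation of names under a common binder. -/
inductive RelUnder {k m : ℕ} (ρ : PiName k → RhoRef m → Prop) :
    PiName (k + 1) → RhoRef (m + 1) → Prop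
  | zero : RelUnder ρ (.bound 0) (.bound 0)
  | shift {y : PiName k} {r : RhoRef m} : ρ y r → RelUnder ρ y.shift r.shift

/-- A relation of names under a binder of the target. -/
inductive RelShift {k m : ℕ} (ρ : PiName k → RhoRef m → Prop) : PiName k → RhoRef (m + 1) → Prop
  | shift {y : PiName k} {r : RhoRef m} : ρ y r → RelShift ρ y r.shift

/-- One round of a translated replication: a copy `X`, the copier, and new parameters. -/
def RhoProc.round {m : ℕ} (c c₁ c₂ : RhoName) (X Y₁ Y₂ : RhoProc m) : RhoProc m :=
  .par X (.par (.copier c) (.par (.lift (.name c₁) Y₁) (.lift (.name c₂) Y₂)))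

/-- The process copied by a translated replication. -/
def RhoProc.server {m : ℕ} (c c₁ c₂ : RhoName) (X Y₁ Y₂ : RhoProc (m + 2)) : RhoProc m :=
  .inp (.name c₁) (.inp (.name c₂) (.round c c₁ c₂ X Y₁ Y₂))

@[simp] theorem RhoProc.semSubst_copier {k m : ℕ} (s : Fin k → RhoRef m) (c : RhoName) :
    (RhoProc.copier c : RhoProc k).semSubst s = .copier c := by
  simp [RhoProc.copier]

@[simp] theorem RhoProc.semSubst_round {k m : ℕ} (s : Fin k → RhoRef m) (c c₁ c₂ : RhoName)
    (X Y₁ Y₂ : RhoProc k) : (RhoProc.round c c₁ c₂ X Y₁ Y₂).semSubst s =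
      .round c c₁ c₂ (X.semSubst s) (Y₁.semSubst s) (Y₂.semSubst s) := by
  simp [RhoProc.round]

@[simp] theorem RhoProc.semSubst_server {k m : ℕ} (s : Fin k → RhoRef m) (c c₁ c₂ : RhoName)
    (X Y₁ Y₂ : RhoProc (k + 2)) : (RhoProc.server c c₁ c₂ X Y₁ Y₂).semSubst s =
      .server c c₁ c₂ (X.semSubst (subUnder (subUnder s))) (Y₁.semSubst (subUnder (subUnder s)))
        (Y₂.semSubst (subUnder (subUnder s))) := by
  simp [RhoProc.server]

/-- `X` translates the restriction-free process `P`, whose names are represented as `ρ` says.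
What is sent on the channels of the replications is left open. -/
inductive Translates (b : ℕ) : {k m : ℕ} → (PiName k → RhoRef m → Prop) → PiProc k →
    RhoProc m → Prop
  | nil {k m : ℕ} {ρ : PiName k → RhoRef m → Prop} : Translates b ρ .nil .nil
  | par {k m : ℕ} {ρ : PiName k → RhoRef m → Prop} {P Q : PiProc k} {X Y : RhoProc m} :
      Translates b ρ P X → Translates b ρ Q Y → Translates b ρ (.par P Q) (.par X Y)
  | out {k m : ℕ} {ρ : PiName k → RhoRef m → Prop} {x z : PiName k} {r : RhoRef m}
      {Y : RhoProc m} : ρ x r → Denotes ρ z Y → Translates b ρ (.out x z) (.lift r Y)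
  | inp {k m : ℕ} {ρ : PiName k → RhoRef m → Prop} {x : PiName k} {r : RhoRef m}
      {P : PiProc (k + 1)} {X : RhoProc (m + 1)} :
      ρ x r → Translates b (RelUnder ρ) P X → Translates b ρ (.inp x P) (.inp r X)
  -- The two shifts account for the binders of the received parameters, which represent no name of
  -- the pi-calculus. As the body has no restriction, the values of the parameters do not matter and
  -- the messages `Y₁ Y₂ Z₁ Z₂` are arbitrary.
  | repl {k m : ℕ} {ρ : PiName k → RhoRef m → Prop} {P : PiProc k} {X : RhoProc (m + 2)}
      {c c₁ c₂ : RhoName} (Y₁ Y₂ : RhoProc (m + 2)) (Z₁ Z₂ : RhoProc m) :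
      IsCopy b c → IsData b c₁ → IsData b c₂ → Translates b (RelShift (RelShift ρ)) P X →
      Translates b ρ (.repl P) (.par (.lift (.name c) (.server c c₁ c₂ X Y₁ Y₂))
        (.par (.copier c) (.par (.lift (.name c₁) Z₁) (.lift (.name c₂) Z₂))))

theorem RelUnder.mono {k m : ℕ} {ρ ρ' : PiName k → RhoRef m → Prop}
    (h : ∀ y r, ρ y r → ρ' y r) : ∀ y r, RelUnder ρ y r → RelUnder ρ' y r
  | _, _, .zero => .zero
  | _, _, .shift h' => .shift (h _ _ h')

theorem RelShift.mono {k m : ℕ} {ρ ρ' : PiName k → RhoRef m → Prop}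
    (h : ∀ y r, ρ y r → ρ' y r) : ∀ y r, RelShift ρ y r → RelShift ρ' y r
  | _, _, .shift h' => .shift (h _ _ h')

theorem Denotes.mono {k m : ℕ} {ρ ρ' : PiName k → RhoRef m → Prop}
    (h : ∀ y r, ρ y r → ρ' y r) {z : PiName k} {Y : RhoProc m} : Denotes ρ z Y → Denotes ρ' z Y
  | .drop h' => .drop (h _ _ h')
  | .run h' => .run (h _ _ h')

theorem Translates.mono {b k m : ℕ} {ρ ρ' : PiName k → RhoRef m → Prop} {P : PiProc k}
    {X : RhoProc m} (h : Translates b ρ P X) (hρ : ∀ y r, ρ y r → ρ' y r) :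
    Translates b ρ' P X := by
  induction h with
  | nil => exact .nil
  | par _ _ ih ih' => exact .par (ih hρ) (ih' hρ)
  | out h h' => exact .out (hρ _ _ h) (h'.mono hρ)
  | inp h _ ih => exact .inp (hρ _ _ h) (ih (RelUnder.mono hρ))
  | repl _ _ _ _ h₁ h₂ h₃ _ ih =>
    exact .repl _ _ _ _ h₁ h₂ h₃ (ih (RelShift.mono (RelShift.mono hρ)))

theorem RelUnder.sub {k m l : ℕ} {ρ : PiName k → RhoRef m → Prop}
    {ρ' : PiName k → RhoRef l → Prop} {s : Fin m → RhoRef l}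
    (h : ∀ y r, ρ y r → ρ' y (r.sub s)) :
    ∀ y r, RelUnder ρ y r → RelUnder ρ' y (r.sub (subUnder s))
  | _, _, .zero => .zero
  | _, _, .shift h' => by rw [RhoRef.sub_shift]; exact .shift (h _ _ h')

theorem RelShift.sub {k m l : ℕ} {ρ : PiName k → RhoRef m → Prop}
    {ρ' : PiName k → RhoRef l → Prop} {s : Fin m → RhoRef l}
    (h : ∀ y r, ρ y r → ρ' y (r.sub s)) :
    ∀ y r, RelShift ρ y r → RelShift ρ' y (r.sub (subUnder s))
  | _, _, .shift h' => by rw [RhoRef.sub_shift]; exact .shift (h _ _ h')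

/-- When the variable under a drop is replaced by a quote, the drop becomes the quoted process
itself; the second constructor of `Denotes` exists for this case. -/
theorem Denotes.semSubst {k m l : ℕ} {ρ : PiName k → RhoRef m → Prop}
    {ρ' : PiName k → RhoRef l → Prop} {s : Fin m → RhoRef l} {z : PiName k} {Y : RhoProc m}
    (hY : Denotes ρ z Y) (h : ∀ y r, ρ y r → ρ' y (r.sub s)) : Denotes ρ' z (Y.semSubst s) := by
  cases hY with
  | @drop r hr =>
    have := h _ _ hr
    cases r with
    | name x => simpa using .drop this
    | bound i =>
      rw [RhoProc.semSubst_drop_bound]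
      rw [RhoRef.sub_bound] at this
      generalize s i = r at this
      cases r with
      | bound j => exact .drop this
      | name x => cases x with | quote R => exact .run this
  | run hr => simpa using .run (h _ _ hr)

/-- A reception changes only the way names are represented. The looseness of `Translates` in the
parameter messages makes it stable under substitution. -/
theorem Translates.semSubst {b k m : ℕ} {ρ : PiName k → RhoRef m → Prop} {P : PiProc k}
    {X : RhoProc m} (h : Translates b ρ P X) : ∀ {l : ℕ} {ρ' : PiName k → RhoRef l → Prop}
    {s : Fin m → RhoRef l}, (∀ y r, ρ y r → ρ' y (r.sub s)) →
    Translates b ρ' P (X.semSubst s) := by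
  induction h with
  | nil => intros; simpa using .nil
  | par _ _ ih ih' => intro _ _ _ hρ; simpa using .par (ih hρ) (ih' hρ)
  | out h h' => intro _ _ _ hρ; simpa using .out (hρ _ _ h) (h'.semSubst hρ)
  | inp h _ ih => intro _ _ _ hρ; simpa using .inp (hρ _ _ h) (ih (RelUnder.sub hρ))
  | repl _ _ _ _ h₁ h₂ h₃ _ ih =>
    intro _ _ _ hρ
    simpa using .repl _ _ _ _ h₁ h₂ h₃ (ih (RelShift.sub (RelShift.sub hρ)))

theorem PiName.under_shift {k m : ℕ} (f : PiName k → PiName m) (y : PiName k) :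
    PiName.under f y.shift = (f y).shift := by
  cases y <;> rfl

theorem RelUnder.mapPi {k j m : ℕ} {ρ : PiName k → RhoRef m → Prop}
    {ρ' : PiName j → RhoRef m → Prop} {f : PiName k → PiName j}
    (h : ∀ y r, ρ y r → ρ' (f y) r) :
    ∀ y r, RelUnder ρ y r → RelUnder ρ' (PiName.under f y) r
  | _, _, .zero => .zero
  | _, _, .shift h' => by rw [PiName.under_shift]; exact .shift (h _ _ h')

theorem RelShift.mapPi {k j m : ℕ} {ρ : PiName k → RhoRef m → Prop}
    {ρ' : PiName j → RhoRef m → Prop} {f : PiName k → PiName j}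
    (h : ∀ y r, ρ y r → ρ' (f y) r) : ∀ y r, RelShift ρ y r → RelShift ρ' (f y) r
  | _, _, .shift h' => .shift (h _ _ h')

theorem Denotes.mapPi {k j m : ℕ} {ρ : PiName k → RhoRef m → Prop}
    {ρ' : PiName j → RhoRef m → Prop} {f : PiName k → PiName j} {z : PiName k} {Y : RhoProc m}
    (h : ∀ y r, ρ y r → ρ' (f y) r) : Denotes ρ z Y → Denotes ρ' (f z) Y
  | .drop h' => .drop (h _ _ h')
  | .run h' => .run (h _ _ h')

theorem Translates.mapPi {b k m : ℕ} {ρ : PiName k → RhoRef m → Prop} {P : PiProc k}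
    {X : RhoProc m} (h : Translates b ρ P X) : ∀ {j : ℕ} {ρ' : PiName j → RhoRef m → Prop}
    {f : PiName k → PiName j}, (∀ y r, ρ y r → ρ' (f y) r) → Translates b ρ' (P.map f) X := by
  induction h with
  | nil => intros; exact .nil
  | par _ _ ih ih' => intro _ _ _ hρ; exact .par (ih hρ) (ih' hρ)
  | out h h' => intro _ _ _ hρ; exact .out (hρ _ _ h) (h'.mapPi hρ)
  | inp h _ ih => intro _ _ _ hρ; exact .inp (hρ _ _ h) (ih (RelUnder.mapPi hρ))
  | repl _ _ _ _ h₁ h₂ h₃ _ ih =>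
    intro _ _ _ hρ
    exact .repl _ _ _ _ h₁ h₂ h₃ (ih (RelShift.mapPi (RelShift.mapPi hρ)))

/-! ### The encoding as a translation -/

theorem RhoRef.under_shift {k m : ℕ} (g : RhoRef k → RhoRef m) (r : RhoRef k) :
    RhoRef.under g r.shift = (g r).shift := by
  cases r <;> rfl

@[simp] theorem RhoRef.under_name {k m : ℕ} (g : RhoRef k → RhoRef m) (x : RhoName) :
    RhoRef.under g (.name x) = (g (.name x)).shift := rfl

@[simp] theorem RhoRef.under_zero {k m : ℕ} (g : RhoRef k → RhoRef m) :
    RhoRef.under g (.bound 0) = .bound 0 := rfl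

theorem PiName.toRef_shift (φ : ℕ → RhoName) {k : ℕ} (y : PiName k) :
    y.shift.toRef φ = (y.toRef φ).shift := by
  cases y <;> rfl

theorem RhoRef.bindName_name {k : ℕ} {y w : RhoName} (h : w.code ≠ y.code) :
    RhoRef.bindName (k := k) y (.name w) = .name w := by
  rw [RhoRef.bindName, if_neg fun h' => h h'.code_eq]

theorem RhoRef.bindName_self {k : ℕ} (y : RhoName) :
    RhoRef.bindName (k := k) y (.name y) = .bound 0 := by
  rw [RhoRef.bindName, if_pos (.refl y)]

/-- The renaming of name positions performed by the two input binders of a replication. -/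
noncomputable def bindParams {k : ℕ} (n p : RhoName) : RhoRef k → RhoRef (k + 2) :=
  RhoRef.under (RhoRef.bindName n) ∘ RhoRef.bindName p

theorem bindParams_name {k : ℕ} {n p w : RhoName} (hn : w.code ≠ n.code) (hp : w.code ≠ p.code) :
    bindParams (k := k) n p (.name w) = .name w := by
  simp [bindParams, RhoRef.bindName_name hp, RhoRef.bindName_name hn]

theorem size_linc (n : RhoName) : n.linc.code.2 = 1 + n.code.2 := rfl

theorem size_rinc (n : RhoName) : n.rinc.code.2 = 1 + n.code.2 := rfl

theorem size_comp (n p : RhoName) : (n.comp p).code.2 = 2 + (n.code.2 + p.code.2) := by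
  simp only [RhoName.code_comp, Code.node, Prod.snd_add, Prod.snd_zero]
  omega

theorem isCopy_comp {b : ℕ} {n p : RhoName} (hn : b < n.code.2) (hp : b < p.code.2) :
    IsCopy b (n.comp p) := by
  refine ⟨by simp [RhoName.code_comp, Code.node], ?_⟩
  rw [size_comp]; omega

theorem isData_rinc {b : ℕ} {n : RhoName} (hn : b < n.code.2) : IsData b n.rinc :=
  ⟨⟨_, _, rfl⟩, by rw [size_rinc]; omega⟩

/-- The translation of a replication, its two binders made explicit. -/
theorem PiProc.trans_repl {k m : ℕ} (φ : ℕ → RhoName) (P : PiProc k) (n p : RhoName)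
    (hnp : n.code.2 = p.code.2) (g : RhoRef k → RhoRef m)
    (hg : ∀ w : RhoName, n.code.2 < w.code.2 → g (.name w) = .name w) :
    ((PiProc.repl P).trans φ n p).map g =
      .par (.lift (.name (n.comp p)) (.server (n.comp p) n.rinc p.rinc
          ((P.trans φ n p).map (RhoRef.under (RhoRef.under g) ∘ bindParams n p))
          (.map (RhoRef.under (RhoRef.under g) ∘ bindParams n p) (.output (.name n) (.name n)))
          (.map (RhoRef.under (RhoRef.under g) ∘ bindParams n p) (.output (.name p) (.name p)))))
        (.par (.copier (n.comp p)) (.par (.output (.name n.rinc) (.name n.linc))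
          (.output (.name p.rinc) (.name p.linc)))) := by
  -- Size is invariant under name equivalence, so a name larger than both parameters is not captured
  -- by their binders.
  have hw : ∀ {w : RhoName}, n.code.2 < w.code.2 → w.code ≠ n.code ∧ w.code ≠ p.code := by
    intro w h
    constructor <;> intro h' <;> rw [h'] at h <;> omega
  have h₁ : n.code.2 < (n.comp p).code.2 := by rw [size_comp]; omega
  have h₂ : n.code.2 < n.rinc.code.2 := by rw [size_rinc]; omega
  have h₃ : n.code.2 < p.rinc.code.2 := by rw [size_rinc]; omega
  have h₄ : n.code.2 < n.linc.code.2 := by rw [size_linc]; omega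
  have h₅ : n.code.2 < p.linc.code.2 := by rw [size_linc]; omega
  simp only [trans, RhoProc.map, RhoProc.inputBinding, RhoProc.bindName, RhoProc.copier,
    RhoProc.output, RhoProc.server, RhoProc.round, RhoProc.map_map, RhoRef.under_name,
    RhoRef.under_zero, Function.comp_apply, bindParams, hg _ h₁, hg _ h₂, hg _ h₃, hg _ h₄,
    hg _ h₅, RhoRef.bindName_name (hw h₁).1, RhoRef.bindName_name (hw h₁).2,
    RhoRef.bindName_name (hw h₂).1, RhoRef.bindName_name (hw h₂).2,
    RhoRef.bindName_name (hw h₃).1, RhoRef.bindName_name (hw h₃).2, RhoRef.shift_name]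

/-- The induction must allow for a renaming `f` caused by enclosing binders of the pi-calculus and a
map `g` performed by the parameter binders of enclosing replications. The map fixes the free names,
being smaller than the parameters, and all larger names, among them the increments used as channels.
-/
theorem PiProc.translates_trans (φ : ℕ → RhoName) (F : Finset ℕ) (b : ℕ)
    (hF : ∀ a ∈ F, (φ a).code.2 ≤ b) : ∀ {k : ℕ} (P : PiProc k), P.NuFree → P.fn ⊆ F →
    ∀ {j m : ℕ} (f : PiName k → PiName j) (n p : RhoName) (g : RhoRef j → RhoRef m),
    (∀ y, y.fn ⊆ F → (f y).fn ⊆ F) → n.code.2 = p.code.2 → b < n.code.2 →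
    (∀ w : RhoName, n.code.2 < w.code.2 → g (.name w) = .name w) →
    (∀ a ∈ F, g (.name (φ a)) = .name (φ a)) →
    Translates b (fun y r => y.fn ⊆ F ∧ r = g ((f y).toRef φ)) P
      (((P.map f).trans φ n p).map g) := by
  intro k P
  induction P with
  | nil => intros; exact .nil
  | par P Q ih ih' =>
    intro hν hP j m f n p g hf hnp hb hg hφ
    rw [PiProc.fn, Finset.union_subset_iff] at hP
    refine .par (ih hν.1 hP.1 f _ _ g hf ?_ ?_ ?_ hφ) (ih' hν.2 hP.2 f _ _ g hf ?_ ?_ ?_ hφ)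
    · rw [size_linc, size_linc, hnp]
    · rw [size_linc]; omega
    · exact fun w hw => hg w (by rw [size_linc] at hw; omega)
    · rw [size_rinc, size_rinc, hnp]
    · rw [size_rinc]; omega
    · exact fun w hw => hg w (by rw [size_rinc] at hw; omega)
  | out x z =>
    intro hν hP j m f n p g hf hnp hb hg hφ
    rw [PiProc.fn, Finset.union_subset_iff] at hP
    exact .out ⟨hP.1, rfl⟩ (.drop ⟨hP.2, rfl⟩)
  | inp x P ih =>
    intro hν hP j m f n p g hf hnp hb hg hφ
    rw [PiProc.fn, Finset.union_subset_iff] at hP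
    have hsh : ∀ {i : ℕ} (y : PiName i), y.shift.fn = y.fn := by intro i y; cases y <;> rfl
    refine .inp ⟨hP.1, rfl⟩ ((ih hν hP.2 (PiName.under f) n p (RhoRef.under g) ?_ hnp hb ?_
      ?_).mono ?_)
    · rintro (a | i) hy
      · change (f (.free a)).shift.fn ⊆ F
        rw [hsh]; exact hf _ hy
      · refine Fin.cases ?_ (fun i => ?_) i
        · exact Finset.empty_subset _
        · change (f (.bound i)).shift.fn ⊆ F
          rw [hsh]; exact hf _ (Finset.empty_subset _)
    · intro w hw; rw [RhoRef.under_name, hg w hw, RhoRef.shift_name]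
    · intro a ha; rw [RhoRef.under_name, hφ a ha, RhoRef.shift_name]
    · have aux : ∀ y : PiName _, y.fn ⊆ F → RelUnder
          (fun y r => y.fn ⊆ F ∧ r = g ((f y).toRef φ)) y.shift
          (RhoRef.under g ((PiName.under f y.shift).toRef φ)) := by
        intro y hy
        rw [PiName.under_shift, PiName.toRef_shift, RhoRef.under_shift]
        exact .shift ⟨hy, rfl⟩
      rintro (a | i) r ⟨hy, rfl⟩
      · exact aux (.free a) hy
      · refine Fin.cases ?_ (fun i => ?_) i
        · exact .zero
        · exact aux (.bound i) (Finset.empty_subset _)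
  | res P ih => intro hν; exact hν.elim
  | repl P ih =>
    intro hν hP j m f n p g hf hnp hb hg hφ
    have hfix : ∀ w : RhoName, w.code ≠ n.code → w.code ≠ p.code → g (.name w) = .name w →
        (RhoRef.under (RhoRef.under g) ∘ bindParams n p) (.name w) = .name w := by
      intro w h₁ h₂ h₃
      simp [bindParams_name h₁ h₂, h₃]
    have hφn : ∀ a ∈ F, (φ a).code ≠ n.code ∧ (φ a).code ≠ p.code := by
      intro a ha
      have := hF a ha
      constructor <;> intro h <;> rw [h] at this <;> omega
    rw [PiProc.map, PiProc.trans_repl φ (P.map f) n p hnp g hg]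
    refine .repl _ _ _ _ (isCopy_comp hb (by omega)) (isData_rinc hb) (isData_rinc (by omega))
      ((ih hν hP f n p (RhoRef.under (RhoRef.under g) ∘ bindParams n p) hf hnp hb ?_ ?_).mono ?_)
    · intro w hw
      refine hfix w ?_ ?_ (hg w hw) <;> intro h <;> rw [h] at hw <;> omega
    · exact fun a ha => hfix _ (hφn a ha).1 (hφn a ha).2 (hφ a ha)
    · rintro y r ⟨hy, rfl⟩
      have : (RhoRef.under (RhoRef.under g) ∘ bindParams n p) ((f y).toRef φ) =
          (g ((f y).toRef φ)).shift.shift := by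
        have := hf y hy
        generalize f y = z at this
        rcases z with a | i
        · have ha : a ∈ F := by simpa [PiName.fn] using this
          rw [PiName.toRef, hfix _ (hφn a ha).1 (hφn a ha).2 (hφ a ha), hφ a ha]
          rfl
        · rfl
      rw [this]
      exact .shift (.shift ⟨hy, rfl⟩)

/-- The names of a closed process, represented through `φ` up to name equivalence. -/
inductive NameRep (φ : ℕ → RhoName) (F : Finset ℕ) : PiName 0 → RhoRef 0 → Prop
  | mk {a : ℕ} {w : RhoName} : a ∈ F → RhoNameEq w (φ a) → NameRep φ F (.free a) (.name w)

/-- The receiver of `Y` obtains the name `⌜Y⌝`. If `Y` is a drop of `w`, this is equivalent to `w`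
by the second rule of name equivalence. -/
theorem Denotes.rep {φ : ℕ → RhoName} {F : Finset ℕ} {z : PiName 0} {Y : RhoProc 0}
    (h : Denotes (NameRep φ F) z Y) : NameRep φ F z (.name (.quote Y)) := by
  cases h with
  | drop h => cases h with | mk ha hw => exact .mk ha (.drop hw)
  | run h => simpa using h

theorem Translates.recv {φ : ℕ → RhoName} {F : Finset ℕ} {b : ℕ} {P : PiProc 1} {X : RhoProc 1}
    {z : PiName 0} {R : RhoProc 0} (hX : Translates b (RelUnder (NameRep φ F)) P X)
    (hz : Denotes (NameRep φ F) z R) : Translates b (NameRep φ F) (P.subst z) (X.recv R) := by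
  refine (hX.semSubst (s := fun _ => .name (.quote R))
    (ρ' := fun y r => NameRep φ F (PiName.inst z y) r) ?_).mapPi fun _ _ h => h
  rintro _ _ (_ | h)
  · exact hz.rep
  · cases h with | mk h h' => exact .mk h h'

/-- The parallel components of translations of available threads of `Q`. -/
inductive QPart (φ : ℕ → RhoName) (F : Finset ℕ) (b : ℕ) (Q : PiProc 0) : RhoProc 0 → Prop
  | out {x z : PiName 0} {r : RhoRef 0} {Y : RhoProc 0} : Avail Q (.out x z) → NameRep φ F x r →
      Denotes (NameRep φ F) z Y → QPart φ F b Q (.lift r Y)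
  | inp {x : PiName 0} {P : PiProc 1} {r : RhoRef 0} {X : RhoProc 1} : Avail Q (.inp x P) →
      NameRep φ F x r → Translates b (RelUnder (NameRep φ F)) P X → QPart φ F b Q (.inp r X)
  | copier {c : RhoName} : IsCopy b c → QPart φ F b Q (.copier c)
  -- The channel `d` of the message need not be the channel `c` inside: a copier resends what it has
  -- received under its own, merely equivalent, channel name.
  | store {d c c₁ c₂ : RhoName} {T : PiProc 0} {X : RhoProc 2} (Y₁ Y₂ : RhoProc 2) :
      IsCopy b d → IsCopy b c → IsData b c₁ → IsData b c₂ → Avail Q T →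
      Translates b (RelShift (RelShift (NameRep φ F))) T X →
      QPart φ F b Q (.lift (.name d) (.server c c₁ c₂ X Y₁ Y₂))
  | server {c c₁ c₂ : RhoName} {T : PiProc 0} {X : RhoProc 2} (Y₁ Y₂ : RhoProc 2) : IsCopy b c →
      IsData b c₁ → IsData b c₂ → Avail Q T →
      Translates b (RelShift (RelShift (NameRep φ F))) T X →
      QPart φ F b Q (.server c c₁ c₂ X Y₁ Y₂)
  | round {c c₁ c₂ : RhoName} {T : PiProc 0} {X : RhoProc 1} (Y₁ Y₂ : RhoProc 1) : IsCopy b c →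
      IsData b c₁ → IsData b c₂ → Avail Q T → Translates b (RelShift (NameRep φ F)) T X →
      QPart φ F b Q (.inp (.name c₂) (.round c c₁ c₂ X Y₁ Y₂))
  | data {c : RhoName} (Y : RhoProc 0) : IsData b c → QPart φ F b Q (.lift (.name c) Y)

/-- The translation of an available thread falls apart into components of the tracked forms, because
parallel parts and bodies of replications are again available. -/
theorem Translates.exists_parts {φ : ℕ → RhoName} {F : Finset ℕ} {b : ℕ} {Q : PiProc 0} :
    ∀ {T : PiProc 0} {X : RhoProc 0}, Avail Q T → Translates b (NameRep φ F) T X →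
    ∃ L : Multiset (RhoProc 0), (∀ P ∈ L, QPart φ F b Q P) ∧ X.cls = clsSum L
  | .nil, _, _, .nil => ⟨0, by simp, rfl⟩
  | .par P R, .par X Y, hT, .par h h' => by
      obtain ⟨L, hL, e⟩ := h.exists_parts hT.left
      obtain ⟨L', hL', e'⟩ := h'.exists_parts hT.right
      refine ⟨L + L', fun P hP => (Multiset.mem_add.1 hP).elim (hL P) (hL' P), ?_⟩
      rw [RhoProc.cls_par, e, e', clsSum_add]
  | .out x z, .lift r Y, hT, .out h h' => by
      refine ⟨{.lift r Y}, fun P hP => ?_, by simp⟩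
      rw [Multiset.mem_singleton.1 hP]; exact .out hT h h'
  | .inp x P, .inp r X, hT, .inp h h' => by
      refine ⟨{.inp r X}, fun P hP => ?_, by simp⟩
      rw [Multiset.mem_singleton.1 hP]; exact .inp hT h h'
  | .repl P, _, hT, @Translates.repl _ _ _ _ _ X c c₁ c₂ Y₁ Y₂ Z₁ Z₂ h₁ h₂ h₃ h => by
      refine ⟨{.lift (.name c) (.server c c₁ c₂ X Y₁ Y₂), .copier c, .lift (.name c₁) Z₁,
        .lift (.name c₂) Z₂}, fun P hP => ?_, ?_⟩
      · simp only [Multiset.insert_eq_cons, Multiset.mem_cons, Multiset.mem_singleton] at hP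
        rcases hP with rfl | rfl | rfl | rfl
        exacts [.store _ _ h₁ h₁ h₂ h₃ hT.repl h, .copier h₁, .data _ h₂, .data _ h₃]
      · simp [Multiset.insert_eq_cons, RhoProc.cls_par]

theorem RhoProc.recv_copier (c : RhoName) (R : RhoProc 0) :
    RhoProc.recv (.par (.drop (.bound 0)) (.lift (.name c) (.drop (.bound 0)))) R =
      .par R (.lift (.name c) R) := by
  simp [RhoProc.recv]

/-! ## The abstract machine of the encoded counterexamples -/

/-- The kinds of parallel components. -/
inductive Lab : Type
  | copier | store | server
  | msgN (i : ℕ) | wait (i : ℕ) | msgP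
  | nuIn | nuOut (i : ℕ) | uOut (i : ℕ)
  | ctx0 | ctx1 (i : ℕ) | ctxOut (i : ℕ) | ctxIn (i : ℕ) | xOut
  | q

/-- The code of the parameter sent in the next round. -/
def Code.grow (c : Code) : Code := Code.node false c c

/-- A replication with body `X` at parameters `n` and `p`, next to the test context. -/
structure Machine where
  φ : ℕ → RhoName
  u : ℕ
  x : ℕ
  o : ℕ
  F : Finset ℕ
  Q : PiProc 0
  n : RhoName
  p : RhoName
  X : RhoProc 2
  val : ℕ → Code
  IsVal : ℕ → RhoName → Prop
  nu : Set RhoName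
  K : ℕ → Multiset Lab

namespace Machine

variable (m : Machine)

/-- The size of the parameters. -/
def b : ℕ := m.n.code.2

/-- The channel of the copier. -/
def c : RhoName := m.n.comp m.p

/-- The body of the round, with the received parameters bound. -/
def body : RhoProc 2 :=
  .round m.c m.n.rinc m.p.rinc m.X (.lift (.bound 1) (.drop (.bound 1)))
    (.lift (.bound 0) (.drop (.bound 0)))

/-- The copied process. -/
def serve : RhoProc 0 :=
  .server m.c m.n.rinc m.p.rinc m.X (.lift (.bound 1) (.drop (.bound 1)))
    (.lift (.bound 0) (.drop (.bound 0)))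

/-- The last input of the test context. -/
def test {k : ℕ} (y : RhoRef k) : RhoProc k :=
  .inp y (.lift (.name (m.φ m.x)) (.drop (.name (m.φ m.o))))

/-- The components of kind `l`. -/
inductive IsLab : Lab → RhoProc 0 → Prop
  | copier : IsLab .copier (.copier m.c)
  | store : IsLab .store (.lift (.name m.c) m.serve)
  | server : IsLab .server m.serve
  | msgN {i : ℕ} {Y : RhoProc 0} : Y.code = Code.grow^[i] m.n.linc.code →
      IsLab (.msgN i) (.lift (.name m.n.rinc) Y)
  | wait {i : ℕ} {Y : RhoProc 0} : Y.code = Code.grow^[i] m.n.linc.code →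
      IsLab (.wait i) (.inp (.name m.p.rinc)
        (m.body.semSubst (subUnder fun _ => .name (.quote Y))))
  | msgP {j : ℕ} {Y : RhoProc 0} : Y.code = Code.grow^[j] m.p.linc.code →
      IsLab .msgP (.lift (.name m.p.rinc) Y)
  | nuIn {w : RhoName} : w ∈ m.nu →
      IsLab .nuIn (.inp (.name w) (.lift (.name (m.φ m.u)) (.drop (.bound 0))))
  | nuOut {i : ℕ} {w : RhoName} {Y : RhoProc 0} : w ∈ m.nu → m.IsVal i (.quote Y) →
      IsLab (.nuOut i) (.lift (.name w) Y)
  | uOut {i : ℕ} {Y : RhoProc 0} : m.IsVal i (.quote Y) →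
      IsLab (.uOut i) (.lift (.name (m.φ m.u)) Y)
  | ctx0 : IsLab .ctx0 (.inp (.name (m.φ m.u)) (.inp (.name (m.φ m.u))
      (.par (.lift (.bound 1) (.drop (.name (m.φ m.o)))) (m.test (.bound 0)))))
  | ctx1 {i : ℕ} {Y : RhoProc 0} : m.IsVal i (.quote Y) →
      IsLab (.ctx1 i) (.inp (.name (m.φ m.u))
        (.par (.lift (.name (.quote Y)) (.drop (.name (m.φ m.o)))) (m.test (.bound 0))))
  | ctxOut {i : ℕ} {w : RhoName} (Y : RhoProc 0) : m.IsVal i w →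
      IsLab (.ctxOut i) (.lift (.name w) Y)
  | ctxIn {i : ℕ} {w : RhoName} : m.IsVal i w → IsLab (.ctxIn i) (m.test (.name w))
  | xOut (Y : RhoProc 0) : IsLab .xOut (.lift (.name (m.φ m.x)) Y)
  | q {P : RhoProc 0} : QPart m.φ m.F m.b m.Q P → IsLab .q P

/-- A class is the sum of components with the given labels. -/
def HasLabels (r : RhoCls 0) (ls : Multiset Lab) : Prop :=
  ∃ M : Multiset (Lab × RhoProc 0), (∀ a ∈ M, m.IsLab a.1 a.2) ∧
    r = clsSum (M.map Prod.snd) ∧ M.map Prod.fst = ls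

variable {m}

theorem IsLab.hasLabels {l : Lab} {P : RhoProc 0} (h : m.IsLab l P) :
    m.HasLabels P.cls {l} := by
  refine ⟨{(l, P)}, fun a ha => ?_, by simp, by simp⟩
  rw [Multiset.mem_singleton.1 ha]; exact h

theorem HasLabels.add {r r' : RhoCls 0} {ls ls' : Multiset Lab} (h : m.HasLabels r ls)
    (h' : m.HasLabels r' ls') : m.HasLabels (r + r') (ls + ls') := by
  obtain ⟨M, h₁, rfl, rfl⟩ := h
  obtain ⟨M', h₁', rfl, rfl⟩ := h'
  refine ⟨M + M', fun a ha => (Multiset.mem_add.1 ha).elim (h₁ a) (h₁' a), by simp, by simp⟩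

theorem HasLabels.of_parts {L : Multiset (RhoProc 0)}
    (h : ∀ P ∈ L, QPart m.φ m.F m.b m.Q P) :
    ∃ k, m.HasLabels (clsSum L) (Multiset.replicate k .q) := by
  refine ⟨L.card, L.map fun P => (.q, P), fun a ha => ?_, ?_, ?_⟩
  · obtain ⟨P, hP, rfl⟩ := Multiset.mem_map.1 ha
    exact .q (h P hP)
  · simp [Multiset.map_map]
  · simp [Multiset.map_map]

theorem HasLabels.extract {r : RhoCls 0} {l : Lab} {ls : Multiset Lab}
    (h : m.HasLabels r (l ::ₘ ls)) :
    ∃ P r', m.IsLab l P ∧ r = P.cls + r' ∧ m.HasLabels r' ls := by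
  obtain ⟨M, h₁, rfl, h₂⟩ := h
  have : l ∈ M.map Prod.fst := by rw [h₂]; exact Multiset.mem_cons_self _ _
  obtain ⟨⟨l', P⟩, hP, rfl⟩ := Multiset.mem_map.1 this
  obtain ⟨M', rfl⟩ := Multiset.exists_cons_of_mem hP
  refine ⟨P, clsSum (M'.map Prod.snd), h₁ _ hP, by simp, M',
    fun a ha => h₁ a (Multiset.mem_cons_of_mem ha), rfl, ?_⟩
  simpa using h₂

/-- The reactions of labelled components. -/
inductive React (m : Machine) : Lab → Lab → Multiset Lab → Prop
  | copy : React m .copier .store {.server, .store}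
  | recvN (i : ℕ) : React m .server (.msgN i) {.wait i}
  | recvP (i k : ℕ) : React m (.wait i) .msgP
      (m.K i + Multiset.replicate k .q + {.copier, .msgN (i + 1), .msgP})
  | nu (i : ℕ) : React m .nuIn (.nuOut i) {.uOut i}
  | ctx0 (i : ℕ) : React m .ctx0 (.uOut i) {.ctx1 i}
  | ctx1 (i j : ℕ) : React m (.ctx1 i) (.uOut j) {.ctxOut i, .ctxIn j}
  | ctxIn {i j : ℕ} : m.val i = m.val j → React m (.ctxIn i) (.ctxOut j) {.xOut}
  | q (k : ℕ) : React m .q .q (Multiset.replicate k .q)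

/-- The values of the two parameters of a round. -/
def params (Y Z : RhoProc 0) : Fin 2 → RhoRef 0 :=
  Fin.cases (.name (.quote Z)) fun _ => .name (.quote Y)

/-- The free names of the pi-calculus process. -/
def IsFree (m : Machine) (a : ℕ) : Prop := a = m.u ∨ a = m.x ∨ a = m.o ∨ a ∈ m.F

/-- The conditions under which the components interact only as intended. -/
structure Valid (m : Machine) : Prop where
  inj : ∀ a b : ℕ, RhoNameEq (m.φ a) (m.φ b) → a = b
  ux : m.u ≠ m.x
  uF : m.u ∉ m.F
  xF : m.x ∉ m.F
  size : m.n.code.2 = m.p.code.2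
  ne : m.n.code.1 ≠ m.p.code.1
  -- The threshold `s` separates the free names from the names created by restrictions. It is not
  -- fixed to be `m.b`, because a restriction outside the replication sends a name built from
  -- smaller parameters.
  exists_bound : ∃ s ≤ m.b, (∀ a, m.IsFree a → (m.φ a).code.2 < s) ∧
    (∀ i, s ≤ (m.val i).2) ∧ ∀ w ∈ m.nu, s ≤ w.code.2
  val : ∀ i, ∃ d e, m.val i = Code.node false d e
  isVal : ∀ i w, m.IsVal i w → w.code = m.val i
  nu : ∀ w ∈ m.nu, ∃ e f, w.code = Code.node false e f
  val_nu : ∀ i, ∀ w ∈ m.nu, w.code ≠ m.val i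
  content : ∀ (i j : ℕ) (Y Z : RhoProc 0), Y.code = Code.grow^[i] m.n.linc.code →
    Z.code = Code.grow^[j] m.p.linc.code → ∃ k,
      m.HasLabels (m.X.semSubst (params Y Z)).cls (m.K i + Multiset.replicate k .q)

-- Separation of channels by shape and size

/-- The kinds of channels. -/
inductive Kind : Type
  | pi (a : ℕ) | copyM | dataN | dataP | nu | val | copyQ | dataQ

variable (m) in
/-- The channels of each kind. -/
def Chan : Kind → RhoName → Prop
  | .pi a, w => m.IsFree a ∧ RhoNameEq w (m.φ a)
  | .copyM, w => w.code = m.c.code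
  | .dataN, w => w.code = m.n.rinc.code
  | .dataP, w => w.code = m.p.rinc.code
  | .nu, w => w ∈ m.nu
  | .val, w => ∃ i, m.IsVal i w
  | .copyQ, w => IsCopy m.b w
  | .dataQ, w => IsData m.b w

/-- The shape of the code of a channel. -/
def Shape : ℕ → Code → Prop
  | 0, d => ∃ e f, d.1 = (Code.node false e f).1
  | 1, d => ∃ e f, d.1 = (Code.node true e f).1
  | _, d => d.1.card = 2

theorem Shape.unique {t t' : ℕ} {d : Code} (ht : t ≤ 2) (ht' : t' ≤ 2) (h : Shape t d)
    (h' : Shape t' d) : t = t' := by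
  interval_cases t <;> interval_cases t' <;> first
    | rfl
    | (obtain ⟨e, f, h⟩ := h
       obtain ⟨e', f', h'⟩ := h'
       rw [h] at h'
       have := (Code.node_injective h').1
       simp at this)
    | (obtain ⟨e, f, h⟩ := h
       simp [Shape, h, Code.node] at h')
    | (obtain ⟨e, f, h'⟩ := h'
       simp [Shape, h', Code.node] at h)

/-- The shape of the channels of a kind. -/
def Kind.shape : Kind → ℕ
  | .pi _ => 0
  | .copyM => 2
  | .dataN => 1
  | .dataP => 1
  | .nu => 0
  | .val => 0
  | .copyQ => 2
  | .dataQ => 1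

/-- The kind of a channel that is not a name of the pi-calculus. -/
def Kind.IsPi : Kind → Prop
  | .pi _ => True
  | _ => False

theorem card_comp (n p : RhoName) : (n.comp p).code.1.card = 2 := by
  simp [RhoName.code_comp, Code.node]

theorem Chan.shape (hm : m.Valid) {κ : Kind} {x : RhoName} (h : m.Chan κ x)
    (hκ : ¬ κ.IsPi) : Shape κ.shape x.code := by
  cases κ with
  | pi a => exact (hκ trivial).elim
  | copyM => rw [Chan] at h; rw [h]; exact card_comp _ _
  | dataN => rw [Chan] at h; rw [h]; exact ⟨_, _, rfl⟩
  | dataP => rw [Chan] at h; rw [h]; exact ⟨_, _, rfl⟩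
  | nu => obtain ⟨e, f, h⟩ := hm.nu _ h; rw [h]; exact ⟨_, _, rfl⟩
  | val => obtain ⟨i, h⟩ := h; obtain ⟨e, f, h'⟩ := hm.val i; rw [hm.isVal _ _ h, h']; exact ⟨_, _, rfl⟩
  | copyQ => exact h.1
  | dataQ => exact h.1

/-- Free names have size below the threshold `s`; channels of every other kind have size at least
`s`. -/
theorem Chan.not_pi (hm : m.Valid) {a : ℕ} {κ : Kind} {x y : RhoName} (h : m.Chan (.pi a) x)
    (h' : m.Chan κ y) (hxy : RhoNameEq x y) : κ.IsPi := by
  obtain ⟨s, hs, h₁, h₂, h₃⟩ := hm.exists_bound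
  have hx := h₁ a h.1
  rw [← h.2.code_eq, hxy.code_eq] at hx
  have hsz := hm.size
  unfold b at hs
  cases κ with
  | pi a => trivial
  | copyM => rw [Chan] at h'; rw [h', c, size_comp] at hx; omega
  | dataN => rw [Chan] at h'; rw [h', size_rinc] at hx; omega
  | dataP => rw [Chan] at h'; rw [h', size_rinc] at hx; omega
  | nu => have := h₃ _ h'; omega
  | val => obtain ⟨i, h'⟩ := h'; have := h₂ i; rw [hm.isVal _ _ h'] at hx; omega
  | copyQ => have := h'.2; unfold b at this; omega
  | dataQ => have := h'.2; unfold b at this; omega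

/-- After free names are split off by size, the shape leaves few coincidences. Copying and data
channels of the machine have sizes exactly `2 + 2b` and `1 + b`, those inside `Q` strictly larger
ones; the two data channels of the machine differ since `n` and `p` do; `val_nu` separates the sent
names from the channels of restrictions. -/
theorem Chan.unique (hm : m.Valid) {κ κ' : Kind} {x y : RhoName} (h : m.Chan κ x)
    (h' : m.Chan κ' y) (hxy : RhoNameEq x y) : κ = κ' := by
  by_cases hκ : κ.IsPi
  · cases κ <;> try exact hκ.elim
    have := h.not_pi hm h' hxy
    cases κ' <;> try exact this.elim
    rw [hm.inj _ _ (h.2.symm.trans (hxy.trans h'.2))]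
  by_cases hκ' : κ'.IsPi
  · cases κ' <;> try exact hκ'.elim
    exact (hκ (h'.not_pi hm h hxy.symm)).elim
  have hs := h.shape hm hκ
  have hs' := h'.shape hm hκ'
  have he := hxy.code_eq
  rw [he] at hs
  have ht := hs.unique (by cases κ <;> simp [Kind.shape]) (by cases κ' <;> simp [Kind.shape]) hs'
  have hsz := hm.size
  have hsc := size_comp m.n m.p
  have hn := size_rinc m.n
  have hp := size_rinc m.p
  cases κ <;> cases κ' <;> first
    | rfl
    | exact (hκ trivial).elim
    | exact (hκ' trivial).elim
    | (simp [Kind.shape] at ht; done)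
    | skip
  · simp only [Chan, IsCopy, c, b] at h h'; rw [he] at h; rw [h] at h'; omega
  · simp only [Chan] at h h'
    rw [he, h'] at h
    exact (hm.ne (Code.node_injective (congrArg Prod.fst h)).2.1.symm).elim
  · simp only [Chan, IsData, b] at h h'; rw [he] at h; rw [h] at h'; omega
  · simp only [Chan] at h h'
    rw [he, h'] at h
    exact (hm.ne (Code.node_injective (congrArg Prod.fst h)).2.1).elim
  · simp only [Chan, IsData, b] at h h'; rw [he] at h; rw [h] at h'; omega
  · obtain ⟨i, h'⟩ := h'; exact (hm.val_nu i _ h (he.trans (hm.isVal _ _ h'))).elim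
  · obtain ⟨i, h⟩ := h; exact (hm.val_nu i _ h' (he.symm.trans (hm.isVal _ _ h))).elim
  · simp only [Chan, IsCopy, c, b] at h h'; rw [he, h'] at h; omega
  · simp only [Chan, IsData, b] at h h'; rw [he, h'] at h; omega
  · simp only [Chan, IsData, b] at h h'; rw [he, h'] at h; omega

/-- The kinds of the channels of the components of a given kind. -/
inductive LabKind (m : Machine) : Lab → Kind → Prop
  | copier : LabKind m .copier .copyM
  | store : LabKind m .store .copyM
  | server : LabKind m .server .dataN
  | msgN (i : ℕ) : LabKind m (.msgN i) .dataN
  | wait (i : ℕ) : LabKind m (.wait i) .dataP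
  | msgP : LabKind m .msgP .dataP
  | nuIn : LabKind m .nuIn .nu
  | nuOut (i : ℕ) : LabKind m (.nuOut i) .nu
  | uOut (i : ℕ) {κ : Kind} : κ = .pi m.u → LabKind m (.uOut i) κ
  | ctx0 {κ : Kind} : κ = .pi m.u → LabKind m .ctx0 κ
  | ctx1 (i : ℕ) {κ : Kind} : κ = .pi m.u → LabKind m (.ctx1 i) κ
  | ctxOut (i : ℕ) : LabKind m (.ctxOut i) .val
  | ctxIn (i : ℕ) : LabKind m (.ctxIn i) .val
  | xOut {κ : Kind} : κ = .pi m.x → LabKind m .xOut κ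
  | qPi {a : ℕ} {κ : Kind} : a ∈ m.F → κ = .pi a → LabKind m .q κ
  | qCopy : LabKind m .q .copyQ
  | qData : LabKind m .q .dataQ

theorem IsLab.inp_chan {l : Lab} {x : RhoName} {P : RhoProc 1}
    (h : m.IsLab l (.inp (.name x) P)) : ∃ κ, LabKind m l κ ∧ m.Chan κ x := by
  cases h with
  | copier => exact ⟨_, .copier, rfl⟩
  | server => exact ⟨_, .server, rfl⟩
  | wait => exact ⟨_, .wait _, rfl⟩
  | nuIn h => exact ⟨_, .nuIn, h⟩
  | ctx0 => exact ⟨_, .ctx0 rfl, .inl rfl, .refl _⟩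
  | ctx1 => exact ⟨_, .ctx1 _ rfl, .inl rfl, .refl _⟩
  | ctxIn h => exact ⟨_, .ctxIn _, _, h⟩
  | q h =>
    cases h with
    | inp _ h _ => cases h with | mk ha hw => exact ⟨_, .qPi ha rfl, .inr (.inr (.inr ha)), hw⟩
    | copier h => exact ⟨_, .qCopy, h⟩
    | server _ _ _ h => exact ⟨_, .qData, h⟩
    | round _ _ _ _ h => exact ⟨_, .qData, h⟩

theorem IsLab.lift_chan {l : Lab} {x : RhoName} {P : RhoProc 0}
    (h : m.IsLab l (.lift (.name x) P)) : ∃ κ, LabKind m l κ ∧ m.Chan κ x := by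
  cases h with
  | store => exact ⟨_, .store, rfl⟩
  | msgN => exact ⟨_, .msgN _, rfl⟩
  | msgP => exact ⟨_, .msgP, rfl⟩
  | nuOut h => exact ⟨_, .nuOut _, h⟩
  | uOut => exact ⟨_, .uOut _ rfl, .inl rfl, .refl _⟩
  | ctxOut _ h => exact ⟨_, .ctxOut _, _, h⟩
  | xOut => exact ⟨_, .xOut rfl, .inr (.inl rfl), .refl _⟩
  | q h =>
    cases h with
    | out _ h _ => cases h with | mk ha hw => exact ⟨_, .qPi ha rfl, .inr (.inr (.inr ha)), hw⟩
    | store _ _ h => exact ⟨_, .qCopy, h⟩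
    | data _ h => exact ⟨_, .qData, h⟩

theorem params_eq (Y Z : RhoProc 0) :
    RhoRef.sub (fun _ : Fin 1 => (.name (.quote Z) : RhoRef 0)) ∘
        subUnder (fun _ : Fin 1 => (.name (.quote Y) : RhoRef 0)) =
      params Y Z := by
  funext i
  refine Fin.cases rfl (fun _ => rfl) i

theorem body_params (Y Z : RhoProc 0) : m.body.semSubst (params Y Z) =
    .round m.c m.n.rinc m.p.rinc (m.X.semSubst (params Y Z)) (.lift (.name (.quote Y)) Y)
      (.lift (.name (.quote Z)) Z) := by
  have h₀ : params Y Z 0 = .name (.quote Z) := rfl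
  have h₁ : params Y Z 1 = .name (.quote Y) := rfl
  simp [body, h₀, h₁]

/-- Distinct replications inside `Q` may share channels. This is harmless: whichever copier meets
whichever stored process, or whichever input meets whichever parameter, the result again consists of
components of translated available threads. -/
theorem qPart_react (hm : m.Valid) {x y : RhoName} {P : RhoProc 1} {R : RhoProc 0}
    (h : QPart m.φ m.F m.b m.Q (.inp (.name x) P)) (h' : QPart m.φ m.F m.b m.Q (.lift (.name y) R))
    (hxy : RhoNameEq x y) : ∃ k, m.HasLabels (P.recv R).cls (Multiset.replicate k .q) := by
  have key : ∀ {T : PiProc 0} {X : RhoProc 0}, Avail m.Q T → Translates m.b (NameRep m.φ m.F) T X →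
      ∃ k, m.HasLabels X.cls (Multiset.replicate k .q) := by
    intro T X hT hX
    obtain ⟨L, hL, e⟩ := hX.exists_parts hT
    rw [e]; exact HasLabels.of_parts hL
  have single : ∀ {X : RhoProc 0}, QPart m.φ m.F m.b m.Q X →
      m.HasLabels X.cls {.q} := fun h => (IsLab.q h).hasLabels
  cases h with
  | inp hT hx hX =>
    cases hx with | mk ha hw =>
    have hc : m.Chan (.pi _) x := ⟨.inr (.inr (.inr ha)), hw⟩
    cases h' with
    | out hT' hy hz =>
      cases hy with | mk ha' hw' =>
      -- Injectivity of `φ` up to equivalence turns the communication into one between two available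
      -- threads of `Q`, so its result is available.
      obtain rfl := hm.inj _ _ (hw.symm.trans (hxy.trans hw'))
      exact key (hT.com hT') (hX.recv hz)
    | store _ _ h => cases hc.unique hm (κ' := .copyQ) h hxy
    | data _ h => cases hc.unique hm (κ' := .dataQ) h hxy
  | copier hc =>
    have hc : m.Chan .copyQ x := hc
    cases h' with
    | out hT' hy hz =>
      cases hy with | mk ha' hw' =>
      cases hc.unique hm (κ' := .pi _) ⟨.inr (.inr (.inr ha')), hw'⟩ hxy
    | store Y₁ Y₂ _ h₁ h₂ h₃ hT hX =>
      refine ⟨2, ?_⟩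
      rw [RhoProc.recv_copier]
      exact (single (.server _ _ h₁ h₂ h₃ hT hX)).add (single (.store _ _ hc h₁ h₂ h₃ hT hX))
    | data _ h => cases hc.unique hm (κ' := .dataQ) h hxy
  | server Y₁ Y₂ h₁ h₂ h₃ hT hX =>
    refine ⟨1, single ?_⟩
    rw [RhoProc.recv, RhoProc.semSubst_inp, RhoProc.semSubst_round]
    refine .round _ _ h₁ h₂ h₃ hT (hX.semSubst (RelShift.sub ?_))
    rintro _ _ ⟨h⟩
    cases h with | mk h h' => exact .mk h h'
  | round Y₁ Y₂ h₁ h₂ h₃ hT hX =>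
    rw [RhoProc.recv, RhoProc.semSubst_round]
    have hX' := hX.semSubst (s := fun _ => .name (.quote R)) (ρ' := NameRep m.φ m.F) (by
      rintro _ _ ⟨h⟩
      cases h with | mk h h' => exact .mk h h')
    obtain ⟨k, hk⟩ := key hT hX'
    refine ⟨k + 3, ?_⟩
    rw [Multiset.replicate_add]
    exact hk.add ((single (.copier h₁)).add ((single (.data _ h₂)).add (single (.data _ h₃))))

/-- The channels of the two partners are equivalent, hence of one kind, and the kind leaves only the
intended pairs of labels. What remains is to compute the result of each communication. -/
theorem IsLab.react (hm : m.Valid) {a b : Lab} {x y : RhoName} {P : RhoProc 1} {R : RhoProc 0}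
    (ha : m.IsLab a (.inp (.name x) P)) (hb : m.IsLab b (.lift (.name y) R))
    (hxy : RhoNameEq x y) : ∃ ls, React m a b ls ∧ m.HasLabels (P.recv R).cls ls := by
  obtain ⟨κ, hκ, hc⟩ := ha.inp_chan
  obtain ⟨κ', hκ', hc'⟩ := hb.lift_chan
  obtain rfl := hc.unique hm hc' hxy
  have hq : ∀ {a : ℕ}, a ∈ m.F → κ = .pi a → κ ≠ .pi m.u ∧ κ ≠ .pi m.x := by
    rintro a ha rfl
    exact ⟨fun h => hm.uF (Kind.pi.inj h ▸ ha), fun h => hm.xF (Kind.pi.inj h ▸ ha)⟩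
  have hux : κ = .pi m.u → κ ≠ .pi m.x := by
    rintro rfl h
    exact hm.ux (Kind.pi.inj h)
  have hqq : a = .q → b = .q →
      ∃ ls, React m a b ls ∧ m.HasLabels (P.recv R).cls ls := by
    rintro rfl rfl
    cases ha with | q ha =>
    cases hb with | q hb =>
    obtain ⟨k, hk⟩ := qPart_react hm ha hb hxy
    exact ⟨_, .q k, hk⟩
  -- Impossible pairs are discarded here: components of the wrong polarity, different kinds, or
  -- different free names.
  cases hκ <;> cases hκ' <;> first
    | (cases ha; done)
    | (cases hb; done)
    | exact hqq rfl rfl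
    | (rename_i h; cases h; done)
    | exact (hux ‹_› ‹_›).elim
    | exact ((hq ‹_› ‹_›).1 ‹_›).elim
    | exact ((hq ‹_› ‹_›).2 ‹_›).elim
    | skip
  · cases ha; cases hb
    refine ⟨_, .copy, ?_⟩
    rw [RhoProc.recv_copier]
    exact (IsLab.server.hasLabels).add IsLab.store.hasLabels
  · cases ha
    cases hb with | msgN h =>
    exact ⟨_, .recvN _, (IsLab.wait h).hasLabels⟩
  · cases ha with | wait h =>
    cases hb with | @msgP j _ h' =>
    obtain ⟨k, hk⟩ := hm.content _ _ _ _ h h'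
    refine ⟨_, .recvP _ k, ?_⟩
    rw [RhoProc.recv, RhoProc.semSubst_semSubst, params_eq, body_params]
    refine hk.add (IsLab.copier.hasLabels.add ((IsLab.msgN ?_).hasLabels.add
      (IsLab.msgP (j := j + 1) ?_).hasLabels))
    · rw [Function.iterate_succ_apply', ← h]; rfl
    · rw [Function.iterate_succ_apply', ← h']; rfl
  · cases ha
    cases hb with | nuOut _ h =>
    refine ⟨_, .nu _, ?_⟩
    have : RhoProc.recv (.lift (.name (m.φ m.u)) (.drop (.bound 0))) R =
      .lift (.name (m.φ m.u)) R := by simp [RhoProc.recv]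
    rw [this]
    exact (IsLab.uOut h).hasLabels
  · cases ha
    cases hb with | uOut h =>
    refine ⟨_, .ctx0 _, ?_⟩
    exact (IsLab.ctx1 h).hasLabels
  · cases ha with | ctx1 h =>
    cases hb with | uOut h' =>
    refine ⟨_, .ctx1 _ _, ?_⟩
    exact (IsLab.ctxOut (w := .quote _) _ h).hasLabels.add
      (IsLab.ctxIn (w := .quote R) h').hasLabels
  · cases ha with | ctxIn h =>
    cases hb with | ctxOut _ h' =>
    refine ⟨_, .ctxIn ((hm.isVal _ _ h).symm.trans (hxy.code_eq.trans (hm.isVal _ _ h'))), ?_⟩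
    have : RhoProc.recv (.lift (.name (m.φ m.x)) (.drop (.name (m.φ m.o)))) R =
      .lift (.name (m.φ m.x)) (.drop (.name (m.φ m.o))) := by simp [RhoProc.recv]
    rw [this]
    exact (IsLab.xOut _).hasLabels

theorem IsLab.comps {l : Lab} {P : RhoProc 0} (h : m.IsLab l P) : P.comps = {P} := by
  cases h with
  | q h => cases h <;> rfl
  | _ => rfl

theorem HasLabels.step (hm : m.Valid) {A A' : RhoProc 0} {ls : Multiset Lab}
    (h : m.HasLabels A.cls ls) (hr : RhoRed A A') :
    ∃ a b r ls', ls = a ::ₘ b ::ₘ r ∧ React m a b ls' ∧ m.HasLabels A'.cls (ls' + r) := by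
  obtain ⟨M, h₁, h₂, rfl⟩ := h
  obtain ⟨x, y, P, R, L, e, hxy, hA'⟩ := hr.of_sum (fun P hP => by
    obtain ⟨a, ha, rfl⟩ := Multiset.mem_map.1 hP
    exact (h₁ a ha).comps) h₂
  have he : RhoProc.inp (.name x) P ∈ M.map Prod.snd := by rw [e]; exact Multiset.mem_cons_self _ _
  obtain ⟨⟨a, X⟩, ha, hX⟩ := Multiset.mem_map.1 he
  obtain ⟨M, rfl⟩ := Multiset.exists_cons_of_mem ha
  obtain rfl : X = _ := hX
  rw [Multiset.map_cons, Multiset.cons_inj_right] at e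
  have he : RhoProc.lift (.name y) R ∈ M.map Prod.snd := by
    rw [e]; exact Multiset.mem_cons_self _ _
  obtain ⟨⟨b, Y⟩, hb, hY⟩ := Multiset.mem_map.1 he
  obtain ⟨M, rfl⟩ := Multiset.exists_cons_of_mem hb
  obtain rfl : Y = _ := hY
  rw [Multiset.map_cons, Multiset.cons_inj_right] at e
  obtain ⟨ls', h₃, h₄⟩ := (h₁ _ ha).react hm (h₁ _ (Multiset.mem_cons_of_mem hb)) hxy
  refine ⟨a, b, M.map Prod.fst, ls', by simp, h₃, ?_⟩
  rw [hA']
  exact h₄.add ⟨M, fun c hc => h₁ c (Multiset.mem_cons_of_mem (Multiset.mem_cons_of_mem hc)),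
    by rw [e], rfl⟩

theorem HasLabels.barb {N : Set RhoName} (hN : ∀ x y, RhoNameEq x y → x ∈ N → y ∈ N)
    {A : RhoProc 0} {ls : Multiset Lab} {o : Obs RhoName} (h : m.HasLabels A.cls ls)
    (ho : RhoBarb N A o) : o.name ∈ N ∧ ∃ l ∈ ls, ∃ P, m.IsLab l P ∧ PrefixBarb P o := by
  obtain ⟨M, h₁, h₂, rfl⟩ := h
  obtain ⟨hn, P, hP, hPo⟩ := ho.of_sum hN (fun P hP => by
    obtain ⟨a, ha, rfl⟩ := Multiset.mem_map.1 hP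
    exact (h₁ a ha).comps) h₂
  obtain ⟨a, ha, rfl⟩ := Multiset.mem_map.1 hP
  exact ⟨hn, a.1, Multiset.mem_map_of_mem _ ha, a.2, h₁ a ha, hPo⟩

end Machine

/-! ### Conserved quantities -/

/-- Six quantities that are conserved by all reactions. -/
def Lab.weight : Lab → Fin 6 → ℕ
  | .copier => ![1, 0, 0, 0, 0, 0]
  | .store => ![0, 1, 0, 0, 0, 0]
  | .server => ![1, 0, 0, 0, 0, 0]
  | .msgN _ => ![0, 0, 1, 0, 0, 0]
  | .wait _ => ![1, 0, 1, 0, 0, 0]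
  | .msgP => ![0, 0, 0, 1, 0, 0]
  | .ctx0 => ![0, 0, 0, 0, 1, 1]
  | .ctx1 _ => ![0, 0, 0, 0, 1, 1]
  | .ctxIn _ => ![0, 0, 0, 0, 1, 0]
  | .ctxOut _ => ![0, 0, 0, 0, 0, 1]
  | .xOut => ![0, 0, 0, 0, 1, 1]
  | _ => 0

theorem Lab.weight_zero_ne {l : Lab} (h : l.weight 0 ≠ 0) :
    l = .copier ∨ l = .server ∨ ∃ i, l = .wait i := by
  cases l <;> simp [Lab.weight] at h ⊢

theorem Lab.weight_one_ne {l : Lab} (h : l.weight 1 ≠ 0) : l = .store := by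
  cases l <;> simp [Lab.weight] at h ⊢

theorem Lab.weight_two_ne {l : Lab} (h : l.weight 2 ≠ 0) :
    (∃ i, l = .msgN i) ∨ ∃ i, l = .wait i := by
  cases l <;> simp [Lab.weight] at h ⊢

theorem Lab.weight_three_ne {l : Lab} (h : l.weight 3 ≠ 0) : l = .msgP := by
  cases l <;> simp [Lab.weight] at h ⊢

theorem Lab.weight_four_ne {l : Lab} (h : l.weight 4 ≠ 0) :
    l = .ctx0 ∨ (∃ i, l = .ctx1 i) ∨ (∃ i, l = .ctxIn i) ∨ l = .xOut := by
  cases l <;> simp [Lab.weight] at h ⊢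

theorem Lab.weight_five_ne {l : Lab} (h : l.weight 5 ≠ 0) :
    l = .ctx0 ∨ (∃ i, l = .ctx1 i) ∨ (∃ i, l = .ctxOut i) ∨ l = .xOut := by
  cases l <;> simp [Lab.weight] at h ⊢

/-- The test context still waits for an output on `u`. -/
def Lab.Early : Lab → Prop
  | .ctx0 => True
  | .ctx1 _ => True
  | _ => False

namespace Machine

variable {m : Machine}

/-- The total weight. -/
def weight (ls : Multiset Lab) : Fin 6 → ℕ := (ls.map Lab.weight).sum

@[simp] theorem weight_cons (l : Lab) (ls : Multiset Lab) :
    weight (l ::ₘ ls) = l.weight + weight ls := by simp [weight]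

@[simp] theorem weight_add (ls ls' : Multiset Lab) :
    weight (ls + ls') = weight ls + weight ls' := by simp [weight]

@[simp] theorem weight_singleton (l : Lab) : weight {l} = l.weight := by simp [weight]

@[simp] theorem weight_replicate_q (k : ℕ) : weight (Multiset.replicate k .q) = 0 := by
  simp [weight, Lab.weight]

/-- The `q` components have weight zero, so the uncontrolled activity of `Q` does not disturb the
quantities of the machine and the test. -/
theorem React.weight {a b : Lab} {ls : Multiset Lab} (h : React m a b ls)
    (hK : ∀ i, weight (m.K i) = 0) : Machine.weight ls = a.weight + b.weight := by
  cases h <;> simp only [Multiset.insert_eq_cons, weight_cons, weight_singleton, weight_add, hK,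
    weight_replicate_q] <;> ext i <;> fin_cases i <;> rfl

/-- The phase of the test is irreversible: an early component arises only from an early input
component. -/
theorem React.early {a b : Lab} {ls : Multiset Lab} (h : React m a b ls)
    (hK : ∀ i, ∀ l ∈ m.K i, ¬ l.Early) {l : Lab} (hl : l ∈ ls) (he : l.Early) : a.Early := by
  cases h with
  | recvP i k =>
    rcases Multiset.mem_add.1 hl with hl | hl
    · rcases Multiset.mem_add.1 hl with hl | hl
      · exact (hK i l hl he).elim
      · rw [Multiset.eq_of_mem_replicate hl] at he; exact he.elim
    · simp only [Multiset.insert_eq_cons, Multiset.mem_cons, Multiset.mem_singleton] at hl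
      rcases hl with rfl | rfl | rfl <;> exact he.elim
  | q k => rw [Multiset.eq_of_mem_replicate hl] at he; exact he.elim
  | ctx0 => trivial
  | ctx1 => trivial
  | _ =>
    simp only [Multiset.insert_eq_cons, Multiset.mem_cons, Multiset.mem_singleton] at hl
    rcases hl with rfl | rfl <;> exact he.elim

theorem exists_weight {ls : Multiset Lab} {i : Fin 6} (h : weight ls i ≠ 0) :
    ∃ l ls', ls = l ::ₘ ls' ∧ l.weight i ≠ 0 := by
  induction ls using Multiset.induction_on with
  | empty => exact (h rfl).elim
  | cons a ls ih =>
    by_cases ha : a.weight i = 0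
    · rw [weight_cons, Pi.add_apply, ha, zero_add] at h
      obtain ⟨l, ls', rfl, hl⟩ := ih h
      exact ⟨l, a ::ₘ ls', Multiset.cons_swap _ _ _, hl⟩
    · exact ⟨a, ls, rfl, ha⟩

/-! ### Progress -/

/-- A state of the given weight. -/
def State (m : Machine) (v : Fin 6 → ℕ) (A : RhoProc 0) (ls : Multiset Lab) : Prop :=
  m.HasLabels A.cls ls ∧ weight ls = v

theorem State.step {v : Fin 6 → ℕ} (hm : m.Valid) (hK : ∀ i, weight (m.K i) = 0) {A A' : RhoProc 0}
    {ls : Multiset Lab} (h : m.State v A ls) (hr : RhoRed A A') :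
    ∃ a b r ls', ls = a ::ₘ b ::ₘ r ∧ React m a b ls' ∧ m.State v A' (ls' + r) := by
  obtain ⟨a, b, r, ls', rfl, h₁, h₂⟩ := h.1.step hm hr
  refine ⟨a, b, r, ls', rfl, h₁, h₂, ?_⟩
  have := h.2
  rw [weight_add, h₁.weight hK, ← this]
  simp [add_assoc]

/-- Components of the two kinds can always communicate. -/
def Fires (m : Machine) (a b : Lab) : Prop :=
  ∀ X Y, m.IsLab a X → m.IsLab b Y →
    ∃ x P y R, X = .inp (.name x) P ∧ Y = .lift (.name y) R ∧ RhoNameEq x y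

/-- The converse direction to `State.step`: labels known to react guarantee an actual reduction of
the process. -/
theorem State.fire {v : Fin 6 → ℕ} (hm : m.Valid)
    (hK : ∀ i, weight (m.K i) = 0) {a b : Lab} (hf : m.Fires a b)
    {A : RhoProc 0} {r : Multiset Lab} (h : m.State v A (a ::ₘ b ::ₘ r)) :
    ∃ A' ls', RhoRed A A' ∧ React m a b ls' ∧ m.State v A' (ls' + r) := by
  obtain ⟨X, q, hX, e, h₁⟩ := h.1.extract
  obtain ⟨Y, q', hY, rfl, h₁'⟩ := h₁.extract
  obtain ⟨x, P, y, R, rfl, rfl, hxy⟩ := hf X Y hX hY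
  obtain ⟨C, rfl⟩ := q'.exists_rep
  obtain ⟨ls', h₂, h₃⟩ := hX.react hm hY hxy
  refine ⟨.par (P.recv R) C, ls', ?_, h₂, h₃.add h₁', ?_⟩
  · refine RhoRed.of_cls (.par C (.com P R hxy)) ?_ rfl
    rw [e, RhoProc.cls_par, RhoProc.cls_par, add_assoc]
  · have := h.2
    rw [weight_add, h₂.weight hK, ← this]
    simp [add_assoc]

theorem fires_copier : m.Fires .copier .store := by
  rintro _ _ ⟨⟩ ⟨⟩; exact ⟨_, _, _, _, rfl, rfl, .refl _⟩

theorem fires_server (i : ℕ) : m.Fires .server (.msgN i) := by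
  rintro _ _ ⟨⟩ ⟨⟩; exact ⟨_, _, _, _, rfl, rfl, .refl _⟩

theorem fires_wait (i : ℕ) : m.Fires (.wait i) .msgP := by
  rintro _ _ ⟨⟩ ⟨⟩; exact ⟨_, _, _, _, rfl, rfl, .refl _⟩

theorem fires_ctx0 (i : ℕ) : m.Fires .ctx0 (.uOut i) := by
  rintro _ _ ⟨⟩ ⟨⟩; exact ⟨_, _, _, _, rfl, rfl, .refl _⟩

theorem fires_ctx1 (i j : ℕ) : m.Fires (.ctx1 i) (.uOut j) := by
  rintro _ _ ⟨⟩ ⟨⟩; exact ⟨_, _, _, _, rfl, rfl, .refl _⟩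

/-- Reachability. -/
abbrev Reds : RhoProc 0 → RhoProc 0 → Prop := Relation.ReflTransGen RhoRed

/-- The additional conditions under which the machine can always make progress. -/
structure Live (m : Machine) : Prop where
  valid : m.Valid
  weight_K : ∀ i, weight (m.K i) = 0
  early_K : ∀ i, ∀ l ∈ m.K i, ¬ l.Early
  same : ∀ i j w w', m.IsVal i w → m.IsVal j w' → RhoNameEq w w'
  -- The weight `v` is arbitrary because this is applied to states from which a component of the
  -- test context has been set aside.
  output : ∀ v i A r, m.State v A (m.K i + r) → ∃ A' j r', Reds A A' ∧ m.State v A' (.uOut j ::ₘ r')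
  content : ∀ Y Z, ∃ X q, Translates m.b (NameRep m.φ m.F) m.Q X ∧
    (m.X.semSubst (params Y Z)).cls = X.cls + q

theorem fires_ctxIn (hm : m.Live) (i j : ℕ) : m.Fires (.ctxIn i) (.ctxOut j) := by
  rintro _ _ (_ | _ | _ | _ | _ | _ | _ | _ | _ | _ | _ | _ | h) h'
  cases h' with | ctxOut Y h' =>
  exact ⟨_, _, _, _, rfl, rfl, hm.same _ _ _ _ h h'⟩

variable {v : Fin 6 → ℕ}

theorem State.exists_lab {A : RhoProc 0} {ls : Multiset Lab} (h : m.State v A ls) (i : Fin 6)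
    (hv : v i = 1) : ∃ l r, ls = l ::ₘ r ∧ l.weight i ≠ 0 := by
  refine exists_weight ?_
  rw [h.2, hv]; exact one_ne_zero

theorem State.exists_lab_cons {A : RhoProc 0} {a : Lab} {ls : Multiset Lab}
    (h : m.State v A (a ::ₘ ls)) {i : Fin 6} (hv : v i = 1)
    (ha : a.weight i = 0) : ∃ l r, ls = l ::ₘ r ∧ l.weight i ≠ 0 := by
  refine exists_weight ?_
  have := congrFun h.2 i
  rw [weight_cons, Pi.add_apply, ha, zero_add] at this
  rw [this, hv]; exact one_ne_zero

theorem State.weight_cons_eq {A : RhoProc 0} {a : Lab} {ls : Multiset Lab}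
    (h : m.State v A (a ::ₘ ls)) (i : Fin 6) : a.weight i + weight ls i = v i := by
  have := congrFun h.2 i
  rwa [weight_cons] at this

/-- The copier uses up the unit of weight in coordinate `0`, so the component of weight one in
coordinate `2` cannot be a waiting server and must be a message. -/
theorem State.msgs (hv : ∀ i < 4, v i = 1)
    {A : RhoProc 0} {r : Multiset Lab} (h : m.State v A (.copier ::ₘ r)) :
    ∃ i r', r = .store ::ₘ .msgN i ::ₘ .msgP ::ₘ r' := by
  have h1 : weight r 1 = 1 := by
    simpa [Lab.weight, hv 1 (by decide)] using h.weight_cons_eq 1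
  have h2 : weight r 2 = 1 := by
    simpa [Lab.weight, hv 2 (by decide)] using h.weight_cons_eq 2
  have h3 : weight r 3 = 1 := by
    simpa [Lab.weight, hv 3 (by decide)] using h.weight_cons_eq 3
  have h0 : weight r 0 = 0 := by
    simpa [Lab.weight, hv 0 (by decide)] using h.weight_cons_eq 0
  obtain ⟨l, r, rfl, hl⟩ := exists_weight (by rw [h1]; exact one_ne_zero)
  obtain rfl := Lab.weight_one_ne hl
  rw [weight_cons] at h2 h3 h0
  have h2 : weight r 2 = 1 := by simpa [Lab.weight] using h2
  have h3 : weight r 3 = 1 := by simpa [Lab.weight] using h3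
  have h0 : weight r 0 = 0 := by simpa [Lab.weight] using h0
  obtain ⟨l, r, rfl, hl⟩ := exists_weight (by rw [h2]; exact one_ne_zero)
  rcases Lab.weight_two_ne hl with ⟨i, rfl⟩ | ⟨i, rfl⟩
  · rw [weight_cons] at h3
    have h3 : weight r 3 = 1 := by simpa [Lab.weight] using h3
    obtain ⟨l, r, rfl, hl⟩ := exists_weight (by rw [h3]; exact one_ne_zero)
    obtain rfl := Lab.weight_three_ne hl
    exact ⟨i, r, rfl⟩
  · simp [Lab.weight] at h0

/-- A round in progress can always be finished, and the replication is then back in its idle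
position. The coordinates `0` to `3` say that exactly one round position, one stored process and one
parameter of each sort are present. -/
theorem State.ready (hv : ∀ i < 4, v i = 1) (hm : m.Live)
    {A : RhoProc 0} {ls : Multiset Lab} (h : m.State v A ls) :
    ∃ A' i r, Reds A A' ∧ m.State v A' (.copier ::ₘ .store ::ₘ .msgN i ::ₘ .msgP ::ₘ r) := by
  have wait : ∀ {A : RhoProc 0} {i : ℕ} {r : Multiset Lab}, m.State v A (.wait i ::ₘ r) →
      ∃ A' i r, Reds A A' ∧ m.State v A' (.copier ::ₘ .store ::ₘ .msgN i ::ₘ .msgP ::ₘ r) := by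
    intro A i r h
    obtain ⟨l, r, rfl, hl⟩ := h.exists_lab_cons (i := 3) (hv 3 (by decide)) rfl
    obtain rfl := Lab.weight_three_ne hl
    obtain ⟨A', ls', h₁, h₂, h₃⟩ := h.fire hm.valid hm.weight_K (fires_wait i)
    cases h₂ with | recvP _ k =>
    have e : m.K i + Multiset.replicate k Lab.q + {.copier, .msgN (i + 1), .msgP} + r =
        .copier ::ₘ (.msgN (i + 1) ::ₘ .msgP ::ₘ (m.K i + Multiset.replicate k Lab.q + r)) := by
      simp only [Multiset.insert_eq_cons, ← Multiset.singleton_add]; abel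
    rw [e] at h₃
    obtain ⟨j, r', e'⟩ := h₃.msgs hv
    rw [e'] at h₃
    exact ⟨A', j, r', .single h₁, h₃⟩
  obtain ⟨l, r, rfl, hl⟩ := h.exists_lab 0 (hv 0 (by decide))
  rcases Lab.weight_zero_ne hl with rfl | rfl | ⟨i, rfl⟩
  · obtain ⟨i, r', rfl⟩ := h.msgs hv
    exact ⟨A, i, r', .refl, h⟩
  · obtain ⟨l, r, rfl, hl⟩ := h.exists_lab_cons (i := 2) (hv 2 (by decide)) rfl
    rcases Lab.weight_two_ne hl with ⟨i, rfl⟩ | ⟨i, rfl⟩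
    · obtain ⟨A', ls', h₁, h₂, h₃⟩ := h.fire hm.valid hm.weight_K (fires_server i)
      cases h₂
      obtain ⟨A'', i, r, h₄, h₅⟩ := wait (by simpa using h₃)
      exact ⟨A'', i, r, h₄.head h₁, h₅⟩
    · have := h.weight_cons_eq 0
      simp [Lab.weight, hv 0 (by decide)] at this
  · exact wait h

/-- Finishing the current round and running one more provides an output on `u` from any state. -/
theorem State.exists_uOut (hv : ∀ i < 4, v i = 1) (hm : m.Live)
    {A : RhoProc 0} {ls : Multiset Lab} (h : m.State v A ls) :
    ∃ A' j r, Reds A A' ∧ m.State v A' (.uOut j ::ₘ r) := by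
  obtain ⟨A₁, i, r, h₁, h⟩ := h.ready hv hm
  obtain ⟨A₂, ls', h₂, h₃, h⟩ := h.fire hm.valid hm.weight_K fires_copier
  cases h₃
  have e : ({.server, .store} : Multiset Lab) + .msgN i ::ₘ .msgP ::ₘ r =
      .server ::ₘ .msgN i ::ₘ .store ::ₘ .msgP ::ₘ r := by
    simp only [Multiset.insert_eq_cons, ← Multiset.singleton_add]; abel
  rw [e] at h
  obtain ⟨A₃, ls', h₃, h₄, h⟩ := h.fire hm.valid hm.weight_K (fires_server i)
  cases h₄
  have e : ({.wait i} : Multiset Lab) + .store ::ₘ .msgP ::ₘ r =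
      .wait i ::ₘ .msgP ::ₘ .store ::ₘ r := by
    simp only [← Multiset.singleton_add]; abel
  rw [e] at h
  obtain ⟨A₄, ls', h₄, h₅, h⟩ := h.fire hm.valid hm.weight_K (fires_wait i)
  cases h₅ with | recvP _ k =>
  rw [add_assoc, add_assoc] at h
  obtain ⟨A₅, j, r', h₅, h⟩ := hm.output _ _ _ _ h
  exact ⟨A₅, j, r', (((h₁.tail h₂).tail h₃).tail h₄).trans h₅, h⟩

/-- A state whose test context has received two names. -/
def Late (m : Machine) (A : RhoProc 0) : Prop :=
  ∃ ls, m.State 1 A ls ∧ ∀ l ∈ ls, ¬ l.Early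

theorem State.late_step (hm : m.Live) {A A' : RhoProc 0} (h : m.Late A) (hr : RhoRed A A') :
    m.Late A' := by
  obtain ⟨ls, h, hl⟩ := h
  obtain ⟨a, b, r, ls', rfl, h₁, h₂⟩ := h.step hm.valid hm.weight_K hr
  refine ⟨_, h₂, fun l hl' he => ?_⟩
  rcases Multiset.mem_add.1 hl' with hl' | hl'
  · exact hl a (Multiset.mem_cons_self _ _) (h₁.early hm.early_K hl' he)
  · exact hl l (Multiset.mem_cons_of_mem (Multiset.mem_cons_of_mem hl')) he

theorem not_early_of_weight {ls : Multiset Lab} {i : Fin 6} (hi : i = 4 ∨ i = 5)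
    (h : weight ls i = 0) : ∀ l ∈ ls, ¬ l.Early := by
  intro l hl he
  obtain ⟨r, rfl⟩ := Multiset.exists_cons_of_mem hl
  rw [weight_cons, Pi.add_apply] at h
  have : l.weight i = 0 := by omega
  rcases hi with rfl | rfl <;> cases l <;> simp [Lab.weight, Lab.Early] at this he

/-- Both early components have weight one in coordinates `4` and `5`. A component that is not early
but already accounts for the unit in one of them excludes every early component. -/
theorem State.late_of_cons {A : RhoProc 0} {l : Lab} {r : Multiset Lab} (i : Fin 6)
    (hi : i = 4 ∨ i = 5) (h : m.State 1 A (l ::ₘ r)) (hl : ¬ l.Early) (hw : l.weight i = 1) :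
    m.Late A := by
  refine ⟨_, h, fun l' hl' => ?_⟩
  rcases Multiset.mem_cons.1 hl' with rfl | hl'
  · exact hl
  · have := h.weight_cons_eq i
    rw [Pi.one_apply] at this
    exact not_early_of_weight hi (by omega) l' hl'

/-- From every state the test can be completed. -/
theorem State.exists_xOut (hm : m.Live) {A : RhoProc 0} {ls : Multiset Lab} (h : m.State 1 A ls) :
    ∃ A' r, Reds A A' ∧ m.State 1 A' (.xOut ::ₘ r) := by
  have late : ∀ {A : RhoProc 0} {i j : ℕ} {r : Multiset Lab},
      m.State 1 A (.ctxIn i ::ₘ .ctxOut j ::ₘ r) →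
      ∃ A' r, Reds A A' ∧ m.State 1 A' (.xOut ::ₘ r) := by
    intro A i j r h
    obtain ⟨A', ls', h₁, h₂, h₃⟩ := h.fire hm.valid hm.weight_K (fires_ctxIn hm i j)
    cases h₂
    exact ⟨A', r, .single h₁, by simpa using h₃⟩
  -- The component of the context is set aside while the rest produces an output on `u`, so that it
  -- cannot be consumed meanwhile. The rest still has weight one in coordinates `0` to `3`.
  have uOut : ∀ {A : RhoProc 0} {l : Lab} {r : Multiset Lab}, (∀ i < 4, l.weight i = 0) →
      m.State 1 A (l ::ₘ r) → ∃ A' j r, Reds A A' ∧ m.State 1 A' (l ::ₘ .uOut j ::ₘ r) := by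
    intro A l r hl h
    obtain ⟨P, q, hP, e, h₁⟩ := h.1.extract
    obtain ⟨C, rfl⟩ := q.exists_rep
    have hv : ∀ i < 4, weight r i = 1 := by
      intro i hi
      have := h.weight_cons_eq i
      rwa [hl i hi, zero_add, Pi.one_apply] at this
    obtain ⟨C', j, r', h₂, h₃⟩ := State.exists_uOut hv hm (A := C) ⟨h₁, rfl⟩
    have h₄ : ClsReds A.cls (P.cls + C'.cls) := by
      rw [e]
      refine ClsReds.add_left ?_ _
      exact Relation.ReflTransGen.lift RhoProc.cls (fun A B h => ⟨A, B, rfl, rfl, h⟩) _ _ h₂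
    obtain ⟨A', e', h₅⟩ := h₄.exists_reds
    refine ⟨A', j, r', h₅, ?_, ?_⟩
    · rw [e', ← Multiset.singleton_add]
      exact hP.hasLabels.add h₃.1
    · rw [weight_cons, h₃.2, ← weight_cons, h.2]
  have ctx1 : ∀ {A : RhoProc 0} {i : ℕ} {r : Multiset Lab}, m.State 1 A (.ctx1 i ::ₘ r) →
      ∃ A' r, Reds A A' ∧ m.State 1 A' (.xOut ::ₘ r) := by
    intro A i r h
    obtain ⟨A₁, j, r, h₁, h⟩ := uOut (by intro i hi; fin_cases i <;> first | rfl | simp at hi) h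
    obtain ⟨A₂, ls', h₂, h₃, h⟩ := h.fire hm.valid hm.weight_K (fires_ctx1 i j)
    cases h₃
    have e : ({.ctxOut i, .ctxIn j} : Multiset Lab) + r = .ctxIn j ::ₘ .ctxOut i ::ₘ r := by
      simp only [Multiset.insert_eq_cons, ← Multiset.singleton_add]; abel
    rw [e] at h
    obtain ⟨A₃, r, h₃, h⟩ := late h
    exact ⟨A₃, r, (h₁.tail h₂).trans h₃, h⟩
  obtain ⟨l, r, rfl, hl⟩ := h.exists_lab 4 rfl
  rcases Lab.weight_four_ne hl with rfl | ⟨i, rfl⟩ | ⟨i, rfl⟩ | rfl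
  · obtain ⟨A₁, j, r, h₁, h⟩ := uOut (by intro i hi; fin_cases i <;> first | rfl | simp at hi) h
    obtain ⟨A₂, ls', h₂, h₃, h⟩ := h.fire hm.valid hm.weight_K (fires_ctx0 j)
    cases h₃
    obtain ⟨A₃, r, h₃, h⟩ := ctx1 (by simpa using h)
    exact ⟨A₃, r, (h₁.tail h₂).trans h₃, h⟩
  · exact ctx1 h
  · obtain ⟨l, r, rfl, hl⟩ := h.exists_lab_cons (i := 5) rfl rfl
    rcases Lab.weight_five_ne hl with rfl | ⟨j, rfl⟩ | ⟨j, rfl⟩ | rfl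
    · have := h.weight_cons_eq 4
      simp [Lab.weight] at this
    · have := h.weight_cons_eq 4
      simp [Lab.weight] at this
    · exact late h
    · have := h.weight_cons_eq 4
      simp [Lab.weight] at this
  · exact ⟨A, r, .refl, h⟩

/-! ### Available threads -/

/-- The replication between two rounds. -/
def idle (m : Machine) (Y Z : RhoProc 0) : RhoCls 0 :=
  (RhoProc.copier m.c).cls + (RhoProc.lift (.name m.c) m.serve).cls +
    (RhoProc.lift (.name m.n.rinc) Y).cls + (RhoProc.lift (.name m.p.rinc) Z).cls

/-- Three communications: the copier receives the stored process and resends it, and the running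
copy then receives the two parameters. -/
theorem reds_server (c c₁ c₂ : RhoName) (X Y₁ Y₂ : RhoProc 2) (Y Z : RhoProc 0) :
    ClsReds ((RhoProc.copier c).cls + (RhoProc.lift (.name c) (.server c c₁ c₂ X Y₁ Y₂)).cls +
      (RhoProc.lift (.name c₁) Y).cls + (RhoProc.lift (.name c₂) Z).cls)
      ((RhoProc.round c c₁ c₂ (X.semSubst (params Y Z)) (Y₁.semSubst (params Y Z))
        (Y₂.semSubst (params Y Z))).cls +
        (RhoProc.lift (.name c) (.server c c₁ c₂ X Y₁ Y₂)).cls) := by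
  have h₁ := ClsReds.com (.refl c) (.par (.drop (.bound 0)) (.lift (.name c) (.drop (.bound 0))))
    (.server c c₁ c₂ X Y₁ Y₂)
  have h₂ := ClsReds.com (.refl c₁) (.inp (.name c₂) (.round c c₁ c₂ X Y₁ Y₂)) Y
  have h₃ := ClsReds.com (.refl c₂) ((RhoProc.round c c₁ c₂ X Y₁ Y₂).semSubst
    (subUnder fun _ => .name (.quote Y))) Z
  rw [RhoProc.recv_copier, RhoProc.cls_par] at h₁
  rw [RhoProc.recv, RhoProc.semSubst_semSubst, params_eq] at h₃
  simp only [RhoProc.semSubst_round] at h₃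
  have h₁ := (h₁.add_right (RhoProc.lift (.name c₁) Y).cls).add_right
    (RhoProc.lift (.name c₂) Z).cls
  refine h₁.trans ?_
  have h₂ := (h₂.add_right (RhoProc.lift (.name c₂) Z).cls).trans (by
    simpa only [RhoProc.recv, RhoProc.semSubst_inp, RhoProc.semSubst_round,
      RhoRef.sub_name] using h₃)
  have h₂ := h₂.add_right (RhoProc.lift (.name c) (.server c c₁ c₂ X Y₁ Y₂)).cls
  refine h₂.congr ?_ rfl
  simp only [RhoProc.server]
  abel

theorem reds_idle (m : Machine) (Y Z : RhoProc 0) : ∃ Y' Z', ClsReds (m.idle Y Z)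
    (m.idle Y' Z' + (m.X.semSubst (params Y Z)).cls) := by
  have h₀ : params Y Z 0 = .name (.quote Z) := rfl
  have h₁ : params Y Z 1 = .name (.quote Y) := rfl
  have := reds_server m.c m.n.rinc m.p.rinc m.X (.lift (.bound 1) (.drop (.bound 1)))
    (.lift (.bound 0) (.drop (.bound 0))) Y Z
  simp only [RhoProc.semSubst_lift, RhoRef.sub_bound, RhoProc.semSubst_drop_bound, h₀, h₁,
    RhoRef.run_quote, RhoProc.weaken_zero, RhoProc.round, RhoProc.cls_par] at this
  refine ⟨.lift (.name (.quote Y)) Y, .lift (.name (.quote Z)) Z, ?_⟩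
  refine this.congr rfl ?_
  rw [idle, serve]
  abel

/-- Induction on availability, starting from any parameters. A thread produced by a communication is
obtained by running the replication once for the input and again for the output, and then letting
the two meet; for a nested replication its own round is run once. -/
theorem exists_reds_of_avail (hm : m.Live) {T : PiProc 0} (hT : Avail m.Q T) : ∀ Y Z,
    ∃ Y' Z' X q, Translates m.b (NameRep m.φ m.F) T X ∧
      ClsReds (m.idle Y Z) (m.idle Y' Z' + (X.cls + q)) := by
  induction hT with
  | self =>
    intro Y Z
    obtain ⟨X, q, hX, e⟩ := hm.content Y Z
    obtain ⟨Y', Z', h⟩ := reds_idle m Y Z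
    exact ⟨Y', Z', X, q, hX, by rwa [e] at h⟩
  | left _ ih =>
    intro Y Z
    obtain ⟨Y', Z', X, q, hX, h⟩ := ih Y Z
    cases hX with
    | @par _ _ _ _ _ X₁ X₂ h₁ h₂ =>
      refine ⟨Y', Z', X₁, X₂.cls + q, h₁, ?_⟩
      rwa [RhoProc.cls_par, add_assoc] at h
  | right _ ih =>
    intro Y Z
    obtain ⟨Y', Z', X, q, hX, h⟩ := ih Y Z
    cases hX with
    | @par _ _ _ _ _ X₁ X₂ h₁ h₂ =>
      refine ⟨Y', Z', X₂, X₁.cls + q, h₂, ?_⟩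
      rwa [RhoProc.cls_par, add_comm X₁.cls, add_assoc] at h
  | repl _ ih =>
    intro Y Z
    obtain ⟨Y', Z', X, q, hX, h⟩ := ih Y Z
    cases hX with
    | @repl _ _ _ _ X c c₁ c₂ Y₁ Y₂ Z₁ Z₂ h₁ h₂ h₃ hX =>
      have hs := reds_server c c₁ c₂ X Y₁ Y₂ Z₁ Z₂
      have hX' := hX.semSubst (s := params Z₁ Z₂) (ρ' := NameRep m.φ m.F) (by
        rintro _ _ ⟨⟨h⟩⟩
        cases h with | mk h h' => exact .mk h h')
      obtain ⟨j, hj⟩ : ∃ j, (RhoProc.round c c₁ c₂ (X.semSubst (params Z₁ Z₂))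
          (Y₁.semSubst (params Z₁ Z₂)) (Y₂.semSubst (params Z₁ Z₂))).cls =
          (X.semSubst (params Z₁ Z₂)).cls + j := ⟨_, RhoProc.cls_par _ _⟩
      rw [hj] at hs
      refine ⟨Y', Z', _, j + (RhoProc.lift (.name c) (.server c c₁ c₂ X Y₁ Y₂)).cls + q, hX',
        h.trans (((hs.add_right q).add_left (m.idle Y' Z')).congr ?_ ?_)⟩
      · simp only [RhoProc.cls_par]
        abel
      · abel
  | com _ _ ih ih' =>
    intro Y Z
    obtain ⟨Y', Z', X, q, hX, h⟩ := ih Y Z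
    obtain ⟨Y'', Z'', X', q', hX', h'⟩ := ih' Y' Z'
    cases hX with
    | @inp _ _ _ _ _ _ X hr hX =>
    cases hX' with
    | @out _ _ _ _ _ r' R hr' hR =>
    cases hr with | mk ha hw =>
    cases hr' with | mk ha' hw' =>
    have hc := ClsReds.com (hw.trans hw'.symm) X R
    refine ⟨Y'', Z'', _, q + q', hX.recv hR, h.trans ?_⟩
    refine (h'.add_right _).trans ?_
    refine ((hc.add_right (q + q')).add_left (m.idle Y'' Z'')).congr ?_ rfl
    abel

end Machine

/-! ### Bisimilarity of machines -/

/-- A set of states with a stable part that is always reachable, such that all states offer the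
observations `W` and only the states outside the stable part offer the observations `V`. -/
structure IsTwoPhase (N : Set RhoName) (W V : Obs RhoName → Prop) (S L : RhoProc 0 → Prop) :
    Prop where
  step : ∀ A A', S A → RhoRed A A' → S A'
  late_step : ∀ A A', L A → RhoRed A A' → L A'
  exists_late : ∀ A, S A → ∃ A', Relation.ReflTransGen RhoRed A A' ∧ L A'
  late_state : ∀ A, L A → S A
  barb : ∀ A o, S A → RhoBarb N A o → o.name ∈ N ∧ (W o ∨ V o)
  late_barb : ∀ A o, L A → RhoBarb N A o → W o
  weak : ∀ A o, S A → o.name ∈ N → W o → RhoWeakBarb N A o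
  early_weak : ∀ A o, S A → ¬ L A → o.name ∈ N → V o → RhoWeakBarb N A o

/-- A step within one phase is answered by no step. A step from the early into the late phase is
answered by driving the other system into its late phase. -/
theorem IsTwoPhase.red {N : Set RhoName} {W V : Obs RhoName → Prop}
    {S₁ L₁ S₂ L₂ : RhoProc 0 → Prop} (h₁ : IsTwoPhase N W V S₁ L₁) (h₂ : IsTwoPhase N W V S₂ L₂)
    {A B A' : RhoProc 0} (hA : S₁ A) (hB : S₂ B) (hAB : L₁ A ↔ L₂ B) (h : RhoRed A A') :
    ∃ B', Relation.ReflTransGen RhoRed B B' ∧ S₁ A' ∧ S₂ B' ∧ (L₁ A' ↔ L₂ B') := by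
  by_cases hL : L₁ A
  · have := h₁.late_step _ _ hL h
    exact ⟨B, .refl, h₁.step _ _ hA h, hB, iff_of_true this (hAB.1 hL)⟩
  · by_cases hL' : L₁ A'
    · obtain ⟨B', hr, hB'⟩ := h₂.exists_late _ hB
      exact ⟨B', hr, h₁.step _ _ hA h, h₂.late_state _ hB', iff_of_true hL' hB'⟩
    · exact ⟨B, .refl, h₁.step _ _ hA h, hB, iff_of_false hL' (mt hAB.2 hL)⟩

/-- Agreement on the phase matters only for the observations `V`: if they are made early, the
partner is early as well and can make them too. -/
theorem IsTwoPhase.obs {N : Set RhoName} {W V : Obs RhoName → Prop}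
    {S₁ L₁ S₂ L₂ : RhoProc 0 → Prop} (h₁ : IsTwoPhase N W V S₁ L₁) (h₂ : IsTwoPhase N W V S₂ L₂)
    {A B : RhoProc 0} (hA : S₁ A) (hB : S₂ B) (hAB : L₁ A ↔ L₂ B) {o : Obs RhoName}
    (h : RhoBarb N A o) : RhoWeakBarb N B o := by
  obtain ⟨hn, hw | hv⟩ := h₁.barb _ _ hA h
  · exact h₂.weak _ _ hB hn hw
  · by_cases hL : L₁ A
    · exact h₂.weak _ _ hB hn (h₁.late_barb _ _ hL h)
    · exact h₂.early_weak _ _ hB (mt hAB.2 hL) hn hv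

theorem IsTwoPhase.bisim {N : Set RhoName} {W V : Obs RhoName → Prop}
    {S₁ L₁ S₂ L₂ : RhoProc 0 → Prop} (h₁ : IsTwoPhase N W V S₁ L₁) (h₂ : IsTwoPhase N W V S₂ L₂)
    {A B : RhoProc 0} (hA : S₁ A) (hB : S₂ B) (hAB : L₁ A ↔ L₂ B) : RhoWeakBisim N A B := by
  refine ⟨fun A B => (S₁ A ∧ S₂ B ∧ (L₁ A ↔ L₂ B)) ∨ (S₁ B ∧ S₂ A ∧ (L₁ B ↔ L₂ A)),
    ⟨fun A B h => h.symm, ?_, ?_⟩, .inl ⟨hA, hB, hAB⟩⟩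
  · rintro A B (⟨hA, hB, hAB⟩ | ⟨hA, hB, hAB⟩) A' hr
    · obtain ⟨B', hr, h⟩ := h₁.red h₂ hA hB hAB hr
      exact ⟨B', hr, .inl h⟩
    · obtain ⟨B', hr, h, h', h''⟩ := h₂.red h₁ hB hA hAB.symm hr
      exact ⟨B', hr, .inr ⟨h', h, h''.symm⟩⟩
  · rintro A B (⟨hA, hB, hAB⟩ | ⟨hA, hB, hAB⟩) o ho
    · exact h₁.obs h₂ hA hB hAB ho
    · exact h₂.obs h₁ hB hA hAB.symm ho

/-- The observations offered by all states. -/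
inductive Offers (φ : ℕ → RhoName) (u x : ℕ) (F : Finset ℕ) (Q : PiProc 0) : Obs RhoName → Prop
  | u {y : RhoName} : RhoNameEq y (φ u) → Offers φ u x F Q (.out y)
  | x {y : RhoName} : RhoNameEq y (φ x) → Offers φ u x F Q (.out y)
  | out {a : ℕ} {z : PiName 0} {y : RhoName} : a ∈ F → Avail Q (.out (.free a) z) →
      RhoNameEq y (φ a) → Offers φ u x F Q (.out y)
  | inp {a : ℕ} {P : PiProc 1} {y : RhoName} : a ∈ F → Avail Q (.inp (.free a) P) →
      RhoNameEq y (φ a) → Offers φ u x F Q (.inp y)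

namespace Machine

variable {m : Machine} {N : Set RhoName}

/-- Only free names are observable, so by uniqueness of kinds the internal channels never
contribute. The input on `u` can come only from the context before it has received two names. -/
theorem State.barb (hm : m.Valid) (hN : ∀ x y, RhoNameEq x y → x ∈ N → y ∈ N)
    (hN' : ∀ w ∈ N, ∃ a, m.IsFree a ∧ RhoNameEq w (m.φ a)) {v : Fin 6 → ℕ} {A : RhoProc 0}
    {ls : Multiset Lab} (h : m.State v A ls) {o : Obs RhoName} (ho : RhoBarb N A o) :
    o.name ∈ N ∧ (Offers m.φ m.u m.x m.F m.Q o ∨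
      (∃ y, o = .inp y ∧ RhoNameEq y (m.φ m.u)) ∧ ∃ l ∈ ls, l.Early) := by
  obtain ⟨hn, l, hl, P, hP, hb⟩ := h.1.barb hN ho
  refine ⟨hn, ?_⟩
  obtain ⟨a, ha, hna⟩ := hN' _ hn
  have hc : m.Chan (.pi a) o.name := ⟨ha, hna⟩
  cases hb with
  | @out x y R hxy =>
    obtain ⟨κ, hκ, hc'⟩ := hP.lift_chan
    obtain rfl := hc'.unique hm hc hxy
    cases hP with
    | uOut => exact .inl (.u hxy.symm)
    | xOut => exact .inl (.x hxy.symm)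
    | q h =>
      cases h with
      | out hT hr _ =>
        cases hr with | mk ha hw => exact .inl (.out ha hT (hxy.symm.trans hw))
      | store _ _ h => cases hc.unique hm (κ' := .copyQ) h hxy.symm
      | data _ h => cases hc.unique hm (κ' := .dataQ) h hxy.symm
    | _ => cases hκ
  | @inp x y R hxy =>
    obtain ⟨κ, hκ, hc'⟩ := hP.inp_chan
    obtain rfl := hc'.unique hm hc hxy
    cases hP with
    | ctx0 => exact .inr ⟨⟨_, rfl, hxy.symm⟩, _, hl, trivial⟩
    | ctx1 => exact .inr ⟨⟨_, rfl, hxy.symm⟩, _, hl, trivial⟩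
    | q h =>
      cases h with
      | inp hT hr _ =>
        cases hr with | mk ha hw => exact .inl (.inp ha hT (hxy.symm.trans hw))
      | copier h => cases hc.unique hm (κ' := .copyQ) h hxy.symm
      | server _ _ _ h => cases hc.unique hm (κ' := .dataQ) h hxy.symm
      | round _ _ _ _ h => cases hc.unique hm (κ' := .dataQ) h hxy.symm
    | _ => cases hκ

theorem State.barb_of_cons (hN : ∀ x y, RhoNameEq x y → x ∈ N → y ∈ N) {v : Fin 6 → ℕ}
    {A : RhoProc 0} {l : Lab} {ls : Multiset Lab} (h : m.State v A (l ::ₘ ls)) {o : Obs RhoName}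
    (ho : o.name ∈ N) (hl : ∀ P, m.IsLab l P → PrefixBarb P o) : RhoBarb N A o := by
  obtain ⟨P, r, hP, e, _⟩ := h.1.extract
  exact .of_cls hN ho (hl P hP) e

theorem State.weak (hm : m.Live) (hN : ∀ x y, RhoNameEq x y → x ∈ N → y ∈ N)
    {A : RhoProc 0} {ls : Multiset Lab} (h : m.State 1 A ls) {o : Obs RhoName} (ho : o.name ∈ N)
    (hw : Offers m.φ m.u m.x m.F m.Q o) : RhoWeakBarb N A o := by
  -- The replication is first brought into its idle position; from there the thread `T` can be
  -- produced, and the rest of the state stays aside.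
  have key : ∀ T : PiProc 0, Avail m.Q T →
      (∀ X, Translates m.b (NameRep m.φ m.F) T X → PrefixBarb X o) → RhoWeakBarb N A o := by
    intro T hT hX
    obtain ⟨A', i, r, h₁, h₂⟩ := h.ready (fun _ _ => rfl) hm
    obtain ⟨P₁, r₁, hP₁, e₁, h₃⟩ := h₂.1.extract
    obtain ⟨P₂, r₂, hP₂, e₂, h₄⟩ := h₃.extract
    obtain ⟨P₃, r₃, hP₃, e₃, h₅⟩ := h₄.extract
    obtain ⟨P₄, r₄, hP₄, e₄, -⟩ := h₅.extract
    cases hP₁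
    cases hP₂
    cases hP₃ with | @msgN _ Y _ =>
    cases hP₄ with | @msgP _ Z _ =>
    obtain ⟨Y', Z', X, q, hX', hr⟩ := exists_reds_of_avail hm hT Y Z
    have hr := (hr.add_right r₄).congr (q' := A'.cls) (by rw [e₁, e₂, e₃, e₄, idle]; abel) rfl
    obtain ⟨A'', e, hr⟩ := hr.exists_reds
    refine ⟨A'', h₁.trans hr, .of_cls hN ho (hX _ hX') (r := m.idle Y' Z' + q + r₄) ?_⟩
    rw [e]; abel
  cases hw with
  | u hy =>
    obtain ⟨A', j, r, h₁, h₂⟩ := h.exists_uOut (fun _ _ => rfl) hm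
    refine ⟨A', h₁, h₂.barb_of_cons hN ho ?_⟩
    rintro _ ⟨⟩; exact .out _ hy.symm
  | x hy =>
    obtain ⟨A', r, h₁, h₂⟩ := h.exists_xOut hm
    refine ⟨A', h₁, h₂.barb_of_cons hN ho ?_⟩
    rintro _ ⟨⟩; exact .out _ hy.symm
  | out _ hT hy =>
    refine key _ hT fun X hX => ?_
    cases hX with | out hr _ =>
    cases hr with | mk _ hw => exact .out _ (hw.trans hy.symm)
  | inp _ hT hy =>
    refine key _ hT fun X hX => ?_
    cases hX with | inp hr _ =>
    cases hr with | mk _ hw => exact .inp _ (hw.trans hy.symm)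

theorem State.early_barb (hN : ∀ x y, RhoNameEq x y → x ∈ N → y ∈ N) {v : Fin 6 → ℕ}
    {A : RhoProc 0} {ls : Multiset Lab} (h : m.State v A ls) (hl : ∃ l ∈ ls, l.Early) {y : RhoName}
    (hy : RhoNameEq y (m.φ m.u)) (hn : y ∈ N) : RhoBarb N A (.inp y) := by
  obtain ⟨l, hl, he⟩ := hl
  obtain ⟨ls, rfl⟩ := Multiset.exists_cons_of_mem hl
  refine h.barb_of_cons hN (o := .inp y) hn ?_
  rintro _ (_ | _ | _ | _ | _ | _ | _ | _ | _ | _ | _) <;>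
    first
    | exact he.elim
    | exact .inp _ hy.symm

/-- The states of a machine together with initial states. -/
def IsState (m : Machine) (I : RhoProc 0 → Prop) (A : RhoProc 0) : Prop :=
  I A ∨ ∃ ls, m.State 1 A ls

/-- The predicate `I` admits starting states in which a restriction outside the replication has not
yet communicated; they show nothing but the input of the context on `u`. -/
theorem isTwoPhase (hm : m.Live) (hN : ∀ x y, RhoNameEq x y → x ∈ N → y ∈ N)
    (hN' : ∀ w ∈ N, ∃ a, m.IsFree a ∧ RhoNameEq w (m.φ a)) {I : RhoProc 0 → Prop}
    (hq : ∀ A A', I A → RhoRed A A' → ∃ ls, m.State 1 A' ls)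
    (hq' : ∀ A, I A → ∃ A' ls, Reds A A' ∧ m.State 1 A' (.ctx0 ::ₘ ls))
    (hq'' : ∀ A o, I A → RhoBarb N A o → o.name ∈ N ∧
      ∃ y, o = .inp y ∧ RhoNameEq y (m.φ m.u)) :
    IsTwoPhase N (Offers m.φ m.u m.x m.F m.Q) (fun o => ∃ y, o = .inp y ∧ RhoNameEq y (m.φ m.u))
      (m.IsState I) m.Late where
  step := by
    rintro A A' (hA | ⟨ls, hA⟩) hr
    · exact .inr (hq A A' hA hr)
    · obtain ⟨_, _, _, _, _, _, h⟩ := hA.step hm.valid hm.weight_K hr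
      exact .inr ⟨_, h⟩
  late_step _ _ hA hr := State.late_step hm hA hr
  exists_late := by
    have key : ∀ A ls, m.State 1 A ls → ∃ A', Reds A A' ∧ m.Late A' := by
      intro A ls hA
      obtain ⟨A', r, h₁, h₂⟩ := hA.exists_xOut hm
      exact ⟨A', h₁, h₂.late_of_cons 4 (.inl rfl) (by simp [Lab.Early]) rfl⟩
    rintro A (hA | ⟨ls, hA⟩)
    · obtain ⟨A', ls, hr, hA'⟩ := hq' A hA
      obtain ⟨A'', hr', h⟩ := key _ _ hA'
      exact ⟨A'', hr.trans hr', h⟩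
    · exact key _ _ hA
  late_state := by
    rintro A ⟨ls, h, _⟩
    exact .inr ⟨ls, h⟩
  barb := by
    rintro A o (hA | ⟨ls, hA⟩) ho
    · obtain ⟨h, h'⟩ := hq'' A o hA ho
      exact ⟨h, .inr h'⟩
    · obtain ⟨h, h' | ⟨h', _⟩⟩ := hA.barb hm.valid hN hN' ho
      exacts [⟨h, .inl h'⟩, ⟨h, .inr h'⟩]
  late_barb := by
    rintro A o ⟨ls, hA, hl⟩ ho
    obtain ⟨_, h' | ⟨_, l, hl', he⟩⟩ := hA.barb hm.valid hN hN' ho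
    exacts [h', (hl l hl' he).elim]
  weak := by
    rintro A o (hA | ⟨ls, hA⟩) ho hw
    · obtain ⟨A', ls, hr, hA'⟩ := hq' A hA
      obtain ⟨A'', hr', h⟩ := hA'.weak hm hN ho hw
      exact ⟨A'', hr.trans hr', h⟩
    · exact hA.weak hm hN ho hw
  early_weak := by
    rintro A o (hA | ⟨ls, hA⟩) hl hn ⟨y, rfl, hy⟩
    · obtain ⟨A', ls, hr, hA'⟩ := hq' A hA
      exact ⟨A', hr, hA'.early_barb hN ⟨.ctx0, Multiset.mem_cons_self _ _, trivial⟩ hy hn⟩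
    · refine ⟨A, .refl, hA.early_barb hN ?_ hy hn⟩
      by_contra! h
      exact hl ⟨ls, hA, h⟩

theorem Late.not_barb (hm : m.Valid) (hN : ∀ x y, RhoNameEq x y → x ∈ N → y ∈ N)
    (hN' : ∀ w ∈ N, ∃ a, m.IsFree a ∧ RhoNameEq w (m.φ a)) {A : RhoProc 0} (h : m.Late A)
    {y : RhoName} (hy : RhoNameEq y (m.φ m.u)) : ¬ RhoBarb N A (.inp y) := by
  obtain ⟨ls, hA, hl⟩ := h
  intro ho
  obtain ⟨_, h' | ⟨_, l, hl', he⟩⟩ := hA.barb hm hN hN' ho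
  · cases h' with
    | inp ha _ hy' => exact hm.uF (hm.inj _ _ (hy.symm.trans hy') ▸ ha)
  · exact hl l hl' he

end Machine

/-! ## The encoded counterexamples as machines -/

theorem code_parList {k : ℕ} : ∀ L : List (RhoProc k),
    (RhoProc.parList L).code = (L.map RhoProc.code).sum
  | [] => rfl
  | P :: L => by rw [RhoProc.parList, RhoProc.code, code_parList L, List.map_cons, List.sum_cons]

theorem code_initN (φ : ℕ → RhoName) (S : Finset ℕ) :
    (initN φ S).code = ∑ a ∈ S, Code.node false (φ a).code 0 := by
  rw [initN, RhoName.code, code_parList, List.map_map, Finset.sum, ← Multiset.sum_coe,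
    ← Multiset.map_coe, Finset.coe_toList]
  rfl

theorem code_initP (φ : ℕ → RhoName) (S : Finset ℕ) :
    (initP φ S).code = ∑ a ∈ S, Code.node true (φ a).code 0 := by
  rw [initP, RhoName.code, code_parList, List.map_map, Finset.sum, ← Multiset.sum_coe,
    ← Multiset.map_coe, Finset.coe_toList]
  rfl

theorem size_init (φ : ℕ → RhoName) (S : Finset ℕ) :
    (initN φ S).code.2 = (initP φ S).code.2 := by
  rw [code_initN, code_initP, Prod.snd_sum, Prod.snd_sum]; rfl

/-- The initial parameters contain a prefix on every free name and are therefore larger than each of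
them. -/
theorem size_lt_init (φ : ℕ → RhoName) {S : Finset ℕ} {a : ℕ} (ha : a ∈ S) :
    (φ a).code.2 < (initN φ S).code.2 := by
  rw [code_initN, Prod.snd_sum]
  refine lt_of_lt_of_le ?_ (Finset.single_le_sum (f := fun a => (Code.node false (φ a).code 0).2)
    (fun _ _ => Nat.zero_le _) ha)
  simp only [Code.node, Prod.snd_zero]
  omega

/-- One parameter quotes outputs and the other inputs, which the flag of the code records;
nonemptiness is needed, as both are `⌜0⌝` otherwise. -/
theorem init_ne (φ : ℕ → RhoName) {S : Finset ℕ} (hS : S.Nonempty) :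
    (initN φ S).code.1 ≠ (initP φ S).code.1 := by
  obtain ⟨a, ha⟩ := hS
  rw [code_initN, code_initP, Prod.fst_sum, Prod.fst_sum]
  intro h
  have : Encodable.encode (false, (φ a).code.1, (0 : Multiset ℕ)) ∈
      ∑ a ∈ S, (Code.node false (φ a).code 0).1 := by
    rw [Multiset.mem_sum]
    exact ⟨a, ha, Multiset.mem_singleton_self _⟩
  rw [h, Multiset.mem_sum] at this
  obtain ⟨b, _, hb⟩ := this
  simp [Code.node] at hb

theorem linc_ne {n p : RhoName} (h : n.code.1 ≠ p.code.1) : n.linc.code.1 ≠ p.linc.code.1 :=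
  fun h' => h (Code.node_injective h').2.1

theorem bindParams_left {k : ℕ} {n p : RhoName} (h : n.code.1 ≠ p.code.1) :
    bindParams (k := k) n p (.name n) = .bound 1 := by
  have h : n.code ≠ p.code := fun h' => h (congrArg _ h')
  simp [bindParams, RhoRef.bindName_name h, RhoRef.bindName_self]

theorem bindParams_right {k : ℕ} (n p : RhoName) :
    bindParams (k := k) n p (.name p) = .bound 0 := by
  simp [bindParams, RhoRef.bindName_self]

theorem bindParams_size {k : ℕ} {n p w : RhoName} (hn : w.code.2 ≠ n.code.2)
    (hp : w.code.2 ≠ p.code.2) : bindParams (k := k) n p (.name w) = .name w :=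
  bindParams_name (fun h => hn (congrArg _ h)) fun h => hp (congrArg _ h)

theorem RhoProc.semSubst_closed (P : RhoProc 0) (s : Fin 0 → RhoRef 0) : P.semSubst s = P := by
  simpa using P.semSubst_weaken s

theorem PiName.under_id {k : ℕ} : PiName.under (id : PiName k → PiName k) = id := by
  funext y
  rcases y with a | i
  · rfl
  · exact Fin.cases rfl (fun _ => rfl) i

theorem PiProc.map_id : ∀ {k : ℕ} (P : PiProc k), P.map id = P
  | _, .nil => rfl
  | _, .par P Q => by rw [map, P.map_id, Q.map_id]
  | _, .inp x P => by rw [map, PiName.under_id, P.map_id]; rfl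
  | _, .out x z => rfl
  | _, .res P => by rw [map, PiName.under_id, P.map_id]
  | _, .repl P => by rw [map, P.map_id]

/-- The body of a translated replication, its parameters bound. -/
noncomputable def replBody (φ : ℕ → RhoName) {k : ℕ} (P : PiProc k) (n p : RhoName)
    (s : Fin k → RhoRef 0) : RhoProc 2 :=
  ((P.trans φ n p).map (bindParams n p)).semSubst (subUnder (subUnder s))

/-- The values of the bound names in the body of a round. -/
def roundNames {k : ℕ} (s : Fin k → RhoRef 0) (Y Z : RhoProc 0) : Fin (k + 2) → RhoRef 0 :=
  Fin.cases (.name (.quote Z)) (Fin.cases (.name (.quote Y)) s)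

theorem replBody_params (φ : ℕ → RhoName) {k : ℕ} (P : PiProc k) (n p : RhoName)
    (s : Fin k → RhoRef 0) (Y Z : RhoProc 0) : (replBody φ P n p s).semSubst (Machine.params Y Z) =
      ((P.trans φ n p).map (bindParams n p)).semSubst (roundNames s Y Z) := by
  rw [replBody, RhoProc.semSubst_semSubst]
  congr 1
  funext i
  refine Fin.cases rfl (fun i => Fin.cases rfl (fun i => ?_) i) i
  simp only [Function.comp_apply, subUnder_succ, roundNames, Fin.cases_succ]
  cases s i with
  | bound i => exact i.elim0
  | name x => rfl

/-- The parameters `n'`, `p'` of the body are increments, strictly larger than the bound `n`, `p`.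
The representation of the names of `Q` is thus the same whatever is received for the parameters. -/
theorem Translates.trans_params {φ : ℕ → RhoName} {Q : PiProc 0} (hQ : Q.NuFree) {k : ℕ}
    {f : PiName 0 → PiName k} (hf : ∀ a, f (.free a) = .free a) {b : ℕ} {n p n' p' : RhoName}
    (hb : n.code.2 = b) (hp : p.code.2 = b) (hn' : n'.code.2 = 1 + b) (hp' : p'.code.2 = 1 + b)
    (hφ : ∀ a ∈ Q.fn, (φ a).code.2 < b) (t : Fin (k + 2) → RhoRef 0) :
    Translates b (NameRep φ Q.fn) Q
      ((((Q.map f).trans φ n' p').map (bindParams n p)).semSubst t) := by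
  have hw : ∀ w : RhoName, w.code.2 ≠ b → bindParams (k := k) n p (.name w) = .name w :=
    fun w hw => bindParams_size (by rw [hb]; exact hw) (by rw [hp]; exact hw)
  refine (PiProc.translates_trans φ Q.fn b (fun a ha => (hφ a ha).le) Q hQ subset_rfl f n' p'
    (bindParams n p) ?_ (by rw [hn', hp']) (by omega) (fun w h => hw w (by omega))
    fun a ha => hw _ (hφ a ha).ne).semSubst ?_
  · rintro (a | i) h
    · rwa [hf]
    · exact i.elim0
  · rintro (a | i) r ⟨ha, rfl⟩
    · have ha : a ∈ Q.fn := by simpa [PiName.fn] using ha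
      rw [hf, PiName.toRef, hw _ (hφ a ha).ne]
      exact .mk ha (.refl _)
    · exact i.elim0

namespace Machine

variable {m : Machine}

/-- The initial components of a translated replication. -/
theorem trans_repl {k : ℕ} {P : PiProc k} {s : Fin k → RhoRef 0}
    (hX : m.X = replBody m.φ P m.n m.p s) (hsize : m.n.code.2 = m.p.code.2)
    (hne : m.n.code.1 ≠ m.p.code.1) :
    ((PiProc.repl P).trans m.φ m.n m.p).semSubst s =
      .par (.lift (.name m.c) m.serve) (.par (.copier m.c)
        (.par (.lift (.name m.n.rinc) (.drop (.name m.n.linc)))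
          (.lift (.name m.p.rinc) (.drop (.name m.p.linc))))) := by
  have h := PiProc.trans_repl m.φ P m.n m.p hsize id fun _ _ => rfl
  rw [RhoProc.map_id] at h
  have e : subUnder (subUnder s) 1 = .bound 1 := rfl
  rw [h]
  simp [serve, hX, e, replBody, c, RhoProc.output, RhoProc.map, RhoRef.under_id, bindParams_left hne,
    bindParams_right]

/-- The test context. -/
def ctx (m : Machine) : RhoProc 0 :=
  .inp (.name (m.φ m.u)) (.inp (.name (m.φ m.u))
    (.par (.lift (.bound 1) (.drop (.name (m.φ m.o)))) (m.test (.bound 0))))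

theorem exists_state {k : ℕ} {P : PiProc k} {s : Fin k → RhoRef 0}
    (hX : m.X = replBody m.φ P m.n m.p s) (hsize : m.n.code.2 = m.p.code.2)
    (hne : m.n.code.1 ≠ m.p.code.1) {A : RhoProc 0}
    (hA : A.cls = (((PiProc.repl P).trans m.φ m.n m.p).semSubst s).cls + m.ctx.cls) :
    m.State 1 A {.ctx0, .store, .copier, .msgN 0, .msgP} := by
  constructor
  · rw [hA, trans_repl hX hsize hne, add_comm]
    exact (IsLab.ctx0.hasLabels).add (IsLab.store.hasLabels.add (IsLab.copier.hasLabels.add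
      ((IsLab.msgN (i := 0) (Y := .drop (.name m.n.linc)) rfl).hasLabels.add
        (IsLab.msgP (j := 0) (Y := .drop (.name m.p.linc)) rfl).hasLabels)))
  · simp only [Multiset.insert_eq_cons, weight_cons, weight_singleton, Lab.weight]
    ext i; fin_cases i <;> rfl

end Machine

theorem encode_testContext (φ : ℕ → RhoName) (u x o : ℕ) (P : PiProc 0) :
    ((testContext u x o P).encode φ).cls = (P.trans φ (initN φ (testContext u x o P).fn).linc
      (initP φ (testContext u x o P).fn).linc).cls +
      (RhoProc.inp (.name (φ u)) (.inp (.name (φ u)) (.par (.lift (.bound 1) (.drop (.name (φ o))))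
        (.inp (.bound 0) (.lift (.name (φ x)) (.drop (.name (φ o)))))))).cls := rfl

theorem mem_fn_testContext (u x o : ℕ) (P : PiProc 0) (a : ℕ) :
    a ∈ (testContext u x o P).fn ↔ a = u ∨ a = x ∨ a = o ∨ a ∈ P.fn := by
  simp only [testContext, PiProc.fn, PiName.fn, Finset.mem_union, Finset.mem_singleton,
    Finset.notMem_empty]
  tauto

theorem PiName.fn_under {k m : ℕ} {f : PiName k → PiName m} (hf : ∀ y, (f y).fn = y.fn)
    (y : PiName (k + 1)) : (PiName.under f y).fn = y.fn := by
  have hs : ∀ {i : ℕ} (y : PiName i), y.shift.fn = y.fn := by intro i y; cases y <;> rfl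
  rcases y with a | i
  · exact (hs _).trans (hf _)
  · exact Fin.cases rfl (fun i => (hs _).trans (hf _)) i

theorem PiProc.fn_map : ∀ {k m : ℕ} (P : PiProc k) {f : PiName k → PiName m},
    (∀ y, (f y).fn = y.fn) → (P.map f).fn = P.fn
  | _, _, .nil, _, _ => rfl
  | _, _, .par P Q, _, h => by simp only [map, fn, P.fn_map h, Q.fn_map h]
  | _, _, .inp x P, _, h => by simp only [map, fn, h, P.fn_map (PiName.fn_under h)]
  | _, _, .out x z, _, h => by simp only [map, fn, h]
  | _, _, .res P, _, h => by simp only [map, fn, P.fn_map (PiName.fn_under h)]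
  | _, _, .repl P, _, h => by simp only [map, fn, P.fn_map h]

theorem PiProc.fn_weaken {k : ℕ} (P : PiProc k) : P.weaken.fn = P.fn :=
  P.fn_map fun y => by cases y <;> rfl

-- Machines for the first counterexample

/-- The parameters of a replication are fresh for the names of the process, and distinct. -/
structure Fresh (φ : ℕ → RhoName) (S : Finset ℕ) (n p : RhoName) : Prop where
  size : n.code.2 = p.code.2
  ne : n.code.1 ≠ p.code.1
  lt : ∀ a ∈ S, (φ a).code.2 < n.code.2

theorem fresh_init (φ : ℕ → RhoName) {S : Finset ℕ} (hS : S.Nonempty) :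
    Fresh φ S (initN φ S) (initP φ S) :=
  ⟨size_init φ S, init_ne φ hS, fun _ ha => size_lt_init φ ha⟩

theorem Fresh.linc {φ : ℕ → RhoName} {S : Finset ℕ} {n p : RhoName} (h : Fresh φ S n p) :
    Fresh φ S n.linc p.linc where
  size := by rw [size_linc, size_linc, h.size]
  ne := linc_ne h.ne
  lt a ha := (h.lt a ha).trans (by rw [size_linc]; omega)

/-- The machine of `!((νz ū⟨z⟩) | Q)`. -/
noncomputable def newParMachine (φ : ℕ → RhoName) (u x o : ℕ) (Q : PiProc 0) (n p : RhoName) :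
    Machine where
  φ := φ
  u := u
  x := x
  o := o
  F := Q.fn
  Q := Q
  n := n
  p := p
  X := replBody φ (.par (.res (.out (.free u) (.bound 0))) Q) n p Fin.elim0
  val _ := n.linc.code
  IsVal _ w := RhoNameEq w n.linc
  nu := {w | RhoNameEq w p.linc}
  K _ := {.nuIn, .nuOut 0}

/-- The machine of `!(ū⟨z⟩ | Q)`, the name `v` in place of `z`. -/
noncomputable def outParMachine (φ : ℕ → RhoName) (u x o : ℕ) (Q : PiProc 0) (v n p : RhoName) :
    Machine where
  φ := φ
  u := u
  x := x
  o := o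
  F := Q.fn
  Q := Q
  n := n
  p := p
  X := replBody φ (.par (.out (.free u) (.bound 0)) Q.weaken) n p
    fun _ => .name (.quote (.drop (.name v)))
  val _ := v.code
  IsVal _ w := RhoNameEq w v
  nu := ∅
  K _ := {.uOut 0}

section

variable {φ : ℕ → RhoName} {u x o : ℕ} {Q : PiProc 0} {S : Finset ℕ} {v n p : RhoName}

theorem newParMachine_content (hQ : Q.NuFree) (h : Fresh φ S n p) (hS : ∀ a ∈ Q.fn, a ∈ S)
    (hu : u ∈ S) (Y Z : RhoProc 0) :
    ∃ X, Translates n.code.2 (NameRep φ Q.fn) Q X ∧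
      ((newParMachine φ u x o Q n p).X.semSubst (Machine.params Y Z)).cls = X.cls +
        ((RhoProc.inp (.name p.linc) (.lift (.name (φ u)) (.drop (.bound 0)))).cls +
          (RhoProc.lift (.name p.linc) (.drop (.name n.linc))).cls) := by
  -- The restriction stands beside `Q` and is translated with `n.linc`, `p.linc`. These names are
  -- larger than `n` and `p`, hence not bound: all rounds use the same channel and send the same
  -- name.
  have hp := bindParams_size (k := 0) (n := n) (p := p) (w := p.linc)
    (by rw [size_linc]; have := h.size; omega) (by rw [size_linc]; omega)
  have hn := bindParams_size (k := 0) (n := n) (p := p) (w := n.linc)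
    (by rw [size_linc]; omega) (by rw [size_linc]; have := h.size; omega)
  have hu := bindParams_size (k := 0) (n := n) (p := p) (w := φ u)
    (h.lt u hu).ne (by rw [← h.size]; exact (h.lt u hu).ne)
  have hX := Translates.trans_params (φ := φ) hQ (f := id) (fun _ => rfl) (n := n) (p := p)
    (n' := n.rinc) (p' := p.rinc) rfl h.size.symm (by rw [size_rinc])
    (by rw [size_rinc, h.size]) (fun a ha => h.lt a (hS a ha)) (roundNames Fin.elim0 Y Z)
  rw [PiProc.map_id] at hX
  refine ⟨_, hX, ?_⟩
  rw [newParMachine, replBody_params]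
  simp [PiProc.trans, RhoProc.map, RhoProc.output, hp, hn, hu, PiName.toRef, RhoProc.cls_par,
    add_comm]

theorem outParMachine_content (hQ : Q.NuFree) (h : Fresh φ S n p) (hS : ∀ a ∈ Q.fn, a ∈ S)
    (hu : u ∈ S) (Y Z : RhoProc 0) :
    ∃ X, Translates n.code.2 (NameRep φ Q.fn) Q X ∧
      ((outParMachine φ u x o Q v n p).X.semSubst (Machine.params Y Z)).cls =
        X.cls + (RhoProc.lift (.name (φ u)) (.drop (.name v))).cls := by
  have hu := bindParams_size (k := 1) (n := n) (p := p) (w := φ u)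
    (h.lt u hu).ne (by rw [← h.size]; exact (h.lt u hu).ne)
  have hX := Translates.trans_params (φ := φ) hQ (f := PiName.shift) (fun _ => rfl) (n := n)
    (p := p) (n' := n.rinc) (p' := p.rinc) rfl h.size.symm (by rw [size_rinc])
    (by rw [size_rinc, h.size]) (fun a ha => h.lt a (hS a ha))
    (roundNames (fun _ => .name (.quote (.drop (.name v)))) Y Z)
  refine ⟨_, hX, ?_⟩
  have e : roundNames (k := 1) (fun _ => .name (.quote (.drop (.name v)))) Y Z 2 =
    .name (.quote (.drop (.name v))) := rfl
  have hb : bindParams (k := 1) n p (.bound 0) = .bound 2 := rfl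
  rw [outParMachine, replBody_params]
  simp [PiProc.trans, RhoProc.map, RhoProc.output, hu, PiName.toRef, RhoProc.cls_par, hb,
    add_comm, PiProc.weaken, e]

theorem newParMachine_valid (hφ : ∀ a b : ℕ, RhoNameEq (φ a) (φ b) → a = b) (hux : u ≠ x)
    (hQ : Q.NuFree) (huQ : u ∉ Q.fn) (hxQ : x ∉ Q.fn) (h : Fresh φ S n p)
    (hS : ∀ a, a = u ∨ a = x ∨ a = o ∨ a ∈ Q.fn → a ∈ S) :
    (newParMachine φ u x o Q n p).Valid where
  inj := hφ
  ux := hux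
  uF := huQ
  xF := hxQ
  size := h.size
  ne := h.ne
  exists_bound := by
    refine ⟨n.code.2, le_rfl, fun a ha => h.lt a (hS a ha), fun i => ?_, fun w hw => ?_⟩
    · exact (size_linc n).symm ▸ Nat.le_add_left _ _
    · rw [(show RhoNameEq w p.linc from hw).code_eq, size_linc, h.size]
      exact Nat.le_add_left _ _
  val := fun _ => ⟨_, _, rfl⟩
  isVal := fun _ _ hw => RhoNameEq.code_eq hw
  nu := fun w hw => ⟨_, _, (show RhoNameEq w p.linc from hw).code_eq⟩
  val_nu := fun i w hw e => linc_ne h.ne (congrArg Prod.fst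
    (e.symm.trans (show RhoNameEq w p.linc from hw).code_eq))
  content := by
    intro i j Y Z _ _
    obtain ⟨X, hX, e⟩ := newParMachine_content (x := x) (o := o) hQ h
      (fun a ha => hS a (.inr (.inr (.inr ha)))) (hS u (.inl rfl)) Y Z
    obtain ⟨L, hL, e'⟩ := hX.exists_parts .self
    obtain ⟨k, hk⟩ := Machine.HasLabels.of_parts (m := newParMachine φ u x o Q n p) hL
    refine ⟨k, ?_⟩
    rw [e, e', add_comm]
    refine Machine.HasLabels.add (.add (Machine.IsLab.hasLabels (.nuIn ?_))
      (Machine.IsLab.hasLabels (.nuOut ?_ ?_))) hk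
    exacts [RhoNameEq.refl _, RhoNameEq.refl _, RhoNameEq.drop (.refl _)]

theorem newParMachine_fires (i : ℕ) : (newParMachine φ u x o Q n p).Fires .nuIn (.nuOut i) := by
  intro X Y hX hY
  cases hX with | nuIn hw =>
  cases hY with | nuOut hw' _ =>
  exact ⟨_, _, _, _, rfl, rfl, RhoNameEq.trans hw (RhoNameEq.symm hw')⟩

theorem newParMachine_live (hφ : ∀ a b : ℕ, RhoNameEq (φ a) (φ b) → a = b) (hux : u ≠ x)
    (hQ : Q.NuFree) (huQ : u ∉ Q.fn) (hxQ : x ∉ Q.fn) (h : Fresh φ S n p)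
    (hS : ∀ a, a = u ∨ a = x ∨ a = o ∨ a ∈ Q.fn → a ∈ S) :
    (newParMachine φ u x o Q n p).Live where
  valid := newParMachine_valid hφ hux hQ huQ hxQ h hS
  weight_K _ := by
    ext i; fin_cases i <;> rfl
  early_K i l hl := by
    simp only [newParMachine, Multiset.insert_eq_cons, Multiset.mem_cons,
      Multiset.mem_singleton] at hl
    rcases hl with rfl | rfl <;> exact not_false
  same i j w w' hw hw' := RhoNameEq.trans hw (RhoNameEq.symm hw')
  output v' i A r hA := by
    have e : (newParMachine φ u x o Q n p).K i + r = .nuIn ::ₘ .nuOut 0 ::ₘ r := by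
      simp [newParMachine]
    rw [e] at hA
    obtain ⟨A', ls', h₁, h₂, h₃⟩ := hA.fire (newParMachine_valid hφ hux hQ huQ hxQ h hS)
      (fun _ => by ext i; fin_cases i <;> rfl) (newParMachine_fires 0)
    cases h₂
    exact ⟨A', 0, r, .single h₁, h₃⟩
  content Y Z := by
    obtain ⟨X, hX, e⟩ := newParMachine_content (x := x) (o := o) hQ h
      (fun a ha => hS a (.inr (.inr (.inr ha)))) (hS u (.inl rfl)) Y Z
    exact ⟨X, _, hX, e⟩

theorem outParMachine_live (hφ : ∀ a b : ℕ, RhoNameEq (φ a) (φ b) → a = b) (hux : u ≠ x)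
    (hQ : Q.NuFree) (huQ : u ∉ Q.fn) (hxQ : x ∉ Q.fn) (h : Fresh φ S n p)
    (hS : ∀ a, a = u ∨ a = x ∨ a = o ∨ a ∈ Q.fn → a ∈ S)
    (hv : ∀ a ∈ S, (φ a).code.2 < v.code.2) (hvn : v.code.2 ≤ n.code.2)
    (hv' : ∃ w : RhoName, v = w.linc) :
    (outParMachine φ u x o Q v n p).Live where
  valid :=
    { inj := hφ
      ux := hux
      uF := huQ
      xF := hxQ
      size := h.size
      ne := h.ne
      -- The restriction is outside the replication, so the sent name `v` may be smaller than the
      -- parameters `n`, `p`; the threshold is its size.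
      exists_bound := ⟨v.code.2, hvn, fun a ha => hv a (hS a ha), fun _ => le_rfl,
        fun w hw => hw.elim⟩
      val := fun _ => by
        obtain ⟨w, rfl⟩ := hv'
        exact ⟨_, _, rfl⟩
      isVal := fun _ _ hw => RhoNameEq.code_eq hw
      nu := fun w hw => hw.elim
      val_nu := fun i w hw e => hw.elim
      content := by
        intro i j Y Z _ _
        obtain ⟨X, hX, e⟩ := outParMachine_content (x := x) (o := o) (v := v) hQ h
          (fun a ha => hS a (.inr (.inr (.inr ha)))) (hS u (.inl rfl)) Y Z
        obtain ⟨L, hL, e'⟩ := hX.exists_parts .self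
        obtain ⟨k, hk⟩ := Machine.HasLabels.of_parts (m := outParMachine φ u x o Q v n p) hL
        refine ⟨k, ?_⟩
        rw [e, e', add_comm]
        refine Machine.HasLabels.add (Machine.IsLab.hasLabels (.uOut ?_)) hk
        exact RhoNameEq.drop (.refl _) }
  weight_K _ := by
    ext i; fin_cases i <;> rfl
  early_K i l hl := by
    rw [outParMachine, Multiset.mem_singleton] at hl
    rw [hl]; exact not_false
  same i j w w' hw hw' := RhoNameEq.trans hw (RhoNameEq.symm hw')
  output v' i A r hA := ⟨A, 0, r, .refl, hA⟩
  content Y Z := by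
    obtain ⟨X, hX, e⟩ := outParMachine_content (x := x) (o := o) (v := v) hQ h
      (fun a ha => hS a (.inr (.inr (.inr ha)))) (hS u (.inl rfl)) Y Z
    exact ⟨X, _, hX, e⟩

end

/-- The encoding of `νz !(ū⟨z⟩ | Q)` in the test context, the first reduction excluded. -/
theorem outParMachine_initial {φ : ℕ → RhoName} {u x o : ℕ} {Q : PiProc 0} {S : Finset ℕ}
    {v w n p : RhoName} {N : Set RhoName} (hN : ∀ x y, RhoNameEq x y → x ∈ N → y ∈ N)
    (hN' : ∀ w ∈ N, ∃ a ∈ S, RhoNameEq w (φ a)) (h : Fresh φ S n p) (hu : u ∈ S)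
    (hw : ∀ a ∈ S, (φ a).code.2 < w.code.2) {A : RhoProc 0}
    (hA : A.cls = (RhoProc.inp (.name w)
        ((PiProc.repl (.par (.out (.free u) (.bound 0)) Q.weaken)).trans φ n p)).cls +
      (RhoProc.lift (.name w) (.drop (.name v))).cls + (outParMachine φ u x o Q v n p).ctx.cls) :
    (∀ A', RhoRed A A' → ∃ ls, (outParMachine φ u x o Q v n p).State 1 A' ls) ∧
      (∃ A' ls, Relation.ReflTransGen RhoRed A A' ∧
        (outParMachine φ u x o Q v n p).State 1 A' (.ctx0 ::ₘ ls)) ∧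
      ∀ o', RhoBarb N A o' → o'.name ∈ N ∧ ∃ y, o' = .inp y ∧ RhoNameEq y (φ u) := by
  set m := outParMachine φ u x o Q v n p with hm
  -- The channel `w` of the outer restriction is larger than all free names: it is neither
  -- observable nor able to interfere with the context.
  have hne : ∀ {y : RhoName} {a : ℕ}, a ∈ S → RhoNameEq y (φ a) → ¬ RhoNameEq y w := by
    intro y a ha hy hy'
    have := hw a ha
    rw [← hy.code_eq, hy'.code_eq] at this
    exact lt_irrefl _ this
  have hst : ∀ A' : RhoProc 0, A'.cls = (RhoProc.recv ((PiProc.repl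
      (.par (.out (.free u) (.bound 0)) Q.weaken)).trans φ n p) (.drop (.name v))).cls +
        m.ctx.cls → m.State 1 A' {.ctx0, .store, .copier, .msgN 0, .msgP} :=
    fun A' hA' => Machine.exists_state (m := m) rfl h.size h.ne hA'
  have hA' : A.cls = clsSum {.inp (.name w)
        ((PiProc.repl (.par (.out (.free u) (.bound 0)) Q.weaken)).trans φ n p),
      .lift (.name w) (.drop (.name v)), m.ctx} := by
    rw [hA]; simp [Multiset.insert_eq_cons, add_assoc]
  have hL : AllPrefix {.inp (.name w)
        ((PiProc.repl (.par (.out (.free u) (.bound 0)) Q.weaken)).trans φ n p),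
      .lift (.name w) (.drop (.name v)), m.ctx} := by
    intro P hP
    simp only [Multiset.insert_eq_cons, Multiset.mem_cons, Multiset.mem_singleton] at hP
    rcases hP with rfl | rfl | rfl <;> rfl
  refine ⟨fun A' hr => ?_, ?_, fun o' ho => ?_⟩
  · obtain ⟨x', y', P, R, M, e, hxy, e'⟩ := hr.of_sum hL hA'
    have hP : RhoProc.inp (.name x') P ∈ _ := e ▸ Multiset.mem_cons_self _ _
    have hR : RhoProc.lift (.name y') R ∈ _ :=
      e ▸ Multiset.mem_cons_of_mem (Multiset.mem_cons_self _ _)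
    simp only [Multiset.insert_eq_cons, Multiset.mem_cons, Multiset.mem_singleton,
      reduceCtorEq, false_or, or_false, Machine.ctx] at hP hR
    cases hR
    rcases hP with hP | hP
    · cases hP
      simp only [Multiset.insert_eq_cons, Multiset.cons_inj_right] at e
      exact ⟨_, hst A' (by rw [e', ← e, clsSum_singleton])⟩
    · cases hP
      exact (hne hu (.refl _) hxy).elim
  · have hc := ((ClsReds.com (.refl w) ((PiProc.repl
      (.par (.out (.free u) (.bound 0)) Q.weaken)).trans φ n p) (.drop (.name v))).add_right
      m.ctx.cls).congr hA rfl
    obtain ⟨A', e, hr⟩ := hc.exists_reds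
    exact ⟨A', _, hr, hst A' e⟩
  · obtain ⟨hn, P, hP, hb⟩ := ho.of_sum hN hL hA'
    refine ⟨hn, ?_⟩
    obtain ⟨a, ha, hna⟩ := hN' _ hn
    simp only [Multiset.insert_eq_cons, Multiset.mem_cons, Multiset.mem_singleton] at hP
    rcases hP with rfl | rfl | rfl
    · cases hb with | inp _ hxy => exact (hne ha hna hxy.symm).elim
    · cases hb with | out _ hxy => exact (hne ha hna hxy.symm).elim
    · cases hb with | inp _ hxy => exact ⟨_, rfl, hxy.symm⟩

/-- Both encodings are two-phase systems with the same observations: one constant name is sent on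
`u` in each, and the available threads of `Q` are the same. -/
theorem encodeBisim_newPar (φ : ℕ → RhoName) (hφ : ∀ a b : ℕ, RhoNameEq (φ a) (φ b) → a = b)
    {u x : ℕ} (o : ℕ) {Q : PiProc 0} (hux : u ≠ x) (hQ : Q.NuFree) (huQ : u ∉ Q.fn)
    (hxQ : x ∉ Q.fn) : EncodeBisim φ (testContext u x o (replNewPar u Q))
      (testContext u x o (newReplPar u Q)) := by
  have hfn₁ : (replNewPar u Q).fn = insert u Q.fn := by
    simp [replNewPar, PiProc.fn, PiName.fn]
  have hfn₂ : (newReplPar u Q).fn = insert u Q.fn := by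
    simp [newReplPar, PiProc.fn, PiName.fn, PiProc.fn_weaken]
  have hfn : (testContext u x o (replNewPar u Q)).fn = (testContext u x o (newReplPar u Q)).fn := by
    ext a; rw [mem_fn_testContext, mem_fn_testContext, hfn₁, hfn₂]
  set S := (testContext u x o (replNewPar u Q)).fn with hSdef
  have hS : ∀ a, a ∈ S ↔ a = u ∨ a = x ∨ a = o ∨ a ∈ Q.fn := by
    intro a; rw [hSdef, mem_fn_testContext, hfn₁, Finset.mem_insert]; tauto
  have huS : u ∈ S := (hS u).2 (.inl rfl)
  set N := observableNames φ (testContext u x o (replNewPar u Q))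
    (testContext u x o (newReplPar u Q)) with hNdef
  have hN' : ∀ w ∈ N, ∃ a ∈ S, RhoNameEq w (φ a) := by
    rintro w ⟨a, ha, hw⟩
    rw [← hfn, Finset.union_self] at ha
    exact ⟨a, ha, hw⟩
  have hN : ∀ x y, RhoNameEq x y → x ∈ N → y ∈ N := by
    rintro x y hxy ⟨a, ha, hw⟩
    exact ⟨a, ha, hxy.symm.trans hw⟩
  have huN : φ u ∈ N := ⟨u, Finset.mem_union_left _ huS, .refl _⟩
  have h₀ : Fresh φ S (initN φ S) (initP φ S) := fresh_init φ ⟨u, huS⟩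
  have hm₁ := newParMachine_live (o := o) hφ hux hQ huQ hxQ h₀.linc fun a ha => (hS a).2 ha
  -- The outer restriction consumes one more increment: it sends `(initN φ S).linc`, and the
  -- replication runs at the next increments.
  have hm₂ := outParMachine_live (o := o) hφ hux hQ huQ hxQ h₀.linc.linc
    (fun a ha => (hS a).2 ha) (v := (initN φ S).linc) h₀.linc.lt
    (by rw [size_linc, size_linc, size_linc]; omega) ⟨_, rfl⟩
  set m₁ := newParMachine φ u x o Q (initN φ S).linc (initP φ S).linc with hm₁def
  set m₂ := outParMachine φ u x o Q (initN φ S).linc (initN φ S).linc.linc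
    (initP φ S).linc.linc with hm₂def
  have hN₁ : ∀ w ∈ N, ∃ a, m₁.IsFree a ∧ RhoNameEq w (m₁.φ a) := by
    intro w hw
    obtain ⟨a, ha, h⟩ := hN' w hw
    exact ⟨a, (hS a).1 ha, h⟩
  have hN₂ : ∀ w ∈ N, ∃ a, m₂.IsFree a ∧ RhoNameEq w (m₂.φ a) := hN₁
  set A₁ := (testContext u x o (replNewPar u Q)).encode φ with hA₁
  set A₂ := (testContext u x o (newReplPar u Q)).encode φ with hA₂
  have e₁ : A₁.cls = ((replNewPar u Q).trans φ (initN φ S).linc (initP φ S).linc).cls +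
      m₁.ctx.cls := encode_testContext φ u x o _
  have e₂ : A₂.cls = (RhoProc.inp (.name (initP φ S).linc)
      ((PiProc.repl (.par (.out (.free u) (.bound 0)) Q.weaken)).trans φ (initN φ S).linc.linc
        (initP φ S).linc.linc)).cls +
      (RhoProc.lift (.name (initP φ S).linc) (.drop (.name (initN φ S).linc))).cls +
      m₂.ctx.cls := by
    rw [hA₂, encode_testContext φ u x o _, ← hfn]
    rfl
  have h₁ : m₁.State 1 A₁ {.ctx0, .store, .copier, .msgN 0, .msgP} :=
    Machine.exists_state (s := Fin.elim0) (P := .par (.res (.out (.free u) (.bound 0))) Q) rfl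
      h₀.linc.size h₀.linc.ne (by rw [RhoProc.semSubst_closed]; exact e₁)
  have hI : ∀ A : RhoProc 0, A.cls = A₂.cls → _ := fun A hA =>
    outParMachine_initial (Q := Q) (o := o) (x := x) hN hN' h₀.linc.linc huS
      (w := (initP φ S).linc) (fun a ha => (h₀.linc.lt a ha).trans_eq h₀.linc.size)
      (hA.trans e₂)
  have b₁ : RhoBarb N A₁ (.inp (φ u)) :=
    .of_cls hN huN (.inp _ (.refl _)) (e₁.trans (add_comm _ _))
  have b₂ : RhoBarb N A₂ (.inp (φ u)) :=
    .of_cls hN huN (.inp _ (.refl _)) (e₂.trans (add_comm _ _))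
  -- The first encoding starts directly as a state of its machine; the second starts in its
  -- exceptional initial state. Neither is late, since the input of the context on `u` is still
  -- visible in both.
  refine IsTwoPhase.bisim
    (Machine.isTwoPhase hm₁ hN hN₁ (I := fun _ => False) (fun _ _ h => h.elim)
      (fun _ h => h.elim) fun _ _ h => h.elim)
    (Machine.isTwoPhase hm₂ hN hN₂ (I := fun A => A.cls = A₂.cls)
      (fun A A' hA => (hI A hA).1 A') (fun A hA => (hI A hA).2.1) fun A o hA => (hI A hA).2.2 o)
    (.inr ⟨_, h₁⟩) (.inl rfl) (iff_of_false ?_ ?_)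
  · exact fun h => h.not_barb hm₁.valid hN hN₁ (.refl _) b₁
  · exact fun h => h.not_barb hm₂.valid hN hN₂ (.refl _) b₂

theorem WeakBarbedBisimilar.weakBarb {Proc α : Type} {step : Proc → Proc → Prop}
    {barb : Proc → Obs α → Prop} {P Q : Proc} (h : WeakBarbedBisimilar step barb P Q) {o : Obs α}
    (ho : WeakBarb step barb P o) : WeakBarb step barb Q o := by
  obtain ⟨R, hR, hPQ⟩ := h
  obtain ⟨P', hP, ho⟩ := ho
  obtain ⟨Q', hQ, hPQ'⟩ : ∃ Q', Relation.ReflTransGen step Q Q' ∧ R P' Q' := by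
    clear ho
    induction hP with
    | refl => exact ⟨Q, .refl, hPQ⟩
    | tail _ h ih =>
      obtain ⟨Q₁, h₁, h₂⟩ := ih
      obtain ⟨Q₂, h₃, h₄⟩ := hR.red _ _ h₂ _ h
      exact ⟨Q₂, h₁.trans h₃, h₄⟩
  obtain ⟨Q'', h₁, h₂⟩ := hR.obs _ _ hPQ' _ ho
  exact ⟨Q'', hQ.trans h₁, h₂⟩

theorem WeakBarbedBisimilar.symm {Proc α : Type} {step : Proc → Proc → Prop}
    {barb : Proc → Obs α → Prop} {P Q : Proc} (h : WeakBarbedBisimilar step barb P Q) :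
    WeakBarbedBisimilar step barb Q P := by
  obtain ⟨R, hR, hPQ⟩ := h
  exact ⟨R, hR, hR.symm _ _ hPQ⟩

/-! ### Growing parameters -/

theorem Code.grow_iterate_fst {c d : Code} : ∀ i : ℕ,
    (Code.grow^[i] c).1 = (Code.grow^[i] d).1 → c.1 = d.1
  | 0, h => h
  | i + 1, h => by
      rw [Function.iterate_succ_apply', Function.iterate_succ_apply'] at h
      exact grow_iterate_fst i (Code.node_injective h).2.1

theorem Code.grow_iterate_snd {c d : Code} (h : c.2 = d.2) : ∀ i : ℕ,
    (Code.grow^[i] c).2 = (Code.grow^[i] d).2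
  | 0 => h
  | i + 1 => by
      rw [Function.iterate_succ_apply', Function.iterate_succ_apply']
      simp only [Code.grow, Code.node, grow_iterate_snd h i]

theorem Code.grow_strictMono (c : Code) : StrictMono fun i => (Code.grow^[i] c).2 := by
  refine strictMono_nat_of_lt_succ fun i => ?_
  rw [Function.iterate_succ_apply']
  simp only [Code.grow, Code.node]
  omega

/-- Sizes grow strictly with the number of iterations, so equal codes force equal numbers of
iterations; the starting contents are then recovered by peeling off prefixes. -/
theorem Code.grow_iterate_injective {c d : Code} (h : c.2 = d.2) {i j : ℕ}
    (hij : Code.grow^[i] c = Code.grow^[j] d) : i = j ∧ c.1 = d.1 := by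
  have : i = j := (Code.grow_strictMono c).injective
    ((congrArg Prod.snd hij).trans (Code.grow_iterate_snd h j).symm)
  subst this
  exact ⟨rfl, Code.grow_iterate_fst i (congrArg Prod.fst hij)⟩

theorem Code.grow_iterate_linc (n : RhoName) (i : ℕ) :
    ∃ d e, Code.grow^[i] n.linc.code = Code.node false d e := by
  cases i with
  | zero => exact ⟨_, _, rfl⟩
  | succ i => rw [Function.iterate_succ_apply']; exact ⟨_, _, rfl⟩

/-- The machine of `!νz ū⟨z⟩`. -/
noncomputable def newMachine (φ : ℕ → RhoName) (u x o : ℕ) (n p : RhoName) : Machine where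
  φ := φ
  u := u
  x := x
  o := o
  F := ∅
  Q := .nil
  n := n
  p := p
  X := replBody φ (.res (.out (.free u) (.bound 0))) n p Fin.elim0
  val i := Code.grow^[i] n.linc.code
  IsVal i w := w.code = Code.grow^[i] n.linc.code
  nu := {w | ∃ j, w.code = Code.grow^[j] p.linc.code}
  K i := {.nuIn, .nuOut i}

/-- At most one message carries the parameter of a given round, or a later one. -/
def Lab.token (j : ℕ) : Lab → ℕ
  | .msgN i => if i ≤ j then 1 else 0
  | .wait i => if i ≤ j then 1 else 0
  | .nuOut i => if i = j then 1 else 0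
  | .uOut i => if i = j then 1 else 0
  | .ctx1 i => if i = j then 1 else 0
  | .ctxOut i => if i = j then 1 else 0
  | .ctxIn i => if i = j then 1 else 0
  | _ => 0

/-- The test cannot succeed. -/
def Safe (ls : Multiset Lab) : Prop := (∀ j, (ls.map (Lab.token j)).sum ≤ 1) ∧ .xOut ∉ ls

/-- The token of `j` counts what carries the value of round `j` or may still produce it, whence `i ≤
j` for parameter messages. A round `i` turns its token into one for the sent value when `i = j` and
one for the next message when `i + 1 ≤ j`, so the total does not grow. Success would need two tokens
for one `j`, as values of different rounds are inequivalent. -/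
theorem Safe.react {φ : ℕ → RhoName} {u x o : ℕ} {n p : RhoName} {a b : Lab} {r ls : Multiset Lab}
    (h : Safe (a ::ₘ b ::ₘ r)) (hr : Machine.React (newMachine φ u x o n p) a b ls) :
    Safe (ls + r) := by
  obtain ⟨h₁, h₂⟩ := h
  simp only [Multiset.mem_cons, not_or] at h₂
  constructor
  · intro j
    have := h₁ j
    refine le_trans ?_ this
    simp only [Multiset.map_add, Multiset.sum_add, Multiset.map_cons, Multiset.sum_cons,
      ← add_assoc]
    refine Nat.add_le_add_right ?_ _
    cases hr <;> simp [Lab.token, newMachine]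
    split_ifs <;> omega
  · intro hx
    rcases Multiset.mem_add.1 hx with hx | hx
    · cases hr with
      | recvP => simp [newMachine, Multiset.mem_replicate] at hx
      | q => simp [Multiset.mem_replicate] at hx
      | @ctxIn i j hij =>
        obtain rfl := (Code.grow_iterate_injective rfl hij).1
        have := h₁ i
        simp only [Multiset.map_cons, Multiset.sum_cons, Lab.token, if_true] at this
        omega
      | _ => simp at hx
    · exact h₂.2.2 hx

section

variable {φ : ℕ → RhoName} {u x o : ℕ} {S : Finset ℕ} {n p : RhoName}

theorem bindParams_free (h : Fresh φ S n p) {a : ℕ} (ha : a ∈ S) :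
    bindParams (k := 0) n p (.name (φ a)) = .name (φ a) :=
  bindParams_size (h.lt a ha).ne (by rw [← h.size]; exact (h.lt a ha).ne)

theorem newMachine_valid (hφ : ∀ a b : ℕ, RhoNameEq (φ a) (φ b) → a = b) (hux : u ≠ x)
    (h : Fresh φ S n p) (hS : ∀ a, a = u ∨ a = x ∨ a = o → a ∈ S) :
    (newMachine φ u x o n p).Valid where
  inj := hφ
  ux := hux
  uF := Finset.notMem_empty _
  xF := Finset.notMem_empty _
  size := h.size
  ne := h.ne
  exists_bound := by
    have hg : ∀ (w : RhoName) (i : ℕ), w.code.2 ≤ (Code.grow^[i] w.linc.code).2 := by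
      intro w i
      refine le_trans ?_ ((Code.grow_strictMono w.linc.code).monotone (Nat.zero_le i))
      change _ ≤ w.linc.code.2
      rw [size_linc]; omega
    refine ⟨n.code.2, le_rfl, fun a ha => h.lt a (hS a ?_), hg n, ?_⟩
    · rcases ha with ha | ha | ha | ha
      exacts [.inl ha, .inr (.inl ha), .inr (.inr ha), (Finset.notMem_empty _ ha).elim]
    · rintro w ⟨j, hw⟩
      rw [hw, h.size]; exact hg p j
  val := Code.grow_iterate_linc n
  isVal _ _ hw := hw
  nu := by
    rintro w ⟨j, hw⟩
    rw [hw]; exact Code.grow_iterate_linc p j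
  val_nu := by
    rintro i w ⟨j, hw⟩ e
    exact linc_ne h.ne (Code.grow_iterate_injective (by rw [size_linc, size_linc, h.size])
      (e.symm.trans hw)).2
  content := by
    intro i j Y Z hY hZ
    refine ⟨0, ?_⟩
    -- Here the parameters of the restriction are exactly the bound ones: channel and sent value are
    -- what this round has received.
    have e : (newMachine φ u x o n p).X.semSubst (Machine.params Y Z) =
        .par (.inp (.name (.quote Z)) (.lift (.name (φ u)) (.drop (.bound 0))))
          (.lift (.name (.quote Z)) Y) := by
      have h₁ : roundNames Fin.elim0 Y Z 1 = .name (.quote Y) := rfl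
      have h₀ : roundNames Fin.elim0 Y Z 0 = .name (.quote Z) := rfl
      rw [newMachine, replBody_params]
      simp [PiProc.trans, RhoProc.map, RhoProc.output, bindParams_left h.ne, bindParams_right,
        bindParams_free h (hS u (.inl rfl)), PiName.toRef, h₁, h₀]
    rw [e]
    have hw : RhoName.quote Z ∈ (newMachine φ u x o n p).nu := ⟨j, hZ⟩
    exact Machine.HasLabels.add (Machine.IsLab.hasLabels (.nuIn hw))
      (Machine.IsLab.hasLabels (.nuOut (i := i) hw hY))

/-- Only validity of the machine is used. Safety persists along reductions, and an output on `x`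
could only come from the label `xOut`. -/
theorem newMachine_not_weakBarb (hφ : ∀ a b : ℕ, RhoNameEq (φ a) (φ b) → a = b) (hux : u ≠ x)
    (h : Fresh φ S n p) (hS : ∀ a, a = u ∨ a = x ∨ a = o → a ∈ S) {N : Set RhoName}
    (hN : ∀ x y, RhoNameEq x y → x ∈ N → y ∈ N) {A : RhoProc 0} {ls : Multiset Lab}
    (hA : (newMachine φ u x o n p).HasLabels A.cls ls) (hls : Safe ls) :
    ¬ RhoWeakBarb N A (.out (φ x)) := by
  have hm := newMachine_valid hφ hux h hS
  rintro ⟨A', hr, ho⟩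
  obtain ⟨ls', hA', hls'⟩ :
      ∃ ls', (newMachine φ u x o n p).HasLabels A'.cls ls' ∧ Safe ls' := by
    clear ho
    induction hr with
    | refl => exact ⟨ls, hA, hls⟩
    | tail _ hr ih =>
      obtain ⟨ls', h₁, h₂⟩ := ih
      obtain ⟨a, b, r, ls'', rfl, h₃, h₄⟩ := h₁.step hm hr
      exact ⟨_, h₄, h₂.react h₃⟩
  obtain ⟨_, l, hl, P, hP, hb⟩ := hA'.barb hN ho
  cases hb with
  | out R hxy =>
    obtain ⟨κ, hκ, hc⟩ := hP.lift_chan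
    obtain rfl := hc.unique hm (κ' := .pi x) ⟨.inr (.inl rfl), .refl _⟩ hxy
    cases hκ with
    | uOut _ h => exact hux (Machine.Kind.pi.inj h).symm
    | ctx0 h => exact hux (Machine.Kind.pi.inj h).symm
    | ctx1 _ h => exact hux (Machine.Kind.pi.inj h).symm
    | xOut => exact hls'.2 hl
    | qPi ha => exact Finset.notMem_empty _ ha

/-- A round of `!νq νz ū⟨z⟩` sends the same name as every other round. -/
theorem replNewNew_round (h : Fresh φ S n p) (hu : u ∈ S) (Y Z : RhoProc 0) :
    ClsReds ((replBody φ (.res (.res (.out (.free u) (.bound 0)))) n p Fin.elim0).semSubst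
      (Machine.params Y Z)).cls (RhoProc.lift (.name (φ u)) (.drop (.name n.linc))).cls := by
  have hp := bindParams_size (k := 0) (n := n) (p := p) (w := p.linc)
    (by rw [size_linc]; have := h.size; omega) (by rw [size_linc]; omega)
  have hn := bindParams_size (k := 0) (n := n) (p := p) (w := n.linc)
    (by rw [size_linc]; omega) (by rw [size_linc]; have := h.size; omega)
  have h₀ : roundNames Fin.elim0 Y Z 0 = .name (.quote Z) := rfl
  -- The outer restriction communicates on the received parameter, but the name it transmits is
  -- never used. The inner one then works with the constants `p.linc` and `n.linc`.
  have h₁ := ClsReds.com (.refl (.quote Z)) (.par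
    (.inp (.name p.linc) (.lift (.name (φ u)) (.drop (.bound 0))))
    (.lift (.name p.linc) (.drop (.name n.linc))))
    ((((RhoProc.drop (.name n)).map (bindParams n p)).semSubst (roundNames Fin.elim0 Y Z)))
  have h₂ := ClsReds.com (.refl p.linc) (.lift (.name (φ u)) (.drop (.bound 0)))
    (.drop (.name n.linc))
  refine (h₁.trans (h₂.congr ?_ ?_)).congr ?_ rfl
  · simp [RhoProc.recv, RhoProc.cls_par]
  · simp [RhoProc.recv]
  · rw [replBody_params]
    simp [PiProc.trans, RhoProc.map, RhoProc.output, hp, hn, bindParams_right,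
      bindParams_free h hu, PiName.toRef, h₀, RhoProc.cls_par]

/-- Two outputs of the same name suffice for the context to reach its output on `x`. -/
theorem reds_ctx (m : Machine) {v : RhoName} :
    ClsReds (m.ctx.cls + ((RhoProc.lift (.name (m.φ m.u)) (.drop (.name v))).cls +
        (RhoProc.lift (.name (m.φ m.u)) (.drop (.name v))).cls))
      (RhoProc.lift (.name (m.φ m.x)) (.drop (.name (m.φ m.o)))).cls := by
  have h₁ := ClsReds.com (.refl (m.φ m.u)) (.inp (.name (m.φ m.u))
    (.par (.lift (.bound 1) (.drop (.name (m.φ m.o)))) (m.test (.bound 0)))) (.drop (.name v))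
  have h₂ := ClsReds.com (.refl (m.φ m.u)) (.par (.lift (.name (.quote (.drop (.name v))))
    (.drop (.name (m.φ m.o)))) (m.test (.bound 0))) (.drop (.name v))
  have h₃ := ClsReds.com (.refl (.quote (.drop (.name v))))
    (.lift (.name (m.φ m.x)) (.drop (.name (m.φ m.o)))) (.drop (.name (m.φ m.o)))
  refine ((h₁.add_right
    (RhoProc.lift (.name (m.φ m.u)) (.drop (.name v))).cls).trans
    ((h₂.trans (h₃.congr ?_ ?_)).congr ?_ rfl)).congr ?_ rfl
  · simp [RhoProc.recv, RhoProc.cls_par, Machine.test, add_comm]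
  · simp [RhoProc.recv]
  · rfl
  · exact (add_assoc _ _ _).symm

end

/-- Bisimilarity preserves weak observations; the output on `x` is reachable only in the encoding
with the additional restriction. -/
theorem not_encodeBisim_new (φ : ℕ → RhoName) (hφ : ∀ a b : ℕ, RhoNameEq (φ a) (φ b) → a = b)
    {u x : ℕ} (o : ℕ) (hux : u ≠ x) : ¬ EncodeBisim φ (testContext u x o (replNew u))
      (testContext u x o (replNewNew u)) := by
  have hfn : (testContext u x o (replNewNew u)).fn = (testContext u x o (replNew u)).fn := rfl
  intro hbis
  rw [EncodeBisim] at hbis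
  set S := (testContext u x o (replNew u)).fn with hSdef
  have hS : ∀ a, a = u ∨ a = x ∨ a = o → a ∈ S := by
    intro a ha; rw [hSdef, mem_fn_testContext]; tauto
  set N := observableNames φ (testContext u x o (replNew u))
    (testContext u x o (replNewNew u)) with hNdef
  have hN : ∀ x y, RhoNameEq x y → x ∈ N → y ∈ N := by
    rintro x y hxy ⟨a, ha, hw⟩
    exact ⟨a, ha, hxy.symm.trans hw⟩
  have hxN : φ x ∈ N := ⟨x, Finset.mem_union_left _ (hS x (.inr (.inl rfl))), .refl _⟩
  have h : Fresh φ S (initN φ S).linc (initP φ S).linc :=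
    (fresh_init φ ⟨u, hS u (.inl rfl)⟩).linc
  have hA : (newMachine φ u x o (initN φ S).linc (initP φ S).linc).State 1
      ((testContext u x o (replNew u)).encode φ) {.ctx0, .store, .copier, .msgN 0, .msgP} :=
    Machine.exists_state (s := Fin.elim0) (P := .res (.out (.free u) (.bound 0))) rfl h.size h.ne
      (by rw [RhoProc.semSubst_closed]; exact encode_testContext φ u x o _)
  refine newMachine_not_weakBarb hφ hux h hS hN hA.1 ⟨fun j => ?_, ?_⟩
    (hbis.symm.weakBarb (o := .out (φ x)) ?_)
  · simp [Lab.token]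
  · simp
  -- This machine serves only as notation for the idle replication and the context; its labels and
  -- validity play no role. Two rounds provide the two outputs on `u`.
  · set m : Machine := { newMachine φ u x o (initN φ S).linc (initP φ S).linc with
      X := replBody φ (.res (.res (.out (.free u) (.bound 0)))) (initN φ S).linc
        (initP φ S).linc Fin.elim0 } with hm
    have hu := replNewNew_round h (hS u (.inl rfl))
    obtain ⟨Y, Z, h₁⟩ := Machine.reds_idle m (.drop (.name m.n.linc)) (.drop (.name m.p.linc))
    obtain ⟨Y', Z', h₂⟩ := Machine.reds_idle m Y Z
    have h₁ := h₁.trans ((hu _ _).add_left _)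
    have h₂ := h₂.trans ((hu _ _).add_left _)
    have h₃ := ((h₁.trans (h₂.add_right _)).add_right m.ctx.cls).trans
      (((reds_ctx m).add_left (m.idle Y' Z')).congr (by
        rw [add_comm m.ctx.cls, ← add_assoc, ← add_assoc]; rfl) rfl)
    have e : ((testContext u x o (replNewNew u)).encode φ).cls =
        m.idle (.drop (.name m.n.linc)) (.drop (.name m.p.linc)) + m.ctx.cls := by
      have := Machine.trans_repl (m := m) (s := Fin.elim0)
        (P := .res (.res (.out (.free u) (.bound 0)))) rfl h.size h.ne
      rw [RhoProc.semSubst_closed] at this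
      rw [encode_testContext, hfn]
      refine congrArg₂ _ ((congrArg RhoProc.cls this).trans ?_) rfl
      rw [Machine.idle]
      simp only [RhoProc.cls_par]
      abel
    obtain ⟨A', e', hr⟩ := (h₃.congr e rfl).exists_reds
    exact ⟨A', hr, .of_cls hN hxN (.out _ (.refl _)) (e'.trans (add_comm _ _))⟩

/-! ## Structural congruence in the pi-calculus -/

theorem PiName.under_eq_free {k m : ℕ} {f : PiName k → PiName m}
    (hf : ∀ y a, f y = .free a ↔ y = .free a) (y : PiName (k + 1)) (a : ℕ) :
    PiName.under f y = .free a ↔ y = .free a := by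
  have hs : ∀ {i : ℕ} (y : PiName i) (a : ℕ), y.shift = .free a ↔ y = .free a := by
    intro i y a; cases y <;> simp [PiName.shift]
  rcases y with b | i
  · exact ((hs (f (.free b)) a).trans (hf _ a)).trans (by simp)
  · refine Fin.cases ?_ (fun i => ?_) i
    · simp [PiName.under]
    · exact ((hs (f (.bound i)) a).trans (hf _ a)).trans (by simp)

theorem PiBarb.map_iff {N : Set ℕ} {o : Obs ℕ} : ∀ {k m : ℕ} (P : PiProc k)
    {f : PiName k → PiName m}, (∀ y a, f y = .free a ↔ y = .free a) →
    (PiBarb N (P.map f) o ↔ PiBarb N P o)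
  | _, _, .nil, _, _ => ⟨fun h => (nomatch h), fun h => (nomatch h)⟩
  | _, _, .par P Q, f, hf => by
      constructor
      · intro h
        cases h with
        | par_left _ h => exact .par_left _ ((PiBarb.map_iff P hf).1 h)
        | par_right _ h => exact .par_right _ ((PiBarb.map_iff Q hf).1 h)
      · intro h
        cases h with
        | par_left _ h => exact .par_left _ ((PiBarb.map_iff P hf).2 h)
        | par_right _ h => exact .par_right _ ((PiBarb.map_iff Q hf).2 h)
  | _, _, .inp x P, f, hf => by
      constructor
      · intro h
        rw [PiProc.map] at h
        generalize hx : f x = x' at h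
        cases h with
        | inp _ h =>
          obtain rfl := (hf x _).1 hx
          exact .inp _ h
      · intro h
        cases h with
        | inp _ h => rw [PiProc.map, (hf _ _).2 rfl]; exact .inp _ h
  | _, _, .out x z, f, hf => by
      constructor
      · intro h
        rw [PiProc.map] at h
        generalize hx : f x = x' at h
        cases h with
        | out _ h =>
          obtain rfl := (hf x _).1 hx
          exact .out _ h
      · intro h
        cases h with
        | out _ h => rw [PiProc.map, (hf _ _).2 rfl]; exact .out _ h
  | _, _, .res P, f, hf => by
      constructor
      · intro h
        cases h with
        | res h => exact .res ((PiBarb.map_iff P (PiName.under_eq_free hf)).1 h)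
      · intro h
        cases h with
        | res h => exact .res ((PiBarb.map_iff P (PiName.under_eq_free hf)).2 h)
  | _, _, .repl P, f, hf => by
      constructor
      · intro h
        cases h with
        | repl h => exact .repl ((PiBarb.map_iff P hf).1 h)
      · intro h
        cases h with
        | repl h => exact .repl ((PiBarb.map_iff P hf).2 h)

section

variable {N : Set ℕ} {k : ℕ} {o : Obs ℕ}

theorem piBarb_nil : ¬ PiBarb N (PiProc.nil : PiProc k) o := nofun

theorem piBarb_par {P Q : PiProc k} : PiBarb N (.par P Q) o ↔ PiBarb N P o ∨ PiBarb N Q o := by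
  constructor
  · intro h
    cases h with
    | par_left _ h => exact .inl h
    | par_right _ h => exact .inr h
  · rintro (h | h)
    exacts [.par_left _ h, .par_right _ h]

theorem piBarb_res {P : PiProc (k + 1)} : PiBarb N (.res P) o ↔ PiBarb N P o :=
  ⟨fun h => by cases h with | res h => exact h, .res⟩

theorem piBarb_repl {P : PiProc k} : PiBarb N (.repl P) o ↔ PiBarb N P o :=
  ⟨fun h => by cases h with | repl h => exact h, .repl⟩

theorem piBarb_inp {x : PiName k} {P P' : PiProc (k + 1)} (h : PiBarb N (.inp x P) o) :
    PiBarb N (.inp x P') o := by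
  cases h with | inp _ h => exact .inp _ h

end

theorem PiStruct.barb_iff {N : Set ℕ} {k : ℕ} {P Q : PiProc k} (h : PiStruct P Q) (o : Obs ℕ) :
    PiBarb N P o ↔ PiBarb N Q o := by
  induction h with
  | refl => rfl
  | symm _ ih => exact ih.symm
  | trans _ _ ih ih' => exact ih.trans ih'
  | par _ _ ih ih' => rw [piBarb_par, piBarb_par, ih, ih']
  | inp => exact ⟨piBarb_inp, piBarb_inp⟩
  | res _ ih => rw [piBarb_res, piBarb_res, ih]
  | repl _ ih => rw [piBarb_repl, piBarb_repl, ih]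
  | par_nil => simp [piBarb_par, piBarb_nil]
  | par_comm => rw [piBarb_par, piBarb_par, or_comm]
  | par_assoc => simp only [piBarb_par, or_assoc]
  | res_nil => simp [piBarb_res, piBarb_nil]
  | res_swap P =>
    simp only [piBarb_res]
    refine (PiBarb.map_iff P fun y a => ?_).symm
    cases y <;> simp [PiName.swap]
  | repl_unfold => simp [piBarb_par, piBarb_repl]
  | res_par P Q =>
    simp only [piBarb_par, piBarb_res, PiProc.weaken]
    rw [PiBarb.map_iff Q fun y a => by cases y <;> simp [PiName.shift]]

/-- Structural congruence is itself a bisimulation, as reduction is closed under it and barbs are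
invariant. -/
theorem PiStruct.bisim {P Q : PiProc 0} (h : PiStruct P Q) : PiWeakBisim P Q :=
  ⟨PiStruct, ⟨fun _ _ => .symm, fun _ _ h P' hr => ⟨P', .single (.struct h.symm hr (.refl _)), .refl _⟩,
    fun _ _ h o ho => ⟨_, .refl, (h.barb_iff o).1 ho⟩⟩, h⟩

/-- A restriction on a name that does not occur can be dropped. -/
theorem PiStruct.res_weaken {k : ℕ} (P : PiProc k) : PiStruct (.res P.weaken) P := by
  have h₁ : PiStruct (.res (.par .nil P.weaken)) (.par (.res .nil) P) := (PiStruct.res_par .nil P).symm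
  have h₂ : PiStruct (.par (.res .nil) P) P :=
    ((PiStruct.res_nil.par (.refl P)).trans (.par_comm _ _)).trans (.par_nil P)
  exact ((((PiStruct.par_comm _ _).trans (.par_nil _)).symm.res).trans h₁).trans h₂

theorem replNew_struct (u : ℕ) : PiStruct (replNew u) (replNewNew u) :=
  .repl (PiStruct.res_weaken (.res (.out (.free u) (.bound 0)))).symm

/-- A replicated output answers an input. -/
theorem PiRed.repl_out {k : ℕ} (a z : PiName k) (R C : PiProc k) (P : PiProc (k + 1)) :
    PiRed (.par (.par (.inp a P) (.repl (.par (.out a z) R))) C)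
      (.par (.par (P.subst z) (.repl (.par (.out a z) R))) (.par R C)) := by
  refine .struct ?_ (.par (.par R (.par (.repl (.par (.out a z) R)) C)) (.com a z P)) ?_
  · refine (PiStruct.par_assoc _ _ _).trans ?_
    refine (((PiStruct.refl _).par (((PiStruct.repl_unfold _).par (.refl C)).trans
      (((PiStruct.par_assoc _ _ _)).trans (.par_assoc _ _ _)))).trans (.symm ?_))
    exact .par_assoc _ _ _
  · refine .trans ?_ (PiStruct.par_assoc _ _ _).symm
    refine (PiStruct.refl _).par ?_
    refine (PiStruct.par_assoc _ _ _).symm.trans ?_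
    exact ((PiStruct.par_comm _ _).par (.refl C)).trans (.par_assoc _ _ _)

/-- After extrusion of the single restriction, two unfoldings deliver the same bound name to both
inputs of the context, which can then communicate internally. The spare copies of `Q` are carried
along. -/
theorem newReplPar_weakBarb (u x o : ℕ) (Q : PiProc 0) :
    PiWeakBarb (testContext u x o (newReplPar u Q)) (.out x) := by
  set S : PiProc 1 := .repl (.par (.out (.free u) (.bound 0)) Q.weaken) with hS
  have h₁ : PiStruct (testContext u x o (newReplPar u Q)) (.res (.par (.par
      (.inp (.free u) (.inp (.free u) (.par (.out (.bound 1) (.free o))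
        (.inp (.bound 0) (.out (.free x) (.free o)))))) S) .nil)) := by
    refine (PiStruct.res_par _ _).trans (.res ?_)
    exact (PiStruct.par_comm _ _).trans (PiStruct.par_nil _).symm
  have r₁ := PiRed.repl_out (.free u) (.bound 0) Q.weaken .nil
    (.inp (.free u) (.par (.out (.bound 1) (.free o)) (.inp (.bound 0) (.out (.free x) (.free o)))))
  have r₂ := PiRed.repl_out (.free u) (.bound 0) Q.weaken (.par Q.weaken .nil)
    (.par (.out (.bound 1) (.free o)) (.inp (.bound 0) (.out (.free x) (.free o))))
  have r₃ : PiRed (.par (.par (.par (.out (.bound 0) (.free o)) (.inp (.bound 0)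
      (.out (.free x) (.free o)))) S) (.par Q.weaken (.par Q.weaken .nil)))
      (.par (.par (.out (.free x) (.free o)) S) (.par Q.weaken (.par Q.weaken .nil))) :=
    .par _ (.par _ (.struct (.par_comm _ _) (.com _ _ (.out (.free x) (.free o))) (.refl _)))
  refine ⟨_, ((Relation.ReflTransGen.single (.struct h₁ (.res r₁) (.refl _))).tail
    (.res r₂)).tail (.res r₃), ?_⟩
  exact .res (.par_left _ (.par_left _ (.out _ trivial)))

/-! ## A linear type system for the pi-calculus -/

/-- Extend a function of names under a binder. -/
def PiName.ext {k : ℕ} {α : Type} (Γ : PiName k → α) (s : α) : PiName (k + 1) → α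
  | .free a => Γ (.free a)
  | .bound i => Fin.cases s (fun j => Γ (.bound j)) i

@[simp] theorem PiName.ext_shift {k : ℕ} {α : Type} (Γ : PiName k → α) (s : α) (y : PiName k) :
    PiName.ext Γ s y.shift = Γ y := by
  cases y <;> rfl

@[simp] theorem PiName.ext_zero {k : ℕ} {α : Type} (Γ : PiName k → α) (s : α) :
    PiName.ext Γ s (.bound 0) = s := rfl

theorem PiName.ext_under {k m : ℕ} {α : Type} (Γ : PiName m → α) (s : α) (f : PiName k → PiName m) :
    PiName.ext Γ s ∘ PiName.under f = PiName.ext (Γ ∘ f) s := by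
  funext y
  rcases y with a | i
  · exact PiName.ext_shift _ _ _
  · exact Fin.cases rfl (fun i => PiName.ext_shift _ _ _) i

theorem PiName.ext_comp_shift {k : ℕ} {α : Type} (Γ : PiName k → α) (s : α) :
    PiName.ext Γ s ∘ PiName.shift = Γ := by
  funext y; simp

theorem PiName.exists_shift {k : ℕ} (y : PiName (k + 1)) :
    y = .bound 0 ∨ ∃ z : PiName k, y = z.shift := by
  rcases y with a | i
  · exact .inr ⟨.free a, rfl⟩
  · exact Fin.cases (.inl rfl) (fun i => .inr ⟨.bound i, rfl⟩) i

/-- The sum of the weights of the occurrences of names. -/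
def PiProc.count : {k : ℕ} → (PiName k → ℕ) → PiProc k → ℕ
  | _, _, .nil => 0
  | _, g, .par P Q => P.count g + Q.count g
  | _, g, .inp x P => g x + P.count (PiName.ext g 0)
  | _, g, .out x z => g x + g z
  | _, g, .res P => P.count (PiName.ext g 0)
  | _, g, .repl P => P.count g

open Classical in
/-- The indicator of a name. -/
noncomputable def PiName.single {k : ℕ} (y z : PiName k) : ℕ := if z = y then 1 else 0

@[simp] theorem PiName.single_self {k : ℕ} (y : PiName k) : PiName.single y y = 1 := if_pos rfl

theorem PiName.single_of_ne {k : ℕ} {y z : PiName k} (h : z ≠ y) : PiName.single y z = 0 :=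
  if_neg h

theorem PiName.shift_injective {k : ℕ} : Function.Injective (PiName.shift (k := k)) := by
  rintro (a | i) (b | j) h <;> simp_all [PiName.shift]

theorem PiName.shift_ne_zero {k : ℕ} (y : PiName k) : y.shift ≠ .bound 0 := by
  cases y
  · exact nofun
  · intro h; exact Fin.succ_ne_zero _ (PiName.bound.inj h)

theorem PiName.ext_single {k : ℕ} (y : PiName k) :
    PiName.ext (PiName.single y) 0 = PiName.single y.shift := by
  funext z
  rcases z.exists_shift with rfl | ⟨z, rfl⟩
  · exact (PiName.single_of_ne y.shift_ne_zero.symm).symm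
  · rw [PiName.ext_shift]
    by_cases h : z = y
    · rw [h, single_self, single_self]
    · rw [single_of_ne h, single_of_ne fun h' => h (shift_injective h')]

theorem PiName.ext_add {k : ℕ} (g h : PiName k → ℕ) :
    PiName.ext (g + h) 0 = PiName.ext g 0 + PiName.ext h 0 := by
  funext z
  rcases z.exists_shift with rfl | ⟨z, rfl⟩ <;> simp

namespace PiProc

theorem count_map : ∀ {k m : ℕ} (P : PiProc k) (f : PiName k → PiName m) (g : PiName m → ℕ),
    (P.map f).count g = P.count (g ∘ f)
  | _, _, .nil, _, _ => rfl
  | _, _, .par P Q, f, g => by simp only [map, count, P.count_map, Q.count_map]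
  | _, _, .inp x P, f, g => by
      simp only [map, count, P.count_map, PiName.ext_under, Function.comp_apply]
  | _, _, .out x z, f, g => rfl
  | _, _, .res P, f, g => by simp only [map, count, P.count_map, PiName.ext_under]
  | _, _, .repl P, f, g => by simp only [map, count, P.count_map]

theorem count_add : ∀ {k : ℕ} (P : PiProc k) (g h : PiName k → ℕ),
    P.count (g + h) = P.count g + P.count h
  | _, .nil, _, _ => rfl
  | _, .par P Q, g, h => by simp only [count, P.count_add, Q.count_add]; omega
  | _, .inp x P, g, h => by
      simp only [count, PiName.ext_add, P.count_add, Pi.add_apply]; omega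
  | _, .out x z, g, h => by simp only [count, Pi.add_apply]; omega
  | _, .res P, g, h => by simp only [count, PiName.ext_add, P.count_add]
  | _, .repl P, g, h => by simp only [count, P.count_add]

theorem count_zero {k : ℕ} (P : PiProc k) : P.count 0 = 0 := by
  have := P.count_add 0 0
  rw [add_zero] at this
  omega

/-- If no name of positive weight occurs, then the total weight is zero. -/
theorem count_eq_zero : ∀ {k : ℕ} (P : PiProc k) (g : PiName k → ℕ),
    (∀ y, g y ≠ 0 → P.count (PiName.single y) = 0) → P.count g = 0
  | _, .nil, _, _ => rfl
  | _, .par P Q, g, h => by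
      simp only [count, Nat.add_eq_zero_iff] at h ⊢
      exact ⟨P.count_eq_zero g fun y hy => (h y hy).1, Q.count_eq_zero g fun y hy => (h y hy).2⟩
  | _, .inp x P, g, h => by
      simp only [count, Nat.add_eq_zero_iff, PiName.ext_single] at h ⊢
      constructor
      · by_contra hx
        simpa using (h x hx).1
      · refine P.count_eq_zero _ fun y hy => ?_
        rcases y.exists_shift with rfl | ⟨y, rfl⟩
        · exact (hy rfl).elim
        · exact (h y (by simpa using hy)).2
  | _, .out x z, g, h => by
      simp only [count, Nat.add_eq_zero_iff] at h ⊢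
      constructor
      · by_contra hx
        simpa using (h x hx).1
      · by_contra hx
        simpa using (h z hx).2
  | _, .res P, g, h => by
      simp only [count, PiName.ext_single] at h ⊢
      refine P.count_eq_zero _ fun y hy => ?_
      rcases y.exists_shift with rfl | ⟨y, rfl⟩
      · exact (hy rfl).elim
      · exact h y (by simpa using hy)
  | _, .repl P, g, h => P.count_eq_zero g h

theorem count_le : ∀ {k : ℕ} (P : PiProc k) {g h : PiName k → ℕ}, g ≤ h → P.count g ≤ P.count h := by
  intro k P g h hgh
  have : h = g + (h - g) := (add_tsub_cancel_of_le hgh).symm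
  rw [this, P.count_add]
  exact Nat.le_add_right _ _

theorem count_weaken_zero {k : ℕ} (P : PiProc k) :
    P.weaken.count (PiName.single (.bound 0)) = 0 := by
  rw [weaken, count_map]
  refine (congrArg (fun g => P.count g) ?_).trans P.count_zero
  funext y
  exact PiName.single_of_ne y.shift_ne_zero

end PiProc

/-- The sorts of names: the channel of fresh names, the channel that is never used, ordinary names,
and names that are used at most once. -/
inductive PiSort : Type
  | fresh | dead | ordinary | linear

/-- The typed processes. -/
def PiProc.Typed : {k : ℕ} → (PiName k → PiSort) → PiProc k → Prop
  | _, _, .nil => True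
  | _, Γ, .par P Q => P.Typed Γ ∧ Q.Typed Γ
  | _, Γ, .inp x P =>
      (Γ x = .ordinary ∧ P.Typed (PiName.ext Γ .ordinary)) ∨
      (Γ x = .fresh ∧ P.Typed (PiName.ext Γ .linear) ∧ P.count (PiName.single (.bound 0)) ≤ 1) ∨
      -- Such an input can never fire, its channel being used at most once. Its body is therefore
      -- not required to be typed, and may even output on the dead channel; it must only be free of
      -- linear names.
      (Γ x = .linear ∧ ∀ y, Γ y = .linear → P.count (PiName.single y.shift) = 0)
  | _, Γ, .out x z =>
      (Γ x = .ordinary ∧ Γ z = .ordinary) ∨ (Γ x = .fresh ∧ Γ z = .linear) ∨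
      (Γ x = .linear ∧ Γ z ≠ .linear)
  | _, Γ, .res P =>
      P.Typed (PiName.ext Γ .ordinary) ∨
      (P.Typed (PiName.ext Γ .linear) ∧ P.count (PiName.single (.bound 0)) ≤ 1)
  | _, Γ, .repl P => P.Typed Γ ∧ ∀ y, Γ y = .linear → P.count (PiName.single y) = 0

theorem PiName.single_zero_under {k m : ℕ} (f : PiName k → PiName m) :
    PiName.single (.bound 0) ∘ PiName.under f = PiName.single (.bound 0) := by
  funext y
  rcases y.exists_shift with rfl | ⟨y, rfl⟩
  · exact (PiName.single_self _).trans (PiName.single_self _).symm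
  · rw [Function.comp_apply, PiName.under_shift, PiName.single_of_ne (PiName.shift_ne_zero _),
      PiName.single_of_ne (PiName.shift_ne_zero _)]

/-- The map `f` may identify names and so add up their counts, but a sum of counts vanishes exactly
when all of them do. -/
theorem PiProc.linear_map {k m : ℕ} (P : PiProc k) (f : PiName k → PiName m)
    (Γ : PiName m → PiSort) :
    (∀ y, Γ y = .linear → (P.map f).count (PiName.single y) = 0) ↔
      ∀ y, Γ (f y) = .linear → P.count (PiName.single y) = 0 := by
  constructor
  · intro h y hy
    have := h _ hy
    rw [P.count_map] at this
    refine Nat.le_zero.1 (this ▸ P.count_le fun z => ?_)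
    by_cases hz : z = y
    · subst hz; simp
    · rw [PiName.single_of_ne hz]; exact Nat.zero_le _
  · intro h y hy
    rw [P.count_map]
    refine P.count_eq_zero _ fun z hz => h z ?_
    have : f z = y := by
      by_contra hne
      exact hz (PiName.single_of_ne hne)
    rw [this, hy]

theorem PiProc.linear_map_shift {k m : ℕ} (P : PiProc (k + 1)) (f : PiName k → PiName m)
    (Γ : PiName m → PiSort) :
    (∀ y, Γ y = .linear → (P.map (PiName.under f)).count (PiName.single y.shift) = 0) ↔
      ∀ y, Γ (f y) = .linear → P.count (PiName.single y.shift) = 0 := by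
  have key : ∀ {i : ℕ} (R : PiProc (i + 1)) (Δ : PiName i → PiSort),
      (∀ y, Δ y = .linear → R.count (PiName.single y.shift) = 0) ↔
        ∀ y, PiName.ext Δ .ordinary y = .linear → R.count (PiName.single y) = 0 := by
    intro i R Δ
    constructor
    · intro h y hy
      rcases y.exists_shift with rfl | ⟨y, rfl⟩
      · cases hy
      · exact h y (by simpa using hy)
    · intro h y hy
      exact h _ (by simpa using hy)
  rw [key, P.linear_map]
  refine Iff.trans ?_ (key P (Γ ∘ f)).symm
  rw [← PiName.ext_under]
  rfl

theorem PiProc.typed_map : ∀ {k m : ℕ} (P : PiProc k) (f : PiName k → PiName m)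
    (Γ : PiName m → PiSort), (P.map f).Typed Γ ↔ P.Typed (Γ ∘ f)
  | _, _, .nil, _, _ => .rfl
  | _, _, .par P Q, f, Γ => by rw [map, Typed, Typed, P.typed_map, Q.typed_map]
  | _, _, .inp x P, f, Γ => by
      have h := P.linear_map_shift f Γ
      simp only [P.count_map] at h
      simp only [map, Typed, P.typed_map, PiName.ext_under, h, P.count_map,
        PiName.single_zero_under, Function.comp_apply]
  | _, _, .out x z, f, Γ => .rfl
  | _, _, .res P, f, Γ => by
      simp only [map, Typed, P.typed_map, PiName.ext_under, P.count_map, PiName.single_zero_under]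
  | _, _, .repl P, f, Γ => by
      simp only [map, Typed, P.typed_map, P.linear_map, Function.comp_apply]

/-! ### Subject reduction -/

theorem PiName.ext_ext_swap {k : ℕ} {α : Type} (Γ : PiName k → α) (s t : α) :
    PiName.ext (PiName.ext Γ s) t ∘ PiName.swap = PiName.ext (PiName.ext Γ t) s := by
  funext y
  rcases y with a | i
  · rfl
  · refine Fin.cases ?_ (fun i => Fin.cases ?_ (fun i => ?_) i) i
    · simp [PiName.swap, PiName.ext]; rfl
    · simp [PiName.swap, PiName.ext]; rfl
    · have : Equiv.swap (0 : Fin (k + 2)) 1 i.succ.succ = i.succ.succ :=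
        Equiv.swap_apply_of_ne_of_ne (Fin.succ_ne_zero _) (by simp [Fin.ext_iff])
      simp only [Function.comp_apply, PiName.swap, this]
      rfl

theorem PiName.single_swap {k : ℕ} (i : Fin (k + 2)) :
    PiName.single (.bound i) ∘ PiName.swap = PiName.single (.bound (Equiv.swap 0 1 i)) := by
  funext y
  rcases y with a | j
  · simp [PiName.swap, PiName.single]
  · simp [PiName.swap, PiName.single, Equiv.swap_apply_eq_iff]

theorem PiName.comp_inst {k : ℕ} {α : Type} (z : PiName k) (g : PiName k → α) :
    g ∘ PiName.inst z = PiName.ext g (g z) := by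
  funext y
  rcases y with a | i
  · rfl
  · exact Fin.cases rfl (fun _ => rfl) i

/-- Unfolding a replication doubles the counts, so for arbitrary processes only vanishing is
invariant. This is what the untyped bodies of linear inputs require. -/
theorem PiStruct.count_eq_zero_iff {k : ℕ} {P Q : PiProc k} (h : PiStruct P Q) :
    ∀ g : PiName k → ℕ, P.count g = 0 ↔ Q.count g = 0 := by
  induction h with
  | refl => exact fun _ => .rfl
  | symm _ ih => exact fun g => (ih g).symm
  | trans _ _ ih ih' => exact fun g => (ih g).trans (ih' g)
  | par _ _ ih ih' => intro g; simp only [PiProc.count, Nat.add_eq_zero_iff, ih, ih']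
  | inp _ _ ih => intro g; simp only [PiProc.count, Nat.add_eq_zero_iff, ih]
  | res _ ih => exact fun g => ih _
  | repl _ ih => exact ih
  | par_nil => exact fun g => .rfl
  | par_comm => intro g; simp only [PiProc.count, add_comm]
  | par_assoc => intro g; simp only [PiProc.count, add_assoc]
  | res_nil => exact fun g => .rfl
  | res_swap P =>
    intro g
    simp only [PiProc.count, P.count_map, PiName.ext_ext_swap]
  | repl_unfold => intro g; simp only [PiProc.count, Nat.add_eq_zero_iff, and_self]
  | res_par P Q =>
    intro g
    simp only [PiProc.count, PiProc.weaken, Q.count_map, PiName.ext_comp_shift]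

/-- A typed replication contains no linear name of the environment, so unfolding preserves the exact
counts of those. Both assertions are proved together: typing a binder refers to the count of its
name, and that count is invariant only in typed processes. -/
theorem PiStruct.typed {k : ℕ} {P Q : PiProc k} (h : PiStruct P Q) : ∀ Γ : PiName k → PiSort,
    (P.Typed Γ ↔ Q.Typed Γ) ∧ (P.Typed Γ → ∀ y, Γ y = .linear →
      P.count (PiName.single y) = Q.count (PiName.single y)) := by
  induction h with
  | refl => exact fun _ => ⟨.rfl, fun _ _ _ => rfl⟩
  | symm _ ih => exact fun Γ => ⟨(ih Γ).1.symm, fun h y hy => ((ih Γ).2 ((ih Γ).1.2 h) y hy).symm⟩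
  | trans _ _ ih ih' =>
    exact fun Γ => ⟨(ih Γ).1.trans (ih' Γ).1, fun h y hy =>
      ((ih Γ).2 h y hy).trans ((ih' Γ).2 ((ih Γ).1.1 h) y hy)⟩
  | par _ _ ih ih' =>
    intro Γ
    refine ⟨and_congr (ih Γ).1 (ih' Γ).1, fun h y hy => ?_⟩
    rw [PiProc.count, PiProc.count, (ih Γ).2 h.1 y hy, (ih' Γ).2 h.2 y hy]
  | @inp k x P P' h ih =>
    intro Γ
    have hz := h.count_eq_zero_iff
    constructor
    · refine or_congr (and_congr .rfl (ih _).1) (or_congr (and_congr .rfl ?_) ?_)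
      · constructor
        · rintro ⟨h₁, h₂⟩
          exact ⟨(ih _).1.1 h₁, ((ih _).2 h₁ (.bound 0) rfl) ▸ h₂⟩
        · rintro ⟨h₁, h₂⟩
          have h₁ := (ih _).1.2 h₁
          exact ⟨h₁, ((ih _).2 h₁ (.bound 0) rfl) ▸ h₂⟩
      · simp only [hz]
    · rintro (⟨_, h₁⟩ | ⟨_, h₁, _⟩ | ⟨_, h₁⟩) y hy
      · rw [PiProc.count, PiProc.count, PiName.ext_single, (ih _).2 h₁ _ (by simpa using hy)]
      · rw [PiProc.count, PiProc.count, PiName.ext_single, (ih _).2 h₁ _ (by simpa using hy)]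
      · rw [PiProc.count, PiProc.count, PiName.ext_single, h₁ y hy, (hz _).1 (h₁ y hy)]
  | @res k P P' h ih =>
    intro Γ
    constructor
    · refine or_congr (ih _).1 ?_
      constructor
      · rintro ⟨h₁, h₂⟩
        exact ⟨(ih _).1.1 h₁, ((ih _).2 h₁ (.bound 0) rfl) ▸ h₂⟩
      · rintro ⟨h₁, h₂⟩
        have h₁ := (ih _).1.2 h₁
        exact ⟨h₁, ((ih _).2 h₁ (.bound 0) rfl) ▸ h₂⟩
    · rintro (h₁ | ⟨h₁, _⟩) y hy <;>
        rw [PiProc.count, PiProc.count, PiName.ext_single, (ih _).2 h₁ _ (by simpa using hy)]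
  | @repl k P P' h ih =>
    intro Γ
    have hz := h.count_eq_zero_iff
    constructor
    · simp only [PiProc.Typed, (ih Γ).1, hz]
    · intro h y hy
      exact (ih Γ).2 h.1 y hy
  | par_nil => exact fun Γ => ⟨⟨And.left, fun h => ⟨h, trivial⟩⟩, fun _ _ _ => rfl⟩
  | par_comm => exact fun Γ => ⟨and_comm, fun _ _ _ => add_comm _ _⟩
  | par_assoc => exact fun Γ => ⟨and_assoc, fun _ _ _ => add_assoc _ _ _⟩
  | res_nil => exact fun Γ => ⟨⟨fun _ => trivial, fun _ => .inl trivial⟩, fun _ _ _ => rfl⟩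
  | @res_swap k P =>
    intro Γ
    have h₀ : ∀ s t, PiName.ext (PiName.ext Γ s) t ∘ PiName.swap = PiName.ext (PiName.ext Γ t) s :=
      PiName.ext_ext_swap Γ
    have h₁ : PiName.single (.bound 0) ∘ PiName.swap (k := k) = PiName.single (.bound 1) :=
      PiName.single_swap 0
    have h₂ : PiName.single (.bound 1) ∘ PiName.swap (k := k) = PiName.single (.bound 0) :=
      PiName.single_swap 1
    have h₃ : ∀ R : PiProc (k + 2), R.res.count (PiName.single (.bound 0)) =
        R.count (PiName.single (.bound 1)) := fun R => by
      rw [PiProc.count, PiName.ext_single]; rfl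
    constructor
    · simp only [PiProc.Typed, h₃, PiProc.typed_map, h₀, PiProc.count_map, h₁, h₂]
      tauto
    · intro _ y _
      simp only [PiProc.count, P.count_map, PiName.ext_ext_swap]
  | repl_unfold P =>
    intro Γ
    refine ⟨⟨fun h => ⟨h.1, h⟩, And.right⟩, fun h y hy => ?_⟩
    simp only [PiProc.count, h.2 y hy]
  | res_par P Q =>
    intro Γ
    constructor
    · simp only [PiProc.Typed, PiProc.count, Q.count_weaken_zero, add_zero]
      simp only [PiProc.weaken, PiProc.typed_map, PiName.ext_comp_shift]
      tauto
    · intro _ y _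
      simp only [PiProc.count, PiProc.weaken, Q.count_map, PiName.ext_comp_shift]

/-- Subject reduction. On the fresh channel, the transmitted linear name loses its occurrence in the
output and gains at most one in the receiver. -/
theorem PiRed.typed {k : ℕ} {P P' : PiProc k} (h : PiRed P P') : ∀ Γ : PiName k → PiSort,
    P.Typed Γ → (∀ y, Γ y = .linear → P.count (PiName.single y) ≤ 1) →
    P'.Typed Γ ∧ ∀ y, Γ y = .linear → P'.count (PiName.single y) ≤ P.count (PiName.single y) := by
  induction h with
  | com x z P =>
    intro Γ ⟨hi, ho⟩ hl
    have hext : ∀ g : PiName _ → ℕ, g ∘ PiName.inst z = PiName.ext g (g z) := PiName.comp_inst _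
    have hext' : Γ ∘ PiName.inst z = PiName.ext Γ (Γ z) := PiName.comp_inst _ _
    have hne : ∀ y, Γ y ≠ Γ z → P.count (PiName.single y ∘ PiName.inst z) =
        P.count (PiName.single y.shift) := by
      intro y hy
      rw [hext, PiName.single_of_ne (fun h => hy (congrArg Γ h.symm)), PiName.ext_single]
    rw [PiProc.subst, P.typed_map, hext']
    simp only [P.count_map]
    rcases hi with ⟨hx, hP⟩ | ⟨hx, hP, hc⟩ | ⟨hx, hP⟩ <;>
      rcases ho with ⟨hx', hz⟩ | ⟨hx', hz⟩ | ⟨hx', hz⟩ <;>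
      first
      | (rw [hx] at hx'; cases hx'; done)
      | skip
    · refine ⟨by rwa [hz], fun y hy => ?_⟩
      rw [hne y (by rw [hy, hz]; exact nofun), PiProc.count, PiProc.count, PiName.ext_single]
      omega
    · refine ⟨by rwa [hz], fun y hy => ?_⟩
      by_cases hyz : y = z
      · subst hyz
        have : (PiName.single y ∘ PiName.inst y : PiName _ → ℕ) =
            PiName.single y.shift + PiName.single (.bound 0) := by
          rw [hext, PiName.single_self]
          funext w
          rcases w.exists_shift with rfl | ⟨w, rfl⟩
          · simp [PiName.single_of_ne (PiName.shift_ne_zero _).symm]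
          · rw [PiName.ext_shift, Pi.add_apply, PiName.single_of_ne (PiName.shift_ne_zero _),
              ← PiName.ext_single, PiName.ext_shift, add_zero]
        rw [this, P.count_add]
        simp only [PiProc.count, PiName.ext_single, PiName.single_self]
        omega
      · rw [hext, PiName.single_of_ne (Ne.symm hyz), PiProc.count, PiProc.count]
        omega
    -- A communication on a linear channel would require two occurrences of it.
    · have := hl x hx
      simp only [PiProc.count, PiName.single_self] at this
      omega
  | par Q _ ih =>
    intro Γ ⟨hP, hQ⟩ hl
    simp only [PiProc.count] at hl ⊢
    obtain ⟨h₁, h₂⟩ := ih Γ hP fun y hy => (Nat.le_add_right _ _).trans (hl y hy)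
    exact ⟨⟨h₁, hQ⟩, fun y hy => Nat.add_le_add_right (h₂ y hy) _⟩
  | res _ ih =>
    intro Γ hP hl
    simp only [PiProc.count, PiName.ext_single] at hl ⊢
    rcases hP with hP | ⟨hP, h₀⟩
    · obtain ⟨h₁, h₂⟩ := ih _ hP fun y hy => by
        rcases y.exists_shift with rfl | ⟨y, rfl⟩
        · cases hy
        · exact hl y (by simpa using hy)
      exact ⟨.inl h₁, fun y hy => h₂ _ (by simpa using hy)⟩
    · obtain ⟨h₁, h₂⟩ := ih _ hP fun y hy => by
        rcases y.exists_shift with rfl | ⟨y, rfl⟩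
        · exact h₀
        · exact hl y (by simpa using hy)
      exact ⟨.inr ⟨h₁, (h₂ _ rfl).trans h₀⟩, fun y hy => h₂ _ (by simpa using hy)⟩
  | struct h _ h' ih =>
    intro Γ hP hl
    have hP₁ := (h.typed Γ).1.1 hP
    have e := (h.typed Γ).2 hP
    obtain ⟨h₁, h₂⟩ := ih Γ hP₁ fun y hy => (e y hy) ▸ hl y hy
    exact ⟨(h'.typed Γ).1.1 h₁, fun y hy => ((h'.typed Γ).2 h₁ y hy) ▸ (e y hy) ▸ h₂ y hy⟩

-- Dead channels of typed processes and failure of the test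

theorem PiProc.Typed.not_barb {N : Set ℕ} {k : ℕ} {P : PiProc k} {o : Obs ℕ}
    (h : PiBarb N P o) : ∀ {Γ : PiName k → PiSort}, P.Typed Γ → ∀ {x : ℕ}, Γ (.free x) = .dead →
    o ≠ .out x := by
  induction h with
  | out z _ =>
    rintro Γ hP x hx ⟨⟩
    rcases hP with ⟨h, _⟩ | ⟨h, _⟩ | ⟨h, _⟩ <;> rw [hx] at h <;> cases h
  | inp => exact fun _ _ _ => nofun
  | par_left _ _ ih => exact fun hP _ hx => ih hP.1 hx
  | par_right _ _ ih => exact fun hP _ hx => ih hP.2 hx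
  | res _ ih =>
    rintro Γ (hP | ⟨hP, _⟩) x hx
    exacts [ih hP hx, ih hP hx]
  | repl _ ih => exact fun hP _ hx => ih hP.1 hx

theorem PiProc.Typed.not_weakBarb {P : PiProc 0} {Γ : PiName 0 → PiSort} (hΓ : ∀ y, Γ y ≠ .linear)
    (hP : P.Typed Γ) {x : ℕ} (hx : Γ (.free x) = .dead) : ¬ PiWeakBarb P (.out x) := by
  rintro ⟨P', hr, ho⟩
  have : P'.Typed Γ := by
    clear ho
    induction hr with
    | refl => exact hP
    | tail _ hr ih => exact (hr.typed Γ ih fun y hy => (hΓ y hy).elim).1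
  exact PiProc.Typed.not_barb ho this hx rfl

/-- Processes over ordinary names, without restriction. -/
theorem PiProc.typed_of_ordinary : ∀ {k : ℕ} (P : PiProc k), P.NuFree →
    ∀ Γ : PiName k → PiSort, (∀ a ∈ P.fn, Γ (.free a) = .ordinary) →
    (∀ i, Γ (.bound i) = .ordinary) → (∀ y, Γ y ≠ .linear) → P.Typed Γ := by
  have name : ∀ {k : ℕ} (y : PiName k) (Γ : PiName k → PiSort),
      (∀ a ∈ y.fn, Γ (.free a) = .ordinary) → (∀ i, Γ (.bound i) = .ordinary) →
      Γ y = .ordinary := by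
    rintro k (a | i) Γ h h'
    exacts [h a (Finset.mem_singleton_self a), h' i]
  intro k P
  induction P with
  | nil => intros; trivial
  | par P Q ih ih' =>
    intro hν Γ hf hb hl
    simp only [fn, Finset.mem_union] at hf
    exact ⟨ih hν.1 Γ (fun a ha => hf a (.inl ha)) hb hl,
      ih' hν.2 Γ (fun a ha => hf a (.inr ha)) hb hl⟩
  | inp x P ih =>
    intro hν Γ hf hb hl
    simp only [fn, Finset.mem_union] at hf
    refine .inl ⟨name x Γ (fun a ha => hf a (.inl ha)) hb, ih hν _ (fun a ha => hf a (.inr ha)) ?_ ?_⟩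
    · exact fun i => Fin.cases rfl (fun i => hb i) i
    · intro y
      rcases y.exists_shift with rfl | ⟨y, rfl⟩
      · exact nofun
      · rw [PiName.ext_shift]; exact hl y
  | out x z =>
    intro hν Γ hf hb hl
    simp only [fn, Finset.mem_union] at hf
    exact .inl ⟨name x Γ (fun a ha => hf a (.inl ha)) hb, name z Γ (fun a ha => hf a (.inr ha)) hb⟩
  | res P ih => exact fun hν => hν.elim
  | repl P ih =>
    intro hν Γ hf hb hl
    exact ⟨ih hν Γ hf hb hl, fun y hy => (hl y hy).elim⟩

/-- The whole process is typed with `u` as channel of fresh names and `x` as dead channel. Each copy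
sends its own restricted name once, so that name may be linear. -/
theorem replNewPar_not_weakBarb {u x : ℕ} (o : ℕ) {Q : PiProc 0} (hux : u ≠ x) (hQ : Q.NuFree)
    (huQ : u ∉ Q.fn) (hxQ : x ∉ Q.fn) :
    ¬ PiWeakBarb (testContext u x o (replNewPar u Q)) (.out x) := by
  classical
  set Γ : PiName 0 → PiSort := fun y => if y = .free u then .fresh else
    if y = .free x then .dead else .ordinary with hΓ
  have hu : Γ (.free u) = .fresh := if_pos rfl
  have hx : Γ (.free x) = .dead := by
    rw [hΓ]
    simp [hux.symm]
  have hl : ∀ y, Γ y ≠ .linear := by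
    intro y
    simp only [hΓ]
    split_ifs <;> exact nofun
  have hP : (testContext u x o (replNewPar u Q)).Typed Γ := ?_
  · exact hP.not_weakBarb hl hx
  refine ⟨⟨⟨.inr ⟨?_, ?_⟩, ?_⟩, ?_⟩, ?_⟩
  · exact .inr (.inl ⟨hu, rfl⟩)
  · simp [PiProc.count, PiName.single]
  · refine Q.typed_of_ordinary hQ Γ (fun a ha => ?_) (fun i => i.elim0) hl
    simp only [hΓ]
    rw [if_neg, if_neg]
    · rintro ⟨⟩; exact hxQ ha
    · rintro ⟨⟩; exact huQ ha
  · exact fun y hy => (hl y hy).elim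
  -- Both names received on `u` are linear: the first is used once, as an output channel, the second
  -- once, as an input channel guarding the output on `x`, which thus escapes typing.
  · refine .inr (.inl ⟨hu, .inr (.inl ⟨hu, ⟨.inr (.inr ⟨rfl, hl _⟩), .inr (.inr ⟨rfl, ?_⟩)⟩, ?_⟩), ?_⟩)
    · rintro (a | i) h
      · exact (hl (.free a) h).elim
      · simp [PiProc.count, PiName.single, PiName.shift]
    · simp [PiProc.count, PiName.single, PiName.ext]
    · simp [PiProc.count, PiName.ext_single, PiName.single, PiName.shift]

-- Failure of full abstraction

theorem mainTheorem8 (φ : ℕ → RhoName) (hφ : ∀ a b : ℕ, RhoNameEq (φ a) (φ b) → a = b) :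
    -- the first pair refutes the implication from right to left
    (∀ (u x o : ℕ) (Q : PiProc 0), u ≠ x → Q.NuFree → u ∉ Q.fn → x ∉ Q.fn →
      ¬ PiWeakBarb (testContext u x o (replNewPar u Q)) (.out x) ∧
      PiWeakBarb (testContext u x o (newReplPar u Q)) (.out x) ∧
      ¬ PiWeakBisim (testContext u x o (replNewPar u Q)) (testContext u x o (newReplPar u Q)) ∧
      EncodeBisim φ (testContext u x o (replNewPar u Q)) (testContext u x o (newReplPar u Q))) ∧
    -- the second pair refutes the implication from left to right
    (∀ u x o : ℕ, u ≠ x →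
      PiStruct (replNew u) (replNewNew u) ∧
      PiWeakBisim (replNew u) (replNewNew u) ∧
      PiWeakBisim (testContext u x o (replNew u)) (testContext u x o (replNewNew u)) ∧
      ¬ EncodeBisim φ (testContext u x o (replNew u)) (testContext u x o (replNewNew u))) ∧
    -- hence both implications of the claimed full abstraction fail
    (¬ ∀ P₁ P₂ : PiProc 0, EncodeBisim φ P₁ P₂ → PiWeakBisim P₁ P₂) ∧
    (¬ ∀ P₁ P₂ : PiProc 0, PiWeakBisim P₁ P₂ → EncodeBisim φ P₁ P₂) := by
  have first : ∀ (u x o : ℕ) (Q : PiProc 0), u ≠ x → Q.NuFree → u ∉ Q.fn → x ∉ Q.fn →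
      ¬ PiWeakBisim (testContext u x o (replNewPar u Q)) (testContext u x o (newReplPar u Q)) :=
    fun u x o Q hux hQ huQ hxQ h => replNewPar_not_weakBarb o hux hQ huQ hxQ
      (WeakBarbedBisimilar.weakBarb (WeakBarbedBisimilar.symm h) (newReplPar_weakBarb u x o Q))
  have second : ∀ u x o : ℕ,
      PiWeakBisim (testContext u x o (replNew u)) (testContext u x o (replNewNew u)) :=
    fun u x o => ((replNew_struct u).par (.refl _)).bisim
  refine ⟨fun u x o Q hux hQ huQ hxQ => ⟨replNewPar_not_weakBarb o hux hQ huQ hxQ,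
    newReplPar_weakBarb u x o Q, first u x o Q hux hQ huQ hxQ,
    encodeBisim_newPar φ hφ o hux hQ huQ hxQ⟩, fun u x o hux => ⟨replNew_struct u,
    (replNew_struct u).bisim, second u x o, not_encodeBisim_new φ hφ o hux⟩, fun h => ?_,
    fun h => ?_⟩
  -- The empty process is already a suitable `Q`.
  · exact first 0 1 2 .nil zero_ne_one trivial (Finset.notMem_empty _) (Finset.notMem_empty _)
      (h _ _ (encodeBisim_newPar φ hφ 2 zero_ne_one trivial (Finset.notMem_empty _)
        (Finset.notMem_empty _)))
  · exact not_encodeBisim_new φ hφ 2 zero_ne_one (h _ _ (second 0 1 2))
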